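/- For an integer $Q\ge 1$ let $\mathcal F_Q$ be the set of Farey fractions of order $Q$, i.e. of reduced fractions $a/q$ with $0<a\le q\le Q$. Write $e(x)=e^{2\pi i x}$, let $A=\big(e(n\theta)\big)_{\theta\in\mathcal F_Q,\,1\le n\le N}$, and let $\lambda_1,\dots,\lambda_N\ge 0$ be the eigenvalues, with multiplicity, of the $N\times N$ matrix $A^{\star}A$. Put $$\mu_{Q,N}=\frac1N\sum_{i\le N}\delta_{\lambda_i/N}.$$ Let $\operatorname{sinc}(x)=\frac{\sin x}{x}$ for $x\ne 0$ and $\operatorname{sinc}(0)=1$, let $h_{A,B}(x,y)=\frac{B}{y(Ay-Bx)}$, and for $\mathbf A=(A_1,\dots,A_{\ell-1})$, $\mathbf B=(B_1,\dots,B_{\ell-1})$ in $\mathbb Z^{\ell-1}$ let $$\mathcal D_{\mathbf A,\mathbf B}=\{(x,y):0\le x\le y\le 1,\ 0<A_iy-B_ix\le 1\text{ for all } i\}.$$ For $\alpha>0$ put $M_0(\alpha)=1$, $M_1(\alpha)=\frac{3}{\pi^2\alpha}$ and, for $\ell\ge 2$, $$M_\ell(\alpha)=\frac{6}{\pi^2\alpha}\sum_{\mathbf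 A,\mathbf B}\iint_{\mathcal D_{\mathbf A,\mathbf B}}\operatorname{sinc}\big(\pi\alpha h_{A_1,B_1}\big)\operatorname{sinc}\big(\pi\alpha h_{A_{\ell-1},B_{\ell-1}}\big)\prod_{i=1}^{\ell-2}\operatorname{sinc}\big(\pi\alpha h_{A_i,B_i}-\pi\alpha h_{A_{i+1},B_{i+1}}\big)\,dx\,dy,$$ where the functions $h_{A_i,B_i}$ are evaluated at $(x,y)$ and the sum is over all $\mathbf A,\mathbf B\in\mathbb Z^{\ell-1}$ with $\gcd(A_i,B_i)=1$ for all $i$ (with $\gcd(a,0)=\gcd(0,a)=|a|$, so $(A_i,B_i)\neq(0,0)$). Let $0<\alpha<\infty$. Then for every $\ell\ge2$ the expression defining $M_\ell(\alpha)$ is absolutely convergent, and there is a probability measure $\mu_\alpha$ on $[0,\infty)$ such that: 1. if $N=N(Q)\sim\alpha Q^2$ as $Q\to\infty$, then $\mu_{Q,N}\to\mu_\alpha$ weakly (weak$^*$) as $Q\to\infty$; 2. $\int_0^\infty t^\ell\,d\mu_\alpha(t)=M_\ell(\alpha)$ for every integer $\ell\ge 0$, all these integrals being absolutely convergent; 3.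 $\mu_\alpha$ is determined by its moments: every probability measure on $\mathbb R$ whose moments of all orders $\ell\ge0$ exist and equal $M_\ell(\alpha)$ is equal to $\mu_\alpha$; 4. $\mu_\alpha$ is non-degenerate: its variance is positive. -/

import Mathlib

open MeasureTheory Filter Topology Asymptotics
open scoped NNReal Matrix

noncomputable section

namespace LargeSieve

/-- The set `F_Q` of Farey fractions of order `Q`: the reduced fractions `a / q` with
`0 < a ≤ q ≤ Q`. -/
def farey (Q : ℕ) : Finset ℚ :=
  ((Finset.Icc 1 Q ×ˢ Finset.Icc 1 Q).filter
    (fun p => p.1 ≤ p.2 ∧ Nat.Coprime p.1 p.2)).image (fun p => (p.1 : ℚ) / (p.2 : ℚ))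

/-- `e(x) = exp(2 π i x)`. -/
def e (x : ℝ) : ℂ := Complex.exp (2 * Real.pi * Complex.I * x)

/-- The matrix `A = (e(n θ))` with rows indexed by `θ ∈ F_Q` and columns by `1 ≤ n ≤ N`; the
column index `j : Fin N` stands for `n = j + 1`. -/
def sieveMatrix (Q N : ℕ) : Matrix (farey Q) (Fin N) ℂ :=
  Matrix.of fun θ j => e (((j : ℕ) + 1 : ℝ) * ((θ : ℚ) : ℝ))

/-- The eigenvalues of the large sieve matrix `A⋆ A`, repeated according to multiplicity. -/
def sieveEigenvalue (Q N : ℕ) : Fin N → ℝ :=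
  (Matrix.isHermitian_conjTranspose_mul_self (sieveMatrix Q N)).eigenvalues

/-- The scaled eigenvalue distribution `μ_{Q,N} = (1/N) ∑_{i ≤ N} δ_{λ_i / N}`, a probability
measure whenever `0 < N`. -/
def eigenvalueDist (Q N : ℕ) : FiniteMeasure ℝ :=
  ⟨(N : ℝ≥0)⁻¹ • ∑ i : Fin N, Measure.dirac (sieveEigenvalue Q N i / (N : ℝ)), inferInstance⟩

/-- `h_{A,B}(x,y) = B / (y (A y - B x))`. -/
def h (A B : ℤ) (p : ℝ × ℝ) : ℝ := B / (p.2 * (A * p.2 - B * p.1))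

/-- `D_{A,B} = {(x,y) : 0 ≤ x ≤ y ≤ 1, 0 < A_i y - B_i x ≤ 1 for all i}`. -/
def domain {m : ℕ} (A B : Fin m → ℤ) : Set (ℝ × ℝ) :=
  {p | 0 ≤ p.1 ∧ p.1 ≤ p.2 ∧ p.2 ≤ 1 ∧
    ∀ i, 0 < (A i : ℝ) * p.2 - B i * p.1 ∧ (A i : ℝ) * p.2 - B i * p.1 ≤ 1}

/-- The integrand of the moment of order `ℓ = k + 2` (so that there are `ℓ - 1 = k + 1` pairs
`(A_i, B_i)`):
`sinc(π α h_1) sinc(π α h_{ℓ-1}) ∏_{i=1}^{ℓ-2} sinc(π α h_i - π α h_{i+1})`,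
where `h_i = h_{A_i,B_i}(x,y)`. -/
def integrand {k : ℕ} (α : ℝ) (A B : Fin (k + 1) → ℤ) (p : ℝ × ℝ) : ℝ :=
  Real.sinc (Real.pi * α * h (A 0) (B 0) p) *
    Real.sinc (Real.pi * α * h (A (Fin.last k)) (B (Fin.last k)) p) *
    ∏ i : Fin k, Real.sinc (Real.pi * α * h (A i.castSucc) (B i.castSucc) p -
      Real.pi * α * h (A i.succ) (B i.succ) p)

/-- The range of summation: pairs `(A, B)` of integer vectors of length `m` with
`gcd(A_i, B_i) = 1` for all `i`, where `gcd(a, 0) = gcd(0, a) = |a|`; in particular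
`(A_i, B_i) ≠ (0, 0)`. -/
def Index (m : ℕ) : Type :=
  {AB : (Fin m → ℤ) × (Fin m → ℤ) // ∀ i, Int.gcd (AB.1 i) (AB.2 i) = 1}

/-- The moments `M_ℓ(α)`: `M_0 = 1` (total mass), `M_1 = 3 / (π² α)`, and for `ℓ ≥ 2`
`M_ℓ(α) = (6 / (π² α)) ∑_{A,B} ∬_{D_{A,B}} (integrand) dx dy`. -/
def M : ℕ → ℝ → ℝ
  | 0, _ => 1
  | 1, α => 3 / (Real.pi ^ 2 * α)
  | k + 2, α => 6 / (Real.pi ^ 2 * α) *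
      ∑' AB : Index (k + 1), ∫ p in domain AB.1.1 AB.1.2, integrand α AB.1.1 AB.1.2 p

/-- The expression defining `M_{k+2}(α)` is absolutely convergent. -/
def AbsConvergent (k : ℕ) (α : ℝ) : Prop :=
  (∀ AB : Index (k + 1), IntegrableOn (integrand α AB.1.1 AB.1.2) (domain AB.1.1 AB.1.2)) ∧
    Summable fun AB : Index (k + 1) =>
      ∫ p in domain AB.1.1 AB.1.2, |integrand α AB.1.1 AB.1.2 p|

/-- All moments `∫ t ^ ℓ dν`, `ℓ ≥ 0`, exist (as absolutely convergent integrals) and are equal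
to `M_ℓ(α)`. -/
def HasMoments (α : ℝ) (ν : ProbabilityMeasure ℝ) : Prop :=
  ∀ ℓ : ℕ, Integrable (fun t : ℝ => t ^ ℓ) (ν : Measure ℝ) ∧
    ∫ t, t ^ ℓ ∂(ν : Measure ℝ) = M ℓ α

end LargeSieve

end

open MeasureTheory Filter Topology Asymptotics
open scoped NNReal Matrix

noncomputable section

namespace LargeSieve

open scoped ENNReal

/-! The proof is the method of moments. The nonzero eigenvalues of `A⋆A` and `AA⋆` agree, and the
entries of `AA⋆` are Dirichlet kernels at differences of Farey fractions. The `ℓ`-th moment is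
therefore a sum over closed walks of length `ℓ` in the Farey fractions, weighted by products of
normalised Dirichlet kernels.

A walk starting at `a/q` is described by the primitive point `(x, q)`, where `x` is the inverse of
`a` modulo `q`. Acting with a matrix of determinant one turns the other Farey fractions, modulo one,
into coprime pairs `(A, B)`: the new fraction has denominator `Aq - Bx` and differs from `a/q` by `B
/ (q (Aq - Bx))`. After scaling by `1/Q` this difference is `h_{A,B} / Q²` (`exists_window_equiv`).
For a fixed tuple of pairs the kernels tend to cardinal sines times phases, the phases cancel around
a closed walk (`chain_psi`), and equidistribution of primitive points with density `6/π²`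
(`tendsto_primitive_sum`) turns the average over starting points into an integral over `D_{A,B}`.

The limit and the sum over tuples must be exchanged although the kernel decays only like the inverse
of the distance, so that its row sums diverge logarithmically. A closed walk has one more edge than
it has free vertices. The smallest factor is bounded by the geometric mean of the others, which
raises their exponent above one; as the offsets are `1`-separated (`one_le_abs_offset_sub`), every
sum converges (`tsum_chain_le`). There is room to gain a power of a small edge
(`tsum_chain_small_edge_le`), and a tuple leaving a finite set must have a small edge
(`exists_small_edge`); hence the tails are small uniformly in `Q`.

A large sieve inequality (`sieveEigenvalue_le`) confines all scaled eigenvalues to a fixed compact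
interval. There, compactness provides a measure with the limiting moments, and polynomial
approximation gives both weak convergence and determinacy.

For non-degeneracy, zero variance would force `M 2 = (M 1)²` and `M 3 = (M 1)³`. These moments are
averages over the triangle of diagonal values of the square and the cube of the positive
semidefinite kernel `sinc`. Cauchy-Schwarz (`sq_momentDensity_le`) then makes the first density
constant, whereas it tends to `1` at the origin and exceeds `1` elsewhere. -/

/-! ### Sums of products of a kernel along paths -/

/-- The path `u, t 0, …, t (n - 1), v`. -/
def path {I : Type*} {n : ℕ} (u : I) (t : Fin n → I) (v : I) : Fin (n + 2) → I :=
  Fin.cons u (Fin.snoc t v : Fin (n + 1) → I)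

/-- The product of a kernel over the edges of the path from `u` to `v` through `t`. -/
def chain {I R : Type*} [CommMonoid R] {n : ℕ} (g : I → I → R) (u : I) (t : Fin n → I) (v : I) :
    R :=
  ∏ i : Fin (n + 1), g (path u t v i.castSucc) (path u t v i.succ)

theorem path_cons {I : Type*} {n : ℕ} (u a : I) (t : Fin n → I) (v : I) :
    path u (Fin.cons a t : Fin (n + 1) → I) v = Fin.cons u (path a t v) := by
  funext i
  refine Fin.cases rfl (fun j => ?_) i
  exact congrFun (Fin.cons_snoc_eq_snoc_cons a t v).symm j

theorem chain_cons {I R : Type*} [CommMonoid R] {n : ℕ} (g : I → I → R) (u a : I) (t : Fin n → I)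
    (v : I) : chain g u (Fin.cons a t : Fin (n + 1) → I) v = g u a * chain g a t v := by
  unfold chain
  rw [Fin.prod_univ_succ, path_cons]
  simp only [Fin.castSucc_zero, Fin.cons_zero, Fin.cons_succ, ← Fin.succ_castSucc]
  rfl

theorem chain_zero {I R : Type*} [CommMonoid R] (g : I → I → R) (u : I) (t : Fin 0 → I) (v : I) :
    chain g u t v = g u v := by
  simp [chain, path, Fin.snoc]

theorem chain_eq {I R : Type*} [CommMonoid R] {k : ℕ} (g : I → I → R) (u : I)
    (t : Fin (k + 1) → I) (v : I) :
    chain g u t v = g u (t 0) * g (t (Fin.last k)) v *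
      ∏ i : Fin k, g (t i.castSucc) (t i.succ) := by
  induction k generalizing u with
  | zero =>
    obtain ⟨a, s, rfl⟩ : ∃ a, ∃ s : Fin 0 → I, t = Fin.cons a s :=
      ⟨t 0, Fin.tail t, (Fin.cons_self_tail t).symm⟩
    rw [chain_cons, chain_zero]
    simp
  | succ k ih =>
    obtain ⟨a, s, rfl⟩ : ∃ a, ∃ s : Fin (k + 1) → I, t = Fin.cons a s :=
      ⟨t 0, Fin.tail t, (Fin.cons_self_tail t).symm⟩
    rw [chain_cons, ih, Fin.prod_univ_succ, ← Fin.succ_last]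
    simp only [Fin.castSucc_zero, Fin.cons_zero, Fin.cons_succ, ← Fin.succ_castSucc]
    simp only [mul_assoc, mul_left_comm]

theorem tsum_cons {I : Type*} {n : ℕ} (f : (Fin (n + 1) → I) → ℝ≥0∞) :
    ∑' t, f t = ∑' a, ∑' t : Fin n → I, f (Fin.cons a t : Fin (n + 1) → I) := by
  rw [← (Fin.consEquiv (fun _ : Fin (n + 1) => I)).tsum_eq, ENNReal.tsum_prod']
  rfl

/-- Only the end `v` is fixed, so the vertices can be summed out in turn from the free end, each at
the cost of one column sum. -/
theorem tsum_tsum_chain_le {I : Type*} (g : I → I → ℝ≥0∞) (C : ℝ≥0∞)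
    (hcol : ∀ j, ∑' i, g i j ≤ C) (n : ℕ) (v : I) :
    ∑' a, ∑' t : Fin n → I, chain g a t v ≤ C ^ (n + 1) := by
  induction n with
  | zero => simpa [chain_zero, tsum_fintype] using hcol v
  | succ n ih =>
    calc ∑' a, ∑' t : Fin (n + 1) → I, chain g a t v
        = ∑' a, ∑' b, ∑' t : Fin n → I, g a b * chain g b t v := by
          simp_rw [tsum_cons, chain_cons]
      _ = ∑' b, ∑' a, ∑' t : Fin n → I, g a b * chain g b t v := ENNReal.tsum_comm
      _ = ∑' b, (∑' a, g a b) * ∑' t : Fin n → I, chain g b t v := by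
          simp_rw [ENNReal.tsum_mul_left, ENNReal.tsum_mul_right]
      _ ≤ ∑' b, C * ∑' t : Fin n → I, chain g b t v := by
          gcongr with b; exact hcol b
      _ ≤ C * C ^ (n + 1) := by rw [ENNReal.tsum_mul_left]; gcongr
      _ = C ^ (n + 1 + 1) := by ring

/-- Deleting the edge `e` cuts the path into two pieces, each tied to one of the fixed ends. The `n`
free vertices are summed out against the `n` remaining edges: row sums on the side of `u`, column
sums on the side of `v`. -/
theorem tsum_prod_erase_le {I : Type*} (g : I → I → ℝ≥0∞) (C : ℝ≥0∞)
    (hrow : ∀ i, ∑' j, g i j ≤ C) (hcol : ∀ j, ∑' i, g i j ≤ C) (n : ℕ) (e : Fin (n + 1))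
    (u v : I) :
    ∑' t : Fin n → I, ∏ i : Fin (n + 1),
      (if i = e then 1 else g (path u t v i.castSucc) (path u t v i.succ)) ≤ C ^ n := by
  induction n generalizing u with
  | zero => 
    have : e = 0 := by omega
    subst this
    simp [tsum_fintype]
  | succ n ih =>
    rw [tsum_cons]
    have key : ∀ a (t : Fin n → I), (∏ i : Fin (n + 1 + 1),
        (if i = e then 1 else g (path u (Fin.cons a t : Fin (n + 1) → I) v i.castSucc)
          (path u (Fin.cons a t : Fin (n + 1) → I) v i.succ)))
        = (if 0 = e then 1 else g u a) * ∏ i : Fin (n + 1),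
          (if i.succ = e then 1 else g (path a t v i.castSucc) (path a t v i.succ)) := by
      intro a t
      rw [Fin.prod_univ_succ, path_cons]
      simp only [Fin.castSucc_zero, Fin.cons_zero, Fin.cons_succ, ← Fin.succ_castSucc]
      rfl
    simp_rw [key]
    refine Fin.cases ?_ (fun e' => ?_) e
    · simpa [chain] using tsum_tsum_chain_le g C hcol n v
    · have h0 : ¬ ((0 : Fin (n + 1 + 1)) = e'.succ) := (Fin.succ_ne_zero e').symm
      simp only [h0, if_false, Fin.succ_inj, ENNReal.tsum_mul_left]
      calc _ ≤ ∑' a, g u a * C ^ n := by gcongr with a; exact ih e' a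
        _ ≤ C * C ^ n := by rw [ENNReal.tsum_mul_right]; gcongr; exact hrow u
        _ = C ^ (n + 1) := by ring

/-- The smallest of the `n + 2` factors is at most the geometric mean of the other `n + 1`, so it
can be traded for an extra exponent `1 / (n + 1)` on each of them. Summing over `e` avoids having to
know where the minimum is. -/
theorem prod_le_sum_prod_rpow {n : ℕ} (x : Fin (n + 2) → ℝ≥0∞) :
    ∏ i, x i ≤ ∑ e, ∏ i, (if i = e then 1 else x i ^ (((n : ℝ) + 2) / (n + 1))) := by
  obtain ⟨e, -, he⟩ := Finset.exists_min_image Finset.univ x Finset.univ_nonempty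
  refine le_trans ?_ (Finset.single_le_sum (fun _ _ => zero_le) (Finset.mem_univ e))
  set Y := ∏ i ∈ Finset.univ.erase e, x i with hY
  have hn : (0 : ℝ) < n + 1 := by positivity
  have h1 : x e ^ (n + 1) ≤ Y := by
    have := Finset.prod_le_prod' (s := Finset.univ.erase e) (f := fun _ => x e) (g := x)
      (fun i _ => he i (Finset.mem_univ i))
    simpa [Finset.card_erase_of_mem] using this
  have h2 : x e ≤ Y ^ (1 / ((n : ℝ) + 1)) := by
    rw [one_div, ENNReal.le_rpow_inv_iff hn]
    exact_mod_cast h1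
  rw [← Finset.mul_prod_erase _ _ (Finset.mem_univ e), 
    ← Finset.mul_prod_erase Finset.univ (fun i => if i = e then (1 : ℝ≥0∞) else _)
      (Finset.mem_univ e), if_pos rfl, one_mul]
  calc x e * Y ≤ Y ^ (1 / ((n : ℝ) + 1)) * Y ^ (1 : ℝ) := by
        rw [ENNReal.rpow_one]; gcongr
    _ = Y ^ (((n : ℝ) + 2) / (n + 1)) := by
        rw [← ENNReal.rpow_add_of_nonneg _ _ (by positivity) (by norm_num)]
        congr 1; field_simp; ring
    _ = ∏ i ∈ Finset.univ.erase e, x i ^ (((n : ℝ) + 2) / (n + 1)) := by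
        rw [hY, ENNReal.prod_rpow_of_nonneg (by positivity)]
    _ = _ := by
        refine Finset.prod_congr rfl fun i hi => ?_
        rw [if_neg (Finset.ne_of_mem_erase hi)]

/-- With both ends fixed there is one edge more than there are free vertices. The spare edge raises
the exponent of the others to `(n + 2) / (n + 1) > 1`, which makes row sums of a kernel decaying
like the inverse distance finite. -/
theorem tsum_chain_le {I : Type*} (g : I → I → ℝ≥0∞) (C : ℝ≥0∞) (n : ℕ)
    (hrow : ∀ i, ∑' j, g i j ^ (((n : ℝ) + 2) / (n + 1)) ≤ C)
    (hcol : ∀ j, ∑' i, g i j ^ (((n : ℝ) + 2) / (n + 1)) ≤ C) (u v : I) :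
    ∑' t : Fin (n + 1) → I, chain g u t v ≤ (n + 2) * C ^ (n + 1) := by
  calc ∑' t : Fin (n + 1) → I, chain g u t v
      ≤ ∑' t : Fin (n + 1) → I, ∑ e : Fin (n + 2), ∏ i : Fin (n + 2), (if i = e then 1 else
          (g (path u t v i.castSucc) (path u t v i.succ)) ^ (((n : ℝ) + 2) / (n + 1))) :=
        ENNReal.tsum_le_tsum fun t => prod_le_sum_prod_rpow _
    _ = ∑ e : Fin (n + 2), ∑' t : Fin (n + 1) → I, ∏ i : Fin (n + 2), (if i = e then 1 else
          (g (path u t v i.castSucc) (path u t v i.succ)) ^ (((n : ℝ) + 2) / (n + 1))) :=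
        Summable.tsum_finsetSum fun _ _ => ENNReal.summable
    _ ≤ ∑ e : Fin (n + 2), C ^ (n + 1) := by
        refine Finset.sum_le_sum fun e _ => ?_
        exact tsum_prod_erase_le (fun i j => g i j ^ (((n : ℝ) + 2) / (n + 1))) C hrow hcol (n + 1)
          e u v
    _ = (n + 2) * C ^ (n + 1) := by simp

/-- Paths with a small edge contribute little. -/
theorem tsum_chain_small_edge_le {I : Type*} (g : I → I → ℝ≥0∞) (C : ℝ≥0∞) (n : ℕ)
    (hg : ∀ i j, g i j ≤ 1)
    (hrow : ∀ i, ∑' j, g i j ^ ((2 * (n : ℝ) + 3) / (2 * n + 2)) ≤ C)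
    (hcol : ∀ j, ∑' i, g i j ^ ((2 * (n : ℝ) + 3) / (2 * n + 2)) ≤ C) (η : ℝ≥0∞) (u v : I) :
    ∑' t : {t : Fin (n + 1) → I // ∃ i : Fin (n + 2),
        g (path u t v i.castSucc) (path u t v i.succ) ≤ η}, chain g u (t : Fin (n + 1) → I) v
      ≤ η ^ (1 / (2 * (n : ℝ) + 4)) * ((n + 2) * C ^ (n + 1)) := by
  -- Splitting `g = g ^ ε * g ^ (1 - ε)`, the first factor yields the gain from the small edge. This
  -- `ε` is small enough that `(1 - ε) (n + 2) / (n + 1)` is still larger than one.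
  set ε : ℝ := 1 / (2 * (n : ℝ) + 4) with hε
  have hε0 : 0 < ε := by positivity
  have hε1 : 0 ≤ 1 - ε := by
    rw [hε, sub_nonneg, div_le_one (by positivity)]
    have : (0 : ℝ) ≤ n := Nat.cast_nonneg n
    linarith
  have hexp : (1 - ε) * (((n : ℝ) + 2) / (n + 1)) = (2 * (n : ℝ) + 3) / (2 * n + 2) := by
    rw [hε]; field_simp; ring
  calc _ ≤ ∑' t : {t : Fin (n + 1) → I // ∃ i : Fin (n + 2),
        g (path u t v i.castSucc) (path u t v i.succ) ≤ η},
          η ^ ε * chain (fun i j => g i j ^ (1 - ε)) u (t : Fin (n + 1) → I) v := by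
        refine ENNReal.tsum_le_tsum fun ⟨t, e, he⟩ => ?_
        simp only [chain]
        have : ∀ i : Fin (n + 2), g (path u t v i.castSucc) (path u t v i.succ) =
            (g (path u t v i.castSucc) (path u t v i.succ)) ^ ε *
            (g (path u t v i.castSucc) (path u t v i.succ)) ^ (1 - ε) := fun i => by
          rw [← ENNReal.rpow_add_of_nonneg _ _ hε0.le hε1, add_sub_cancel, ENNReal.rpow_one]
        rw [Finset.prod_congr rfl fun i _ => this i, Finset.prod_mul_distrib]
        gcongr
        rw [← Finset.mul_prod_erase _ _ (Finset.mem_univ e)]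
        calc _ ≤ η ^ ε * 1 := by
              gcongr
              exact Finset.prod_le_one' fun i _ => ENNReal.rpow_le_one (hg _ _) hε0.le
          _ = η ^ ε := mul_one _
    _ ≤ ∑' t : Fin (n + 1) → I, η ^ ε * chain (fun i j => g i j ^ (1 - ε)) u t v :=
        ENNReal.tsum_comp_le_tsum_of_injective Subtype.val_injective
          (fun t : Fin (n + 1) → I => η ^ ε * chain (fun i j => g i j ^ (1 - ε)) u t v)
    _ ≤ _ := by
        rw [ENNReal.tsum_mul_left]
        gcongr
        refine tsum_chain_le _ C n (fun i => ?_) (fun i => ?_) u v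
        · simpa only [← ENNReal.rpow_mul, hexp] using hrow i
        · simpa only [← ENNReal.rpow_mul, hexp] using hcol i

/-! ### Sums over separated points -/

/-- The constant bounding `∑ (B / (1 + |x_i - u|)) ^ r` over `1`-separated points `x_i`. -/
def sepConst (B r : ℝ) : ℝ≥0∞ := ∑' n : ℤ, ENNReal.ofReal ((2 * B / (1 + |(n : ℝ)|)) ^ r)

theorem sepConst_lt_top {B r : ℝ} (hB : 0 ≤ B) (hr : 1 < r) : sepConst B r < ∞ := by
  have hs : Summable fun n : ℤ => ((2 * B / (1 + |(n : ℝ)|)) ^ r) := by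
    have h1 : Summable fun n : ℕ => (1 / (1 + (n : ℝ)) ^ r) := by
      have := (summable_nat_add_iff 1).2 (Real.summable_one_div_nat_rpow.2 hr)
      simpa [add_comm] using this
    have h2 : Summable fun n : ℕ => ((2 * B / (1 + (n : ℝ))) ^ r) := by
      refine (h1.mul_left ((2 * B) ^ r)).congr fun n => ?_
      rw [Real.div_rpow (by positivity) (by positivity)]; ring
    refine Summable.of_nat_of_neg ?_ ?_ <;> simpa using h2
  unfold sepConst
  rw [← ENNReal.ofReal_tsum_of_nonneg (fun n => by positivity) hs]
  exact ENNReal.ofReal_lt_top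

/-- Separated points have distinct integer parts relative to `u`, so the sum injects into one over
`ℤ`. Rounding costs the factor `2` in `sepConst`, since `1 + |⌊y⌋| ≤ 2 (1 + |y|)`. -/
theorem tsum_separated_le {I : Type*} (x : I → ℝ) (hx : ∀ i j, i ≠ j → 1 ≤ |x i - x j|)
    {B r : ℝ} (hB : 0 ≤ B) (hr : 0 ≤ r) (u : ℝ) :
    ∑' i, ENNReal.ofReal ((B / (1 + |x i - u|)) ^ r) ≤ sepConst B r := by
  have hinj : Function.Injective fun i => ⌊x i - u⌋ := by
    intro i j hij
    by_contra hne
    have h1 := Int.abs_sub_lt_one_of_floor_eq_floor hij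
    have h2 := hx i j hne
    rw [show x i - u - (x j - u) = x i - x j by ring] at h1
    linarith
  refine le_trans (ENNReal.tsum_le_tsum fun i => ?_)
    (ENNReal.tsum_comp_le_tsum_of_injective hinj
      fun n : ℤ => ENNReal.ofReal ((2 * B / (1 + |(n : ℝ)|)) ^ r))
  refine ENNReal.ofReal_le_ofReal (Real.rpow_le_rpow (by positivity) ?_ hr)
  have h1 : |(⌊x i - u⌋ : ℝ)| ≤ |x i - u| + 1 := by
    have h2 := Int.floor_le (x i - u)
    have h3 := Int.lt_floor_add_one (x i - u)
    rw [abs_le]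
    constructor
    · have := neg_abs_le (x i - u); linarith
    · have := le_abs_self (x i - u); linarith
  rw [div_le_div_iff₀ (by positivity) (by positivity)]
  nlinarith [abs_nonneg (x i - u)]

/-! ### Equidistribution of primitive lattice points -/

section MoebiusInversion

open scoped ArithmeticFunction.Moebius ArithmeticFunction.zeta

/-- The primitive lattice points of `[1, Q]²`. -/
def primitivePoints (Q : ℕ) : Finset (ℕ × ℕ) :=
  (Finset.Icc 1 Q ×ˢ Finset.Icc 1 Q).filter fun p => Nat.Coprime p.1 p.2

/-- The lattice point `p`, scaled by `1 / Q`. -/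
def scaledPoint (Q : ℕ) (p : ℕ × ℕ) : ℝ × ℝ := ((p.1 : ℝ) / Q, (p.2 : ℝ) / Q)

theorem sum_divisors_moebius (n : ℕ) :
    ∑ d ∈ n.divisors, ArithmeticFunction.moebius d = if n = 1 then 1 else 0 := by
  rw [← ArithmeticFunction.coe_zeta_mul_apply, ArithmeticFunction.coe_zeta_mul_moebius,
    ArithmeticFunction.one_apply]

/-- Coprimality is detected by summing the Möbius function over the common divisors; points with
common divisor `d` are exactly the multiples `d * w`. -/
theorem sum_primitivePoints (Q : ℕ) (F : ℕ × ℕ → ℂ) :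
    ∑ p ∈ primitivePoints Q, F p = ∑ d ∈ Finset.Icc 1 Q, (ArithmeticFunction.moebius d : ℂ) *
      ∑ w ∈ Finset.Icc 1 (Q / d) ×ˢ Finset.Icc 1 (Q / d), F (d * w.1, d * w.2) := by
  have h1 : ∀ p ∈ Finset.Icc 1 Q ×ˢ Finset.Icc 1 Q, (if Nat.Coprime p.1 p.2 then F p else 0)
      = ∑ d ∈ Finset.Icc 1 Q, if d ∣ p.1 ∧ d ∣ p.2 then (ArithmeticFunction.moebius d : ℂ) * F p
        else 0 := by
    intro p hp
    simp only [Finset.mem_product, Finset.mem_Icc] at hp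
    rw [← Finset.sum_filter]
    have h2 : (Finset.Icc 1 Q).filter (fun d => d ∣ p.1 ∧ d ∣ p.2) = (p.1.gcd p.2).divisors := by
      ext d
      simp only [Finset.mem_filter, Finset.mem_Icc, Nat.mem_divisors, Nat.dvd_gcd_iff]
      constructor
      · rintro ⟨_, h⟩
        exact ⟨h, (Nat.gcd_pos_of_pos_left _ hp.1.1).ne'⟩
      · rintro ⟨h, _⟩
        exact ⟨⟨Nat.pos_of_dvd_of_pos h.1 hp.1.1, (Nat.le_of_dvd hp.1.1 h.1).trans hp.1.2⟩, h⟩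
    rw [h2, ← Finset.sum_mul]
    have h3 := congrArg (fun z : ℤ => (z : ℂ)) (sum_divisors_moebius (p.1.gcd p.2))
    push_cast at h3
    rw [h3]
    by_cases h : p.1.gcd p.2 = 1 <;> simp [h, Nat.Coprime]
  rw [primitivePoints, Finset.sum_filter, Finset.sum_congr rfl h1, Finset.sum_comm]
  refine Finset.sum_congr rfl fun d hd => ?_
  rw [Finset.mem_Icc] at hd
  rw [← Finset.sum_filter, Finset.mul_sum]
  symm
  refine Finset.sum_bij' (fun w _ => (d * w.1, d * w.2)) (fun p _ => (p.1 / d, p.2 / d)) ?_ ?_ ?_ ?_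
    ?_
  · rintro ⟨a, b⟩ h
    simp only [Finset.mem_product, Finset.mem_Icc, Finset.mem_filter,
      Nat.le_div_iff_mul_le hd.1] at h ⊢
    refine ⟨⟨⟨Nat.mul_pos hd.1 h.1.1, ?_⟩, Nat.mul_pos hd.1 h.2.1, ?_⟩, dvd_mul_right _ _,
      dvd_mul_right _ _⟩ <;> linarith [mul_comm a d, mul_comm b d]
  · rintro ⟨a, b⟩ h
    simp only [Finset.mem_product, Finset.mem_Icc, Finset.mem_filter] at h ⊢
    exact ⟨⟨Nat.div_pos (Nat.le_of_dvd h.1.1.1 h.2.1) hd.1, Nat.div_le_div_right h.1.1.2⟩,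
      Nat.div_pos (Nat.le_of_dvd h.1.2.1 h.2.2) hd.1, Nat.div_le_div_right h.1.2.2⟩
  · rintro ⟨a, b⟩ h
    simp [Nat.mul_div_cancel_left _ hd.1]
  · rintro ⟨a, b⟩ h
    simp only [Finset.mem_filter] at h
    simp [Nat.mul_div_cancel' h.2.1, Nat.mul_div_cancel' h.2.2]
  · intro w _
    rfl

theorem tsum_moebius_div_sq :
    ∑' d : ℕ, (ArithmeticFunction.moebius d : ℂ) / (d : ℂ) ^ 2 = 6 / (Real.pi : ℂ) ^ 2 := by
  have h1 := LSeries_one_mul_Lseries_moebius (s := 2) (by norm_num)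
  rw [LSeries_one_eq_riemannZeta (by norm_num), riemannZeta_two] at h1
  have h2 : LSeries (fun n => (ArithmeticFunction.moebius n : ℂ)) 2
      = ∑' d : ℕ, (ArithmeticFunction.moebius d : ℂ) / (d : ℂ) ^ 2 := by
    refine tsum_congr fun d => ?_
    rcases eq_or_ne d 0 with rfl | h
    · simp
    · rw [LSeries.term_of_ne_zero h]
      norm_cast
  rw [← h2, eq_div_iff (by simp [Real.pi_ne_zero])]
  linear_combination 6 * h1

/-- A lattice sum is the integral of a step function, constant on the half-open squares of side `1 /
s` with upper right corner at `w / s`. In this form dominated convergence applies to it. -/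
theorem integral_ceil (s : ℝ) (hs : 0 < s) (F : ℤ × ℤ → ℂ) (W : Finset (ℤ × ℤ))
    (hF : ∀ w ∉ W, F w = 0) :
    ∫ p : ℝ × ℝ, F (⌈s * p.1⌉, ⌈s * p.2⌉) = (s : ℂ)⁻¹ ^ 2 * ∑ w ∈ W, F w := by
  set E : ℤ × ℤ → Set (ℝ × ℝ) := fun w =>
    Set.Ioc (((w.1 : ℝ) - 1) / s) (w.1 / s) ×ˢ Set.Ioc (((w.2 : ℝ) - 1) / s) (w.2 / s) with hE
  have hmem : ∀ (w : ℤ × ℤ) (p : ℝ × ℝ), p ∈ E w ↔ (⌈s * p.1⌉, ⌈s * p.2⌉) = w := by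
    rintro ⟨a, b⟩ ⟨x, y⟩
    simp only [hE, Set.mem_prod, Set.mem_Ioc, Prod.mk.injEq, Int.ceil_eq_iff, div_lt_iff₀ hs,
      le_div_iff₀ hs, mul_comm s]
  have h1 : (fun p : ℝ × ℝ => F (⌈s * p.1⌉, ⌈s * p.2⌉)) =
      fun p => ∑ w ∈ W, (E w).indicator (fun _ => F w) p := by
    funext p
    simp only [Set.indicator_apply, hmem]
    rw [Finset.sum_ite_eq]
    split_ifs with h
    · rfl
    · exact hF _ h
  have hEm : ∀ w, MeasurableSet (E w) := fun w => measurableSet_Ioc.prod measurableSet_Ioc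
  have hvol : ∀ w, (volume : Measure (ℝ × ℝ)).real (E w) = s⁻¹ ^ 2 := by
    intro w
    rw [hE, Measure.volume_eq_prod, measureReal_prod_prod, Real.volume_real_Ioc_of_le,
      Real.volume_real_Ioc_of_le]
    · field_simp; ring
    · gcongr; linarith
    · gcongr; linarith
  rw [h1, integral_finsetSum]
  · simp_rw [integral_indicator_const _ (hEm _), hvol, Finset.mul_sum]
    refine Finset.sum_congr rfl fun w _ => ?_
    rw [Complex.real_smul]; push_cast; ring
  · intro w _
    refine (integrable_indicator_iff (hEm w)).2 (integrableOn_const ?_)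
    rw [hE, Measure.volume_eq_prod, Measure.prod_prod]
    simp [ENNReal.mul_eq_top]

theorem tendsto_ceil_div {x : ℝ} : Tendsto (fun s : ℝ => (⌈s * x⌉ : ℝ) / s) atTop (𝓝 x) := by
  have h1 : Tendsto (fun s : ℝ => s⁻¹) atTop (𝓝 0) := tendsto_inv_atTop_zero
  refine tendsto_of_tendsto_of_tendsto_of_le_of_le' tendsto_const_nhds
    (by simpa using h1.const_add x) ?_ ?_
  · filter_upwards [eventually_gt_atTop 0] with s hs
    rw [le_div_iff₀ hs, mul_comm]
    exact Int.le_ceil _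
  · filter_upwards [eventually_gt_atTop 0] with s hs
    rw [div_le_iff₀ hs, add_mul, inv_mul_cancel₀ hs.ne', mul_comm x]
    exact (Int.ceil_lt_add_one _).le

theorem natCast_div_eq_floor (Q d : ℕ) : ((Q / d : ℕ) : ℤ) = ⌊(Q : ℝ) / d⌋ := by
  rw [← Nat.floor_div_eq_div (K := ℝ), ← Int.natCast_floor_eq_floor (by positivity)]

theorem mem_Ioc_of_ceil_le {s x : ℝ} (hs0 : 0 ≤ s) (hx1 : 0 < s * x) (hx2 : (⌈s * x⌉ : ℝ) ≤ s) :
    x ∈ Set.Ioc (0 : ℝ) 1 := by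
  have hs1 : 0 < s := hs0.lt_of_ne fun h => by simp [← h] at hx1
  refine ⟨pos_of_mul_pos_right hx1 hs0, ?_⟩
  have := (Int.le_ceil _).trans hx2
  exact le_of_mul_le_mul_left (by linarith) hs1

/-- The lattice point rounding up `p` moves with `Q` while tending to `p`, which is why convergence
of `f` is required jointly in the index and the point. Dominated convergence does the rest. -/
theorem tendsto_lattice_sum (f : ℕ → ℝ × ℝ → ℂ) (g : ℝ × ℝ → ℂ) (C : ℝ)
    (hC : ∀ n p, ‖f n p‖ ≤ C)
    (hlim : ∀ᵐ p : ℝ × ℝ, Tendsto (fun q : ℕ × (ℝ × ℝ) => f q.1 q.2) (atTop ×ˢ 𝓝 p) (𝓝 (g p)))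
    (d : ℕ) (hd : 0 < d) :
    Tendsto (fun Q : ℕ => ((Q : ℂ) ^ 2)⁻¹ *
        ∑ w ∈ Finset.Icc 1 (Q / d) ×ˢ Finset.Icc 1 (Q / d), f Q (scaledPoint Q (d * w.1, d * w.2)))
      atTop (𝓝 (((d : ℂ) ^ 2)⁻¹ * ∫ p in Set.Ioc 0 1 ×ˢ Set.Ioc 0 1, g p)) := by
  have hd' : (0 : ℝ) < d := by exact_mod_cast hd
  have hC0 : 0 ≤ C := (norm_nonneg _).trans (hC 0 0)
  set box : Set (ℝ × ℝ) := Set.Ioc 0 1 ×ˢ Set.Ioc 0 1 with hbox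
  have hboxm : MeasurableSet box := measurableSet_Ioc.prod measurableSet_Ioc
  set W : ℕ → Finset (ℤ × ℤ) := fun Q =>
    Finset.Icc 1 ((Q / d : ℕ) : ℤ) ×ˢ Finset.Icc 1 ((Q / d : ℕ) : ℤ) with hW
  set F : ℕ → ℤ × ℤ → ℂ := fun Q w => if w ∈ W Q then
    f Q ((d : ℝ) * w.1 / Q, (d : ℝ) * w.2 / Q) else 0 with hF
  set G : ℕ → ℝ × ℝ → ℂ := fun Q p => F Q (⌈(Q : ℝ) / d * p.1⌉, ⌈(Q : ℝ) / d * p.2⌉) with hG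
  have hs : Tendsto (fun Q : ℕ => (Q : ℝ) / d) atTop atTop :=
    tendsto_natCast_atTop_atTop.atTop_div_const hd'
  have hint : Tendsto (fun Q => ∫ p, G Q p) atTop (𝓝 (∫ p, box.indicator g p)) := by
    refine tendsto_integral_of_dominated_convergence (box.indicator fun _ => C) ?_ ?_ ?_ ?_
    · intro Q
      refine Measurable.aestronglyMeasurable ?_
      refine (Measurable.of_discrete (f := F Q)).comp ?_
      exact (Int.measurable_ceil.comp (measurable_fst.const_mul ((Q : ℝ) / d))).prodMk
        (Int.measurable_ceil.comp (measurable_snd.const_mul ((Q : ℝ) / d)))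
    · refine (integrable_indicator_iff hboxm).2 (integrableOn_const ?_)
      rw [hbox, Measure.volume_eq_prod, Measure.prod_prod]
      simp
    · intro Q
      refine ae_of_all _ fun p => ?_
      by_cases hp : p ∈ box
      · rw [Set.indicator_of_mem hp]
        simp only [hG, hF]
        split_ifs
        · exact hC _ _
        · simpa using hC0
      · rw [Set.indicator_of_notMem hp]
        simp only [hG, hF]
        rw [if_neg, norm_zero]
        contrapose! hp
        simp only [hW, Finset.mem_product, Finset.mem_Icc, natCast_div_eq_floor, Int.one_le_ceil_iff,
          Int.le_floor] at hp
        obtain ⟨⟨h1, h2⟩, h3, h4⟩ := hp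
        exact ⟨mem_Ioc_of_ceil_le (by positivity) h1 h2, mem_Ioc_of_ceil_le (by positivity) h3 h4⟩
    -- A coordinate equal to `1` may round up beyond `⌊Q / d⌋`, outside the range of summation; such
    -- points form a null set.
    · have hne : ∀ᵐ p : ℝ × ℝ, p.1 ≠ 1 ∧ p.2 ≠ 1 := by
        refine Filter.Eventually.and ?_ ?_
        · exact Measure.quasiMeasurePreserving_fst.ae (Measure.ae_ne volume (1 : ℝ))
        · exact Measure.quasiMeasurePreserving_snd.ae (Measure.ae_ne volume (1 : ℝ))
      filter_upwards [hlim, hne] with p hp hpne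
      by_cases hpb : p ∈ box
      · rw [Set.indicator_of_mem hpb]
        have aux : ∀ x : ℝ, x ∈ Set.Ioc (0 : ℝ) 1 → x ≠ 1 → ∀ᶠ Q : ℕ in atTop,
            ⌈(Q : ℝ) / d * x⌉ ∈ Finset.Icc 1 ((Q / d : ℕ) : ℤ) := by
          intro x hx hx1
          have h1 : 0 < 1 - x := by have := lt_of_le_of_ne hx.2 hx1; linarith
          filter_upwards [hs.eventually_ge_atTop (1 / (1 - x)), hs.eventually_gt_atTop 0] with
            Q hQ hQ0
          rw [Finset.mem_Icc, natCast_div_eq_floor, Int.one_le_ceil_iff, Int.le_floor]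
          refine ⟨mul_pos hQ0 hx.1, ?_⟩
          rw [div_le_iff₀ h1] at hQ
          have := Int.ceil_lt_add_one ((Q : ℝ) / d * x)
          nlinarith
        have hpt : Tendsto (fun Q : ℕ => (Q, ((d : ℝ) * ⌈(Q : ℝ) / d * p.1⌉ / Q,
            (d : ℝ) * ⌈(Q : ℝ) / d * p.2⌉ / Q))) atTop (atTop ×ˢ 𝓝 p) := by
          refine tendsto_id.prodMk ?_
          have aux2 : ∀ x : ℝ, Tendsto (fun Q : ℕ => (d : ℝ) * ⌈(Q : ℝ) / d * x⌉ / Q) atTop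
              (𝓝 x) := by
            intro x
            refine (tendsto_ceil_div.comp hs).congr fun Q => ?_
            simp only [Function.comp]
            rw [div_div_eq_mul_div, mul_comm]
          exact (aux2 p.1).prodMk_nhds (aux2 p.2)
        refine (hp.comp hpt).congr' ?_
        filter_upwards [aux p.1 hpb.1 hpne.1, aux p.2 hpb.2 hpne.2] with Q h1 h2
        simp only [hG, hF, Function.comp]
        rw [if_pos (Finset.mem_product.2 ⟨h1, h2⟩)]
      · rw [Set.indicator_of_notMem hpb]
        refine tendsto_const_nhds.congr fun Q => ?_
        simp only [hG, hF]
        rw [if_neg]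
        contrapose! hpb
        simp only [hW, Finset.mem_product, Finset.mem_Icc, natCast_div_eq_floor, Int.one_le_ceil_iff,
          Int.le_floor] at hpb
        obtain ⟨⟨h1, h2⟩, h3, h4⟩ := hpb
        exact ⟨mem_Ioc_of_ceil_le (by positivity) h1 h2, mem_Ioc_of_ceil_le (by positivity) h3 h4⟩
  rw [integral_indicator hboxm] at hint
  refine (hint.const_mul (((d : ℂ) ^ 2)⁻¹)).congr' ?_
  filter_upwards [eventually_gt_atTop 0] with Q hQ
  have hQ' : (0 : ℝ) < Q := by exact_mod_cast hQ
  have hdc : (d : ℂ) ≠ 0 := by exact_mod_cast hd.ne'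
  have hQc : (Q : ℂ) ≠ 0 := by exact_mod_cast hQ.ne'
  simp only [hG]
  rw [integral_ceil ((Q : ℝ) / d) (by positivity) (F Q) (W Q) (fun w hw => by simp [hF, hw])]
  push_cast
  rw [← mul_assoc]
  congr 1
  · field_simp
  · symm
    refine Finset.sum_bij (fun w _ => ((w.1 : ℤ), (w.2 : ℤ))) ?_ ?_ ?_ ?_
    · intro w hw
      simp only [hW, Finset.mem_product, Finset.mem_Icc] at hw ⊢
      exact_mod_cast hw
    · rintro ⟨a, b⟩ _ ⟨a', b'⟩ _ h
      simpa using h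
    · rintro ⟨a, b⟩ hw
      simp only [hW, Finset.mem_product, Finset.mem_Icc] at hw
      refine ⟨(a.toNat, b.toNat), ?_, ?_⟩
      · simp only [Finset.mem_product, Finset.mem_Icc]; omega
      · simp only [Prod.mk.injEq]; omega
    · intro w hw
      have : ((w.1 : ℤ), (w.2 : ℤ)) ∈ W Q := by
        simp only [hW, Finset.mem_product, Finset.mem_Icc] at hw ⊢
        exact_mod_cast hw
      simp only [hF]
      rw [if_pos this]
      simp [scaledPoint]

/-- Equidistribution of primitive lattice points, for functions converging continuously almost
everywhere. -/
theorem tendsto_primitive_sum (f : ℕ → ℝ × ℝ → ℂ) (g : ℝ × ℝ → ℂ) (C : ℝ)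
    (hC : ∀ n p, ‖f n p‖ ≤ C)
    (hlim : ∀ᵐ p : ℝ × ℝ, Tendsto (fun q : ℕ × (ℝ × ℝ) => f q.1 q.2) (atTop ×ˢ 𝓝 p) (𝓝 (g p))) :
    Tendsto (fun Q : ℕ => ((Q : ℂ) ^ 2)⁻¹ * ∑ v ∈ primitivePoints Q, f Q (scaledPoint Q v))
      atTop (𝓝 (6 / (Real.pi : ℂ) ^ 2 * ∫ p in Set.Ioc 0 1 ×ˢ Set.Ioc 0 1, g p)) := by
  have hC0 : 0 ≤ C := (norm_nonneg _).trans (hC 0 0)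
  set T : ℕ → ℕ → ℂ := fun Q d => (ArithmeticFunction.moebius d : ℂ) * (((Q : ℂ) ^ 2)⁻¹ *
    ∑ w ∈ Finset.Icc 1 (Q / d) ×ˢ Finset.Icc 1 (Q / d), f Q (scaledPoint Q (d * w.1, d * w.2)))
    with hT
  have h1 : ∀ Q : ℕ, ((Q : ℂ) ^ 2)⁻¹ * ∑ v ∈ primitivePoints Q, f Q (scaledPoint Q v)
      = ∑' d, T Q d := by
    intro Q
    rw [sum_primitivePoints Q (fun v => f Q (scaledPoint Q v)), tsum_eq_sum (s := Finset.Icc 1 Q),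
      Finset.mul_sum]
    · refine Finset.sum_congr rfl fun d _ => ?_
      simp only [hT]; ring
    · intro d hd
      have : Q / d = 0 := by
        rcases Nat.eq_zero_or_pos d with rfl | hd0
        · simp
        · rw [Finset.mem_Icc] at hd
          exact Nat.div_eq_of_lt (by omega)
      simp [hT, this]
  simp_rw [h1]
  rw [← tsum_moebius_div_sq, ← tsum_mul_right]
  -- The sum for `d` has at most `(Q / d) ^ 2` terms, so after division by `Q ^ 2` it is dominated
  -- by `C / d ^ 2` for every `Q > 0`.
  refine tendsto_tsum_of_dominated_convergence (bound := fun d : ℕ => C * (1 / (d : ℝ) ^ 2)) ?_ ?_ ?_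
  · exact (Real.summable_one_div_nat_pow.2 (by norm_num)).mul_left C
  · intro d
    rcases Nat.eq_zero_or_pos d with rfl | hd
    · simp [hT]
    · have := (tendsto_lattice_sum f g C hC hlim d hd).const_mul (ArithmeticFunction.moebius d : ℂ)
      rw [← mul_assoc, ← div_eq_mul_inv] at this
      exact this
  · filter_upwards [eventually_gt_atTop 0] with Q hQ d
    have hQ' : (0 : ℝ) < Q := by exact_mod_cast hQ
    rcases Nat.eq_zero_or_pos d with rfl | hd
    · simp [hT]
    have hd' : (0 : ℝ) < d := by exact_mod_cast hd
    simp only [hT, norm_mul, norm_inv, norm_pow, Complex.norm_natCast]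
    have hmu : ‖(ArithmeticFunction.moebius d : ℂ)‖ ≤ 1 := by
      rw [Complex.norm_intCast]
      exact_mod_cast ArithmeticFunction.abs_moebius_le_one
    have hsum : ‖∑ w ∈ Finset.Icc 1 (Q / d) ×ˢ Finset.Icc 1 (Q / d),
        f Q (scaledPoint Q (d * w.1, d * w.2))‖ ≤ ((Q : ℝ) / d) ^ 2 * C := by
      refine (norm_sum_le_of_le _ fun w _ => hC _ _).trans ?_
      rw [Finset.sum_const, Finset.card_product, Nat.card_Icc, nsmul_eq_mul]
      gcongr
      rw [Nat.add_sub_cancel, ← sq]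
      push_cast
      gcongr
      exact Nat.cast_div_le
    calc _ ≤ 1 * (((Q : ℝ) ^ 2)⁻¹ * (((Q : ℝ) / d) ^ 2 * C)) := by gcongr
      _ = _ := by field_simp

end MoebiusInversion

/-! ### Coprime pairs and the spacing of their offsets -/

/-- Pairs of coprime integers. -/
abbrev Pair : Type := {p : ℤ × ℤ // Int.gcd p.1 p.2 = 1}

/-- The linear form `A y - B x`. -/
def denom (i : Pair) (p : ℝ × ℝ) : ℝ := (i.1.1 : ℝ) * p.2 - i.1.2 * p.1

/-- The value `h_{A,B}(x, y)`. -/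
def offset (p : ℝ × ℝ) (i : Pair) : ℝ := h i.1.1 i.1.2 p

theorem offset_eq (p : ℝ × ℝ) (i : Pair) : offset p i = i.1.2 / (p.2 * denom i p) := rfl

/-- The pair `(1, 0)`. -/
def basePair : Pair := ⟨(1, 0), by simp⟩

@[simp] theorem offset_basePair (p : ℝ × ℝ) : offset p basePair = 0 := by
  simp [offset_eq, basePair]

@[simp] theorem denom_basePair (p : ℝ × ℝ) : denom basePair p = p.2 := by
  simp [denom, basePair]

/-- The pairs `(A, B)` with `0 < A y - B x ≤ 1`. -/
def localPairs (p : ℝ × ℝ) : Set Pair := {i | 0 < denom i p ∧ denom i p ≤ 1}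

/-- Proportional primitive integer vectors differ at most by sign, and positivity of the linear form
at `p` fixes the sign. -/
theorem eq_of_cross_eq {i j : Pair} {p : ℝ × ℝ} (hi : 0 < denom i p) (hj : 0 < denom j p)
    (hc : i.1.2 * j.1.1 = j.1.2 * i.1.1) : i = j := by
  obtain ⟨⟨A, B⟩, hi1⟩ := i
  obtain ⟨⟨A', B'⟩, hj1⟩ := j
  simp only [denom] at hi hj hc
  dsimp only at hi1 hj1
  obtain ⟨u, v, huv⟩ := Int.isCoprime_iff_gcd_eq_one.2 hi1
  set k := u * A' + v * B' with hk
  have hA : A' = A * k := by rw [hk]; linear_combination (-A') * huv + v * hc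
  have hB : B' = B * k := by rw [hk]; linear_combination (-B') * huv - u * hc
  have h2 : k.natAbs = 1 := by
    have := hj1
    rw [hA, hB, Int.gcd_mul_right, hi1, one_mul] at this
    exact this
  have hkpos : 0 < k := by
    rw [hA, hB] at hj
    push_cast at hj
    have : 0 < ((A : ℝ) * p.2 - B * p.1) * (k : ℝ) := by linarith
    exact_mod_cast pos_of_mul_pos_right this hi.le
  have hk1 : k = 1 := by omega
  simp [hA, hB, hk1]

/-- This is the spacing `|a/q - a'/q'| ≥ 1/(qq')` of Farey fractions in scaled form: the difference
of offsets is a nonzero integer determinant divided by a product of two denominators in `(0, 1]`. -/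
theorem one_le_abs_offset_sub {p : ℝ × ℝ} (hp : 0 < p.2) {i j : Pair}
    (hi : i ∈ localPairs p) (hj : j ∈ localPairs p) (hij : i ≠ j) :
    1 ≤ |offset p i - offset p j| := by
  have hne : i.1.2 * j.1.1 - j.1.2 * i.1.1 ≠ 0 := fun h0 =>
    hij (eq_of_cross_eq hi.1 hj.1 (by linarith))
  have h1 : (1 : ℝ) ≤ |((i.1.2 * j.1.1 - j.1.2 * i.1.1 : ℤ) : ℝ)| := by
    exact_mod_cast Int.one_le_abs hne
  have h2 : offset p i - offset p j =
      ((i.1.2 * j.1.1 - j.1.2 * i.1.1 : ℤ) : ℝ) / (denom i p * denom j p) := by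
    have h3 := hi.1.ne'
    have h4 := hj.1.ne'
    have h5 := hp.ne'
    rw [offset_eq, offset_eq]
    field_simp
    simp only [denom]
    push_cast
    ring
  rw [h2, abs_div, abs_of_pos (mul_pos hi.1 hj.1), le_div_iff₀ (mul_pos hi.1 hj.1), one_mul]
  exact (mul_le_one₀ hi.2 hj.1.le hj.2).trans h1

/-! ### Farey fractions as primitive points and as coprime pairs -/

theorem mem_farey {Q : ℕ} {r : ℚ} : r ∈ farey Q ↔ 0 < r ∧ r ≤ 1 ∧ r.den ≤ Q := by
  simp only [farey, Finset.mem_image, Finset.mem_filter, Finset.mem_product, Finset.mem_Icc,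
    Prod.exists]
  constructor
  · rintro ⟨a, q, ⟨⟨⟨ha, haQ⟩, hq, hqQ⟩, haq, hc⟩, rfl⟩
    have hq' : (0 : ℚ) < q := by exact_mod_cast hq
    refine ⟨by positivity, ?_, ?_⟩
    · rw [div_le_one hq']; exact_mod_cast haq
    · have := Rat.den_div_eq_of_coprime (a := (a : ℤ)) (b := (q : ℤ)) (by exact_mod_cast hq)
        (by simpa using hc)
      have h2 : ((a : ℚ) / q).den = q := by
        simp only [Int.cast_natCast] at this
        exact Int.ofNat_inj.1 this
      rw [h2]; exact hqQ
  · rintro ⟨h0, h1, hQ⟩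
    have hnum : 0 < r.num := Rat.num_pos.2 h0
    have hle : r.num ≤ r.den := by
      have := Rat.num_div_den r
      rw [← this, div_le_one (by exact_mod_cast r.den_pos)] at h1
      exact_mod_cast h1
    refine ⟨r.num.toNat, r.den, ⟨⟨⟨by omega, by omega⟩, r.den_pos, hQ⟩, by omega, ?_⟩, ?_⟩
    · have := r.reduced
      rwa [show r.num.toNat = r.num.natAbs by omega]
    · conv_rhs => rw [← Rat.num_div_den r]
      congr 1
      exact_mod_cast Int.toNat_of_nonneg hnum.le

theorem exists_modInv {x q : ℕ} (hq : 1 ≤ q) (hc : Nat.Coprime x q) :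
    ∃ a : ℕ, 1 ≤ a ∧ a ≤ q ∧ a * x ≡ 1 [MOD q] := by
  rcases eq_or_lt_of_le hq with rfl | hq1
  -- Modulo `1` the representative has to be `1` rather than `0`, to lie in `[1, q]`.
  · exact ⟨1, le_rfl, le_rfl, Nat.modEq_one⟩
  · obtain ⟨m, hm, h⟩ := Nat.exists_mul_mod_eq_one_of_coprime hc hq1
    refine ⟨m, ?_, hm.le, ?_⟩
    · rcases Nat.eq_zero_or_pos m with rfl | h0
      · simp at h
      · exact h0
    · rw [mul_comm, Nat.ModEq, h, Nat.mod_eq_of_lt hq1]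

/-- The inverse of `x` modulo `q` in `[1, q]`. -/
def modInv (x q : ℕ) : ℕ :=
  if hx : 1 ≤ q ∧ Nat.Coprime x q then (exists_modInv hx.1 hx.2).choose else 0

theorem modInv_spec {x q : ℕ} (hq : 1 ≤ q) (hc : Nat.Coprime x q) :
    1 ≤ modInv x q ∧ modInv x q ≤ q ∧ modInv x q * x ≡ 1 [MOD q] := by
  rw [modInv, dif_pos ⟨hq, hc⟩]
  exact (exists_modInv hq hc).choose_spec

theorem coprime_of_mul_modEq_one {a x q : ℕ} (h1 : a * x ≡ 1 [MOD q]) : Nat.Coprime a q := by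
  have := h1.gcd_eq
  rw [Nat.gcd_one_left] at this
  exact Nat.Coprime.coprime_mul_right (k := x) this

theorem modInv_modInv {x q : ℕ} (hx : 1 ≤ x) (hxq : x ≤ q) (hc : Nat.Coprime x q) :
    modInv (modInv x q) q = x := by
  have hq := hx.trans hxq
  obtain ⟨h1, h2, h3⟩ := modInv_spec hq hc
  obtain ⟨h4, h5, h6⟩ := modInv_spec hq (coprime_of_mul_modEq_one h3)
  have h7 : modInv (modInv x q) q ≡ x [MOD q] := by
    calc modInv (modInv x q) q = modInv (modInv x q) q * 1 := (mul_one _).symm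
      _ ≡ modInv (modInv x q) q * (modInv x q * x) [MOD q] := h3.symm.mul_left _
      _ = (modInv (modInv x q) q * modInv x q) * x := by ring
      _ ≡ 1 * x [MOD q] := h6.mul_right _
      _ = x := one_mul x
  have h8 := (Nat.modEq_iff_dvd.1 h7)
  obtain ⟨m, hm⟩ := h8
  have : m = 0 := by
    rcases lt_trichotomy m 0 with h | h | h
    · nlinarith
    · exact h
    · nlinarith
  subst this
  omega

/-- The Farey fraction attached to a primitive point `(x, q)` with `x ≤ q`. -/
def fareyOf (v : ℕ × ℕ) : ℚ := (modInv v.1 v.2 : ℚ) / v.2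

/-- The primitive points of the triangle `x ≤ y ≤ Q`. -/
def trianglePoints (Q : ℕ) : Finset (ℕ × ℕ) := (primitivePoints Q).filter fun v => v.1 ≤ v.2

theorem mem_trianglePoints {Q : ℕ} {v : ℕ × ℕ} :
    v ∈ trianglePoints Q ↔ 1 ≤ v.1 ∧ v.1 ≤ v.2 ∧ v.2 ≤ Q ∧ Nat.Coprime v.1 v.2 := by
  simp only [trianglePoints, primitivePoints, Finset.mem_filter, Finset.mem_product, Finset.mem_Icc]
  constructor
  · rintro ⟨⟨⟨⟨_, _⟩, _, _⟩, h5⟩, _⟩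
    refine ⟨?_, ?_, ?_, h5⟩ <;> omega
  · rintro ⟨h1, h2, h3, h4⟩
    refine ⟨⟨⟨⟨?_, ?_⟩, ?_, ?_⟩, h4⟩, h2⟩ <;> omega

theorem fareyOf_num_den {Q : ℕ} {v : ℕ × ℕ} (hv : v ∈ trianglePoints Q) :
    (fareyOf v).num = modInv v.1 v.2 ∧ (fareyOf v).den = v.2 := by
  rw [mem_trianglePoints] at hv
  have hq := hv.1.trans hv.2.1
  obtain ⟨h1, h2, h3⟩ := modInv_spec hq hv.2.2.2
  have hc := coprime_of_mul_modEq_one h3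
  have h4 := Rat.den_div_eq_of_coprime (a := (modInv v.1 v.2 : ℤ)) (b := (v.2 : ℤ))
    (by exact_mod_cast hq) (by simpa using hc)
  have h5 := Rat.num_div_eq_of_coprime (a := (modInv v.1 v.2 : ℤ)) (b := (v.2 : ℤ))
    (by exact_mod_cast hq) (by simpa using hc)
  refine ⟨?_, ?_⟩
  · simp only [Int.cast_natCast] at h5
    exact h5
  · simp only [Int.cast_natCast] at h4
    exact Int.ofNat_inj.1 h4

theorem fareyOf_mem {Q : ℕ} {v : ℕ × ℕ} (hv : v ∈ trianglePoints Q) : fareyOf v ∈ farey Q := by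
  have hnd := fareyOf_num_den hv
  rw [mem_trianglePoints] at hv
  have hq := hv.1.trans hv.2.1
  obtain ⟨h1, h2, h3⟩ := modInv_spec hq hv.2.2.2
  have hq' : (0 : ℚ) < v.2 := by exact_mod_cast hq
  have h1' : (0 : ℚ) < modInv v.1 v.2 := by exact_mod_cast h1
  rw [mem_farey, hnd.2]
  refine ⟨by unfold fareyOf; positivity, ?_, hv.2.2.1⟩
  unfold fareyOf
  rw [div_le_one hq']
  exact_mod_cast h2

/-- Inversion modulo `q` is an involution on the reduced residues in `[1, q]`. Replacing numerators
by their inverses makes the differences to other Farey fractions explicit functions of the lattice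
point. -/
theorem sum_farey {M : Type*} [AddCommMonoid M] (Q : ℕ) (F : ℚ → M) :
    ∑ r ∈ farey Q, F r = ∑ v ∈ trianglePoints Q, F (fareyOf v) := by
  symm
  refine Finset.sum_bij' (fun v _ => fareyOf v) (fun r _ => (modInv r.num.toNat r.den, r.den))
    (fun v hv => fareyOf_mem hv) ?_ ?_ ?_ (fun _ _ => rfl)
  · intro r hr
    rw [mem_farey] at hr
    have hnum : 0 < r.num := Rat.num_pos.2 hr.1
    have hc : Nat.Coprime r.num.toNat r.den := by
      rw [show r.num.toNat = r.num.natAbs by omega]; exact r.reduced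
    obtain ⟨h1, h2, h3⟩ := modInv_spec r.den_pos hc
    exact mem_trianglePoints.2 ⟨h1, h2, hr.2.2, coprime_of_mul_modEq_one h3⟩
  · intro v hv
    obtain ⟨h1, h2⟩ := fareyOf_num_den hv
    rw [mem_trianglePoints] at hv
    simp only [h1, h2, Int.toNat_natCast]
    rw [modInv_modInv hv.1 hv.2.1 hv.2.2.2]
  · intro r hr
    rw [mem_farey] at hr
    have hnum : 0 < r.num := Rat.num_pos.2 hr.1
    have hc : Nat.Coprime r.num.toNat r.den := by
      rw [show r.num.toNat = r.num.natAbs by omega]; exact r.reduced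
    have hle : r.num ≤ r.den := by
      have h1 := hr.2.1
      rw [← Rat.num_div_den r, div_le_one (by exact_mod_cast r.den_pos)] at h1
      exact_mod_cast h1
    simp only [fareyOf]
    rw [modInv_modInv (by omega) (by omega) hc]
    conv_rhs => rw [← Rat.num_div_den r]
    congr 1
    exact_mod_cast Int.toNat_of_nonneg hnum.le

/-- The pairs attached to the Farey fractions of order `Q`, modulo one. -/
def window (Q : ℕ) (p : ℝ × ℝ) : Set Pair :=
  {i | i ∈ localPairs p ∧ offset p i / (Q : ℝ) ^ 2 ∈ Set.Ioc (-(1 / 2) : ℝ) (1 / 2)}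

/-- A matrix of determinant one with first column `(a, q)` carries `(1, 0)` to the fraction `a/q` of
`v` and permutes the primitive vectors. A pair `(A, B)` goes to a fraction of denominator `Aq - Bx`,
and membership in `localPairs` says that this denominator is positive and at most `Q`. The window
selects one representative of each class modulo one. -/
theorem exists_window_equiv {Q : ℕ} {v : ℕ × ℕ} (hv : v ∈ trianglePoints Q) :
    ∃ φ : window Q (scaledPoint Q v) ≃ farey Q, ∀ i, ∃ n : ℤ,
      (((φ i : ℚ) : ℝ)) = (fareyOf v : ℝ) + offset (scaledPoint Q v) i / (Q : ℝ) ^ 2 + n := by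
  have hv' := mem_trianglePoints.1 hv
  have hq := hv'.1.trans hv'.2.1
  have hQ : 1 ≤ Q := hq.trans hv'.2.2.1
  obtain ⟨h1, h2, h3⟩ := modInv_spec hq hv'.2.2.2
  obtain ⟨c, hc⟩ := Nat.modEq_iff_dvd.1 h3
  set a : ℤ := (modInv v.1 v.2 : ℤ) with ha
  set x : ℤ := (v.1 : ℤ) with hx
  set q : ℤ := (v.2 : ℤ) with hqq
  -- Since `x` inverts `a` modulo `q`, the matrix with rows `(a, c)` and `(q, x)` has determinant
  -- one, after the change of sign of `c` below.
  have hdet : a * x - (-c) * q = 1 := by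
    push_cast at hc
    rw [← ha, ← hx] at hc
    linarith
  generalize -c = c at hdet
  have hq0 : 0 < q := by omega
  have hqr : (0 : ℝ) < (q : ℝ) := by exact_mod_cast hq0
  have hQr : (0 : ℝ) < (Q : ℝ) := by exact_mod_cast hQ
  have hdetr : (a : ℝ) * x - c * q = 1 := by exact_mod_cast hdet
  have hden : ∀ i : Pair, denom i (scaledPoint Q v) = ((i.1.1 * q - i.1.2 * x : ℤ) : ℝ) / Q := by
    intro i
    simp only [denom, scaledPoint, hqq, hx]
    push_cast
    ring
  have hloc : ∀ i : Pair, i ∈ localPairs (scaledPoint Q v) ↔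
      0 < i.1.1 * q - i.1.2 * x ∧ i.1.1 * q - i.1.2 * x ≤ Q := by
    intro i
    simp only [localPairs, Set.mem_ofPred_eq, hden, div_le_one hQr]
    rw [div_pos_iff_of_pos_right hQr]
    exact_mod_cast Iff.rfl
  -- The image of the vector `(A, -B)` under this matrix, read as a fraction.
  set L : Pair → ℚ := fun i => ((i.1.1 * a - i.1.2 * c : ℤ) : ℚ) / ((i.1.1 * q - i.1.2 * x : ℤ) : ℚ)
    with hL
  have hcop : ∀ i : Pair, IsCoprime (i.1.1 * a - i.1.2 * c) (i.1.1 * q - i.1.2 * x) := by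
    intro i
    obtain ⟨s, t, hst⟩ := Int.isCoprime_iff_gcd_eq_one.2 i.2
    refine ⟨s * x + t * q, -(s * c) - t * a, ?_⟩
    linear_combination (s * i.1.1 + t * i.1.2) * hdet + hst
  have hLnd : ∀ i ∈ localPairs (scaledPoint Q v), (L i).num = i.1.1 * a - i.1.2 * c ∧
      ((L i).den : ℤ) = i.1.1 * q - i.1.2 * x := by
    intro i hi
    have hc' := Int.isCoprime_iff_gcd_eq_one.1 (hcop i)
    exact ⟨Rat.num_div_eq_of_coprime ((hloc i).1 hi).1 hc',
      Rat.den_div_eq_of_coprime ((hloc i).1 hi).1 hc'⟩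
  have hfar : (fareyOf v : ℝ) = a / q := by
    simp [fareyOf, ha, hqq]
  have hLoff : ∀ i ∈ localPairs (scaledPoint Q v),
      ((L i : ℚ) : ℝ) = (fareyOf v : ℝ) + offset (scaledPoint Q v) i / (Q : ℝ) ^ 2 := by
    intro i hi
    have hpos : (0 : ℝ) < (i.1.1 * q - i.1.2 * x : ℤ) := by exact_mod_cast ((hloc i).1 hi).1
    rw [hfar, offset_eq, hden]
    simp only [hL, scaledPoint]
    have : (v.2 : ℝ) = q := by simp [hqq]
    rw [this]
    push_cast at hpos ⊢
    have h3 := hpos.ne'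
    field_simp
    linear_combination (i.1.2 : ℝ) * hdetr
  have hLinj : ∀ i ∈ localPairs (scaledPoint Q v), ∀ j ∈ localPairs (scaledPoint Q v),
      L i = L j → i = j := by
    intro i hi j hj hij
    have e1 := hLnd i hi
    have e2 := hLnd j hj
    rw [hij] at e1
    have e3 : i.1.1 * a - i.1.2 * c = j.1.1 * a - j.1.2 * c := e1.1.symm.trans e2.1
    have e4 : i.1.1 * q - i.1.2 * x = j.1.1 * q - j.1.2 * x := e1.2.symm.trans e2.2
    refine Subtype.ext (Prod.ext ?_ ?_)
    · linear_combination (j.1.1 - i.1.1) * hdet + x * e3 - c * e4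
    · linear_combination (j.1.2 - i.1.2) * hdet + q * e3 - a * e4
  have hmem : ∀ i : window Q (scaledPoint Q v), L i - ⌈L i⌉ + 1 ∈ farey Q := by
    rintro ⟨i, hi⟩
    rw [mem_farey]
    refine ⟨?_, ?_, ?_⟩
    · linarith [Int.ceil_lt_add_one (L i)]
    · linarith [Int.le_ceil (L i)]
    · have : L i - ⌈L i⌉ + 1 = L i + ((1 - ⌈L i⌉ : ℤ) : ℚ) := by push_cast; ring
      rw [this, Rat.add_intCast_den]
      have h5 := (hLnd i hi.1).2
      have h6 := ((hloc i).1 hi.1).2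
      omega
  refine ⟨Equiv.ofBijective (fun i => ⟨L i - ⌈L i⌉ + 1, hmem i⟩) ⟨?_, ?_⟩, ?_⟩
  · rintro ⟨i, hi⟩ ⟨j, hj⟩ hij
    simp only [Subtype.mk.injEq] at hij ⊢
    refine hLinj i hi.1 j hj.1 ?_
    have h5 : L i = L j + ((⌈L i⌉ - ⌈L j⌉ : ℤ) : ℚ) := by push_cast; linarith
    have h6 : ((L i : ℚ) : ℝ) = ((L j : ℚ) : ℝ) + ((⌈L i⌉ - ⌈L j⌉ : ℤ) : ℝ) := by exact_mod_cast h5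
    rw [hLoff i hi.1, hLoff j hj.1] at h6
    have h7 := hi.2
    have h8 := hj.2
    rw [Set.mem_Ioc] at h7 h8
    have h9 : ((⌈L i⌉ - ⌈L j⌉ : ℤ) : ℝ) < 1 := by linarith
    have h10 : (-1 : ℝ) < ((⌈L i⌉ - ⌈L j⌉ : ℤ) : ℝ) := by linarith
    have h11 : ⌈L i⌉ - ⌈L j⌉ < 1 := by exact_mod_cast h9
    have h12 : -1 < ⌈L i⌉ - ⌈L j⌉ := by exact_mod_cast h10
    rw [h5, show ⌈L i⌉ - ⌈L j⌉ = 0 by omega]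
    simp
  · rintro ⟨r, hr⟩
    have hr' := mem_farey.1 hr
    -- For surjectivity, `r` is translated by an integer into the half-open interval of length one
    -- centred at `fareyOf v`; the inverse matrix then gives the pair.
    set n : ℤ := -⌈r - fareyOf v - 1 / 2⌉ with hn
    set s : ℚ := r + n with hs
    have hs1 : s - fareyOf v ≤ 1 / 2 := by
      have := Int.le_ceil (r - fareyOf v - 1 / 2)
      rw [hs, hn]; push_cast; linarith
    have hs2 : -(1 / 2) < s - fareyOf v := by
      have := Int.ceil_lt_add_one (r - fareyOf v - 1 / 2)
      rw [hs, hn]; push_cast; linarith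
    have hsden : s.den = r.den := by rw [hs, Rat.add_intCast_den]
    have hcp : Int.gcd (s.num * x - c * s.den) (s.num * q - a * s.den) = 1 := by
      rw [← Int.isCoprime_iff_gcd_eq_one]
      obtain ⟨u, w, huw⟩ := (Int.isCoprime_iff_gcd_eq_one (m := s.num) (n := s.den)).2
        (by simpa [Int.gcd, Nat.Coprime] using s.reduced)
      refine ⟨u * a + w * q, -(u * c) - w * x, ?_⟩
      linear_combination (u * s.num + w * s.den) * hdet + huw
    set i : Pair := ⟨(s.num * x - c * s.den, s.num * q - a * s.den), hcp⟩ with hi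
    have e1 : i.1.1 * q - i.1.2 * x = s.den := by
      simp only [hi]; linear_combination (s.den : ℤ) * hdet
    have e2 : i.1.1 * a - i.1.2 * c = s.num := by
      simp only [hi]; linear_combination s.num * hdet
    have hil : i ∈ localPairs (scaledPoint Q v) := by
      rw [hloc, e1, hsden]
      exact ⟨by exact_mod_cast r.den_pos, by exact_mod_cast hr'.2.2⟩
    have hLi : L i = s := by
      simp only [hL]
      rw [e1, e2]
      exact_mod_cast Rat.num_div_den s
    refine ⟨⟨i, hil, ?_⟩, ?_⟩
    · have := hLoff i hil
      rw [hLi] at this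
      have h5 : offset (scaledPoint Q v) i / (Q : ℝ) ^ 2 = ((s - fareyOf v : ℚ) : ℝ) := by
        push_cast; linarith
      rw [h5]
      refine ⟨?_, ?_⟩
      · have : ((-(1 / 2) : ℚ) : ℝ) < ((s - fareyOf v : ℚ) : ℝ) := by exact_mod_cast hs2
        push_cast at this ⊢; exact this
      · have : ((s - fareyOf v : ℚ) : ℝ) ≤ ((1 / 2 : ℚ) : ℝ) := by exact_mod_cast hs1
        push_cast at this ⊢; exact this
    · refine Subtype.ext ?_
      simp only [hLi]
      have h5 : ⌈s⌉ = n + 1 := by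
        rw [hs, Int.ceil_add_intCast]
        have : ⌈r⌉ = 1 := by
          rw [Int.ceil_eq_iff]; constructor <;> push_cast <;> linarith [hr'.1, hr'.2.1]
        rw [this]; ring
      rw [h5, hs]; push_cast; ring
  · rintro ⟨i, hi⟩
    refine ⟨1 - ⌈L i⌉, ?_⟩
    rw [← hLoff i hi.1]
    change ((L i - ⌈L i⌉ + 1 : ℚ) : ℝ) = _
    push_cast
    ring

/-! ### The Dirichlet kernel -/

theorem e_add (x y : ℝ) : e (x + y) = e x * e y := by
  simp only [e]
  rw [← Complex.exp_add]
  congr 1; push_cast; ring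

@[simp] theorem e_zero : e 0 = 1 := by simp [e]

theorem e_intCast (n : ℤ) : e n = 1 := by
  simp only [e]
  rw [Complex.exp_eq_one_iff]
  exact ⟨n, by push_cast; ring⟩

theorem norm_e (x : ℝ) : ‖e x‖ = 1 := by
  have : (2 * Real.pi * Complex.I * x : ℂ) = ((2 * Real.pi * x : ℝ) : ℂ) * Complex.I := by
    push_cast; ring
  rw [e, this, Complex.norm_exp_ofReal_mul_I]

theorem star_e (x : ℝ) : star (e x) = e (-x) := by
  simp only [e, Complex.star_def, ← Complex.exp_conj]
  congr 1
  simp only [map_mul, Complex.conj_ofReal, Complex.conj_I, Complex.conj_ofNat]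
  push_cast
  ring

/-- The Dirichlet kernel `∑_{n = 1}^{N} e(n t)`. -/
def dirichletKernel (N : ℕ) (t : ℝ) : ℂ := ∑ j ∈ Finset.range N, e (((j : ℕ) + 1 : ℝ) * t)

/-- The normalised Dirichlet kernel. -/
def kernel (N : ℕ) (t : ℝ) : ℂ := dirichletKernel N t / N

theorem dirichletKernel_add_int (N : ℕ) (t : ℝ) (n : ℤ) :
    dirichletKernel N (t + n) = dirichletKernel N t := by
  refine Finset.sum_congr rfl fun j _ => ?_
  rw [mul_add, e_add]
  have : ((j : ℝ) + 1) * (n : ℝ) = (((j + 1 : ℤ) * n : ℤ) : ℝ) := by push_cast; ring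
  rw [this, e_intCast, mul_one]

theorem kernel_add_int (N : ℕ) (t : ℝ) (n : ℤ) : kernel N (t + n) = kernel N t := by
  rw [kernel, kernel, dirichletKernel_add_int]

theorem sub_one_mul_dirichletKernel (N : ℕ) (t : ℝ) :
    (e t - 1) * dirichletKernel N t = e t * (e (N * t) - 1) := by
  induction N with
  | zero => simp [dirichletKernel]
  | succ N ih =>
    rw [dirichletKernel, Finset.sum_range_succ, mul_add, ← dirichletKernel, ih]
    have h1 : e ((N + 1 : ℝ) * t) = e (N * t) * e t := by rw [← e_add]; congr 1; ring
    push_cast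
    rw [h1]
    ring

theorem e_sub_one (t : ℝ) : e t - 1 = e (t / 2) * (2 * Complex.I * Real.sin (Real.pi * t)) := by
  have h2 : e t = e (t / 2) * e (t / 2) := by rw [← e_add]; congr 1; ring
  have h3 : e (t / 2) * e (-(t / 2)) = 1 := by rw [← e_add]; simp
  have h4 : (2 * Complex.I * Real.sin (Real.pi * t) : ℂ) = e (t / 2) - e (-(t / 2)) := by
    have e1 : e (t / 2) = Complex.exp (((Real.pi * t : ℝ) : ℂ) * Complex.I) := by
      rw [e]; congr 1; push_cast; ring
    have e2 : e (-(t / 2)) = Complex.exp (-((Real.pi * t : ℝ) : ℂ) * Complex.I) := by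
      rw [e]; congr 1; push_cast; ring
    rw [Complex.ofReal_sin, Complex.sin, e1, e2]
    linear_combination (Complex.exp (-((Real.pi * t : ℝ) : ℂ) * Complex.I) -
      Complex.exp (((Real.pi * t : ℝ) : ℂ) * Complex.I)) * Complex.I_mul_I
  rw [h4, mul_sub, ← h2, h3]

theorem norm_e_sub_one (t : ℝ) : ‖e t - 1‖ = 2 * |Real.sin (Real.pi * t)| := by
  rw [e_sub_one, norm_mul, norm_e, one_mul, norm_mul, Complex.norm_real, Real.norm_eq_abs]
  simp

theorem four_mul_abs_le_norm_e_sub_one {t : ℝ} (ht : |t| ≤ 1 / 2) : 4 * |t| ≤ ‖e t - 1‖ := by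
  rw [norm_e_sub_one]
  have hpi := Real.pi_pos
  have h1 : |Real.pi * t| ≤ Real.pi / 2 := by
    rw [abs_mul, abs_of_pos hpi]; nlinarith
  have h2 := Real.mul_abs_le_abs_sin h1
  rw [abs_mul, abs_of_pos hpi] at h2
  have h3 : 2 / Real.pi * (Real.pi * |t|) = 2 * |t| := by field_simp
  linarith

theorem norm_dirichletKernel_le (N : ℕ) (t : ℝ) : ‖dirichletKernel N t‖ ≤ N := by
  refine (norm_sum_le_of_le _ fun j _ => (norm_e _).le).trans ?_
  simp

theorem norm_kernel_le_one (N : ℕ) (t : ℝ) : ‖kernel N t‖ ≤ 1 := by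
  rw [kernel, norm_div, Complex.norm_natCast]
  exact div_le_one_of_le₀ (norm_dirichletKernel_le N t) (Nat.cast_nonneg N)

theorem norm_dirichletKernel_mul_le (N : ℕ) {t : ℝ} (ht : |t| ≤ 1 / 2) :
    ‖dirichletKernel N t‖ * (2 * |t|) ≤ 1 := by
  have h1 := congrArg norm (sub_one_mul_dirichletKernel N t)
  rw [norm_mul, norm_mul, norm_e, one_mul] at h1
  have h2 : ‖e (N * t) - 1‖ ≤ 2 := by
    refine (norm_sub_le _ _).trans ?_
    rw [norm_e, norm_one]; norm_num
  have h3 := four_mul_abs_le_norm_e_sub_one ht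
  have h4 := norm_nonneg (dirichletKernel N t)
  nlinarith

/-- Adds the trivial bound `1` to the bound `1 / (2 N |t|)` from the geometric sum. With `D = Q ^ 2`
the result is the inverse-distance decay in terms of offsets. -/
theorem norm_kernel_le {N : ℕ} (hN : 0 < N) {D t : ℝ} (hD : 0 ≤ D) (ht : |t| ≤ 1 / 2) :
    ‖kernel N t‖ ≤ (1 + D / (2 * N)) / (1 + |D * t|) := by
  have hN' : (0 : ℝ) < N := by exact_mod_cast hN
  rw [le_div_iff₀ (by positivity), mul_add, mul_one, abs_mul, abs_of_nonneg hD]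
  refine add_le_add (norm_kernel_le_one N t) ?_
  have h1 := norm_dirichletKernel_mul_le N ht
  rw [kernel, norm_div, Complex.norm_natCast]
  calc ‖dirichletKernel N t‖ / N * (D * |t|)
      = (‖dirichletKernel N t‖ * (2 * |t|)) * (D / (2 * N)) := by field_simp
    _ ≤ 1 * (D / (2 * N)) := by gcongr
    _ = _ := one_mul _

/-! ### Moments as sums over closed walks -/

/-- The values of a power of a matrix as a sum over paths. -/
theorem pow_apply_eq_sum_chain {I : Type*} [Fintype I] [DecidableEq I] (G : Matrix I I ℂ) (n : ℕ)
    (u v : I) : (G ^ (n + 1)) u v = ∑ t : Fin n → I, chain G u t v := by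
  induction n generalizing u with
  | zero =>
    simp only [zero_add, pow_one, Finset.univ_unique, Finset.sum_singleton]
    exact (chain_zero G u _ v).symm
  | succ n ih =>
    rw [pow_succ', Matrix.mul_apply, ← (Fin.consEquiv (fun _ : Fin (n + 1) => I)).sum_comp,
      Fintype.sum_prod_type]
    refine Finset.sum_congr rfl fun a _ => ?_
    rw [ih, Finset.mul_sum]
    refine Finset.sum_congr rfl fun t _ => ?_
    exact (chain_cons G u a t v).symm

theorem sum_eigenvalues_pow {n : Type*} [Fintype n] [DecidableEq n] {A : Matrix n n ℂ}
    (hA : A.IsHermitian) (k : ℕ) : ∑ i, ((hA.eigenvalues i : ℂ)) ^ k = (A ^ k).trace := by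
  conv_rhs => rw [hA.spectral_theorem, ← map_pow, Unitary.conjStarAlgAut_apply]
  rw [Matrix.trace_mul_comm, ← mul_assoc]
  simp [Matrix.diagonal_pow, Matrix.trace_diagonal]

theorem gram_apply (Q N : ℕ) (r s : farey Q) :
    (sieveMatrix Q N * (sieveMatrix Q N)ᴴ) r s = dirichletKernel N ((r : ℚ) - (s : ℚ) : ℝ) := by
  rw [Matrix.mul_apply, dirichletKernel, ← Fin.sum_univ_eq_sum_range
    (fun j => e (((j : ℕ) + 1 : ℝ) * ((r : ℚ) - (s : ℚ) : ℝ)))]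
  refine Finset.sum_congr rfl fun j _ => ?_
  rw [Matrix.conjTranspose_apply, sieveMatrix, Matrix.of_apply, Matrix.of_apply, star_e, ← e_add]
  congr 1; ring

/-- Cyclicity of the trace replaces `A⋆A` by the Gram matrix `AA⋆` indexed by Farey fractions. The
exponent has to be positive, because the zeroth powers have the different traces `N` and `|F_Q|`. -/
theorem sum_sieveEigenvalue_pow (Q N n : ℕ) :
    ∑ i, ((sieveEigenvalue Q N i / N : ℝ) : ℂ) ^ (n + 1) =
      ∑ r : farey Q, ∑ t : Fin n → farey Q,
        chain (fun r s : farey Q => kernel N ((r : ℚ) - (s : ℚ) : ℝ)) r t r := by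
  set A := sieveMatrix Q N
  have h1 := sum_eigenvalues_pow (Matrix.isHermitian_conjTranspose_mul_self A) (n + 1)
  have h2 : ((Aᴴ * A) ^ (n + 1)).trace = ((A * Aᴴ) ^ (n + 1)).trace := by
    have : ∀ m, (Aᴴ * A) ^ (m + 1) = Aᴴ * ((A * Aᴴ) ^ m * A) := by
      intro m
      induction m with
      | zero => simp
      | succ m ih => rw [pow_succ, ih, pow_succ]; simp only [Matrix.mul_assoc]
    rw [this, Matrix.trace_mul_comm, Matrix.mul_assoc, ← pow_succ]
  have h3 : ∀ i, ((sieveEigenvalue Q N i / N : ℝ) : ℂ) ^ (n + 1) = ((N : ℂ) ^ (n + 1))⁻¹ *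
      ((Matrix.isHermitian_conjTranspose_mul_self A).eigenvalues i : ℂ) ^ (n + 1) := by
    intro i
    rw [Complex.ofReal_div, div_pow, div_eq_inv_mul, Complex.ofReal_natCast]
    rfl
  rw [Finset.sum_congr rfl fun i _ => h3 i, ← Finset.mul_sum, h1, h2, Matrix.trace, Finset.mul_sum]
  refine Finset.sum_congr rfl fun r _ => ?_
  rw [Matrix.diag_apply, pow_apply_eq_sum_chain, Finset.mul_sum]
  refine Finset.sum_congr rfl fun t _ => ?_
  simp only [chain, kernel, gram_apply, A]
  rw [Finset.prod_div_distrib]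
  simp [div_eq_inv_mul]

/-- The contribution of the tuple `t` at the point `p` to the trace. -/
def tupleTerm (Q N : ℕ) {n : ℕ} (t : Fin n → Pair) (p : ℝ × ℝ) : ℂ :=
  open scoped Classical in
  if ∀ i, t i ∈ window Q p then
    chain (fun i j => kernel N ((offset p i - offset p j) / (Q : ℝ) ^ 2)) basePair t basePair
  else 0

theorem path_map {I J : Type*} (f : I → J) {n : ℕ} (u : I) (t : Fin n → I) (v : I)
    (i : Fin (n + 2)) : path (f u) (fun i => f (t i)) (f v) i = f (path u t v i) := by
  refine Fin.cases rfl (fun j => ?_) i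
  simp only [path, Fin.cons_succ]
  refine Fin.lastCases ?_ (fun j => ?_) j <;> simp

theorem path_forall {I : Type*} {n : ℕ} {u : I} {t : Fin n → I} {v : I} {P : I → Prop}
    (hu : P u) (ht : ∀ i, P (t i)) (hv : P v) (i : Fin (n + 2)) : P (path u t v i) := by
  refine Fin.cases hu (fun j => ?_) i
  simp only [path, Fin.cons_succ]
  refine Fin.lastCases (by simpa using hv) (fun j => by simpa using ht j) j

theorem basePair_mem_window {Q : ℕ} {p : ℝ × ℝ} (hp : 0 < p.2) (hp1 : p.2 ≤ 1) :
    basePair ∈ window Q p := by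
  refine ⟨⟨by simpa using hp, by simpa using hp1⟩, ?_⟩
  simp

/-- The kernel has period one, so Farey fractions may be replaced by their representatives near the
starting point, that is by the pairs in the window. The starting point itself becomes `basePair`.
Tuples outside the window contribute zero, so the index set no longer depends on `Q` or `v`. -/
theorem sum_chain_eq_tsum {Q : ℕ} (N n : ℕ) {v : ℕ × ℕ} (hv : v ∈ trianglePoints Q) :
    ∑ t : Fin n → farey Q,
      chain (fun r s : farey Q => kernel N ((r : ℚ) - (s : ℚ) : ℝ)) ⟨fareyOf v, fareyOf_mem hv⟩ t
        ⟨fareyOf v, fareyOf_mem hv⟩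
      = ∑' t : Fin n → Pair, tupleTerm Q N t (scaledPoint Q v) := by
  classical
  have hequiv := exists_window_equiv hv
  set p := scaledPoint Q v with hp
  obtain ⟨φ, hφ⟩ := hequiv
  have hv' := mem_trianglePoints.1 hv
  have hy : 0 < p.2 ∧ p.2 ≤ 1 := by
    have h1 : (0 : ℝ) < v.2 := by exact_mod_cast hv'.1.trans hv'.2.1
    have h2 : (v.2 : ℝ) ≤ Q := by exact_mod_cast hv'.2.2.1
    simp only [hp, scaledPoint]
    exact ⟨div_pos h1 (h1.trans_le h2), div_le_one_of_le₀ h2 (h1.le.trans h2)⟩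
  have hbase := basePair_mem_window (Q := Q) hy.1 hy.2
  have hinj : Function.Injective fun (t : Fin n → window Q p) i => (t i : Pair) := by
    intro s t hst
    funext i
    exact Subtype.ext (congrFun hst i)
  have hsupp : Function.support (fun t : Fin n → Pair => tupleTerm Q N t p) ⊆
      Set.range fun (t : Fin n → window Q p) i => (t i : Pair) := by
    intro t ht
    rw [Function.mem_support, tupleTerm] at ht
    have h1 : ∀ i, t i ∈ window Q p := by
      by_contra h
      exact ht (if_neg h)
    exact ⟨fun i => ⟨t i, h1 i⟩, rfl⟩
  rw [← hinj.tsum_eq hsupp]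
  have : Fintype (window Q p) := Fintype.ofEquiv _ φ.symm
  rw [tsum_fintype, ← (Equiv.piCongrRight fun _ : Fin n => φ).sum_comp]
  refine Finset.sum_congr rfl fun t _ => ?_
  rw [tupleTerm, if_pos fun i => (t i).2]
  -- Both fractions lie in `(0, 1]` and differ by an integer, so they agree.
  have hφb : φ ⟨basePair, hbase⟩ = ⟨fareyOf v, fareyOf_mem hv⟩ := by
    obtain ⟨m, hm⟩ := hφ ⟨basePair, hbase⟩
    simp only [offset_basePair, zero_div, add_zero] at hm
    have h1 := mem_farey.1 (φ ⟨basePair, hbase⟩).2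
    have h2 := mem_farey.1 (fareyOf_mem hv)
    have h3 : ((φ ⟨basePair, hbase⟩ : farey Q) : ℚ) = fareyOf v + m := by exact_mod_cast hm
    have h4 : m < 1 := by
      have : (m : ℚ) < 1 := by linarith
      exact_mod_cast this
    have h5 : -1 < m := by
      have : (-1 : ℚ) < m := by linarith
      exact_mod_cast this
    have h6 : m = 0 := by omega
    refine Subtype.ext ?_
    rw [h3, h6]; simp
  rw [← hφb]
  simp only [chain]
  refine Finset.prod_congr rfl fun i _ => ?_
  rw [show (Equiv.piCongrRight fun _ : Fin n => φ) t = fun i => φ (t i) from rfl]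
  rw [path_map φ, path_map φ]
  rw [path_map (fun w : window Q p => (w : Pair)) ⟨basePair, hbase⟩ t ⟨basePair, hbase⟩,
    path_map (fun w : window Q p => (w : Pair)) ⟨basePair, hbase⟩ t ⟨basePair, hbase⟩]
  obtain ⟨m, hm⟩ := hφ (path ⟨basePair, hbase⟩ t ⟨basePair, hbase⟩ i.castSucc)
  obtain ⟨m', hm'⟩ := hφ (path ⟨basePair, hbase⟩ t ⟨basePair, hbase⟩ i.succ)
  rw [hm, hm', ← kernel_add_int N _ (m' - m)]
  congr 1
  push_cast
  ring

theorem sum_sieveEigenvalue_pow_eq (Q N n : ℕ) :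
    ∑ i, ((sieveEigenvalue Q N i / N : ℝ) : ℂ) ^ (n + 1) =
      ∑ v ∈ trianglePoints Q, ∑' t : Fin n → Pair, tupleTerm Q N t (scaledPoint Q v) := by
  classical
  rw [sum_sieveEigenvalue_pow]
  set Ψ : ℚ → ℂ := fun r => if hr : r ∈ farey Q then ∑ t : Fin n → farey Q,
        chain (fun r s : farey Q => kernel N ((r : ℚ) - (s : ℚ) : ℝ)) ⟨r, hr⟩ t ⟨r, hr⟩ else 0
    with hΨ
  have h1 : ∀ r : farey Q, ∑ t : Fin n → farey Q,
        chain (fun r s : farey Q => kernel N ((r : ℚ) - (s : ℚ) : ℝ)) r t r = Ψ r := by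
    rintro ⟨r, hr⟩
    simp [hΨ, hr]
  rw [Finset.sum_congr rfl fun r _ => h1 r, Finset.univ_eq_attach, Finset.sum_attach _ Ψ, sum_farey]
  refine Finset.sum_congr rfl fun v hv => ?_
  rw [hΨ]
  simp only
  rw [dif_pos (fareyOf_mem hv), sum_chain_eq_tsum N n hv]

/-! ### Bounds for sums over tuples, uniform in the order -/

theorem exists_int_abs_add_le (t : ℝ) (ht : |t| < 1) :
    ∃ k ∈ ({-1, 0, 1} : Finset ℤ), |t + k| ≤ 1 / 2 := by
  rw [abs_lt] at ht
  rcases lt_or_ge (1 / 2) t with h | h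
  · exact ⟨-1, by simp, by rw [abs_le]; push_cast; constructor <;> linarith⟩
  · rcases lt_or_ge t (-(1 / 2)) with h' | h'
    · exact ⟨1, by simp, by rw [abs_le]; push_cast; constructor <;> linarith⟩
    · exact ⟨0, by simp, by rw [abs_le]; push_cast; constructor <;> linarith⟩

theorem abs_sub_lt_one_of_mem_window {Q : ℕ} {p : ℝ × ℝ} {i j : Pair} (hi : i ∈ window Q p)
    (hj : j ∈ window Q p) : |(offset p i - offset p j) / (Q : ℝ) ^ 2| < 1 := by
  have h1 := hi.2
  have h2 := hj.2
  rw [Set.mem_Ioc] at h1 h2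
  rw [sub_div, abs_lt]
  constructor <;> linarith

/-- Scaled offsets lie in an interval of length one, so their difference is within `1/2` of one of
`-1, 0, 1`. The kernel thus decays in the distance modulo `Q ^ 2`, and three translates suffice to
express this. -/
theorem exists_norm_kernel_le {Q N : ℕ} (hQ : 0 < Q) (hN : 0 < N) {B : ℝ}
    (hB : 1 + (Q : ℝ) ^ 2 / (2 * N) ≤ B) {p : ℝ × ℝ} {i j : Pair} (hi : i ∈ window Q p)
    (hj : j ∈ window Q p) :
    ∃ k ∈ ({-1, 0, 1} : Finset ℤ), ‖kernel N ((offset p i - offset p j) / (Q : ℝ) ^ 2)‖ ≤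
      B / (1 + |offset p i - offset p j + k * (Q : ℝ) ^ 2|) := by
  have hQ' : (0 : ℝ) < Q := by exact_mod_cast hQ
  obtain ⟨k, hk, hk'⟩ := exists_int_abs_add_le _ (abs_sub_lt_one_of_mem_window hi hj)
  refine ⟨k, hk, ?_⟩
  have h1 := norm_kernel_le hN (sq_nonneg (Q : ℝ)) hk'
  rw [kernel_add_int] at h1
  refine h1.trans ?_
  have h2 : (Q : ℝ) ^ 2 * ((offset p i - offset p j) / (Q : ℝ) ^ 2 + k) =
      offset p i - offset p j + k * (Q : ℝ) ^ 2 := by field_simp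
  rw [h2]
  gcongr

/-- Each of the three possible translates gives a sum over `1`-separated points; hence the factor
`3`. -/
theorem tsum_kernel_rpow_le {Q N : ℕ} (hQ : 0 < Q) (hN : 0 < N) {B : ℝ}
    (hB : 1 + (Q : ℝ) ^ 2 / (2 * N) ≤ B) {p : ℝ × ℝ} (hp : 0 < p.2) {r : ℝ} (hr : 0 ≤ r)
    (i : window Q p) :
    ∑' j : window Q p, ‖kernel N ((offset p i - offset p j) / (Q : ℝ) ^ 2)‖ₑ ^ r
        ≤ 3 * sepConst B r ∧
    ∑' j : window Q p, ‖kernel N ((offset p j - offset p i) / (Q : ℝ) ^ 2)‖ₑ ^ r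
        ≤ 3 * sepConst B r := by
  have hB0 : 0 ≤ B := le_trans (by positivity) hB
  have key : ∀ i j : window Q p, ‖kernel N ((offset p i - offset p j) / (Q : ℝ) ^ 2)‖ₑ ^ r ≤
      ∑ k ∈ ({-1, 0, 1} : Finset ℤ), ENNReal.ofReal
        ((B / (1 + |offset p i - offset p j + k * (Q : ℝ) ^ 2|)) ^ r) := by
    intro i j
    obtain ⟨k, hk, hle⟩ := exists_norm_kernel_le hQ hN hB i.2 j.2
    refine le_trans ?_ (Finset.single_le_sum (fun _ _ => zero_le) hk)
    rw [← ofReal_norm, ENNReal.ofReal_rpow_of_nonneg (norm_nonneg _) hr]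
    exact ENNReal.ofReal_le_ofReal (Real.rpow_le_rpow (norm_nonneg _) hle hr)
  have hsep : ∀ u : ℝ, ∑' j : window Q p, ENNReal.ofReal ((B / (1 + |offset p j - u|)) ^ r)
      ≤ sepConst B r := fun u => tsum_separated_le (fun j : window Q p => offset p j)
        (fun i j hij => one_le_abs_offset_sub hp i.2.1 j.2.1 fun h => hij (Subtype.ext h)) hB0 hr u
  have h3 : ∑ k ∈ ({-1, 0, 1} : Finset ℤ), sepConst B r = 3 * sepConst B r := by
    rw [Finset.sum_const]; simp
  constructor
  · refine (ENNReal.tsum_le_tsum fun j => key i j).trans ?_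
    rw [Summable.tsum_finsetSum fun _ _ => ENNReal.summable, ← h3]
    refine Finset.sum_le_sum fun k _ => ?_
    refine le_trans (le_of_eq ?_) (hsep (offset p i + k * (Q : ℝ) ^ 2))
    refine tsum_congr fun j => ?_
    rw [← abs_neg]; congr 5; ring
  · refine (ENNReal.tsum_le_tsum fun j => key j i).trans ?_
    rw [Summable.tsum_finsetSum fun _ _ => ENNReal.summable, ← h3]
    refine Finset.sum_le_sum fun k _ => ?_
    refine le_trans (le_of_eq ?_) (hsep (offset p i - k * (Q : ℝ) ^ 2))
    refine tsum_congr fun j => ?_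
    congr 5; ring

/-- The exponent occurring in the bounds for sums over `(k + 1)`-tuples. -/
def tupleExp (k : ℕ) : ℝ := (2 * (k : ℝ) + 3) / (2 * k + 2)

theorem one_lt_tupleExp (k : ℕ) : 1 < tupleExp k := by
  rw [tupleExp, one_lt_div (by positivity)]
  linarith

/-- The constant bounding sums over `(k + 1)`-tuples. -/
def tupleConst (B : ℝ) (k : ℕ) : ℝ≥0∞ := (k + 2) * (3 * sepConst B (tupleExp k)) ^ (k + 1)

theorem tupleConst_lt_top {B : ℝ} (hB : 0 ≤ B) (k : ℕ) : tupleConst B k < ∞ := by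
  have := sepConst_lt_top hB (one_lt_tupleExp k)
  refine ENNReal.mul_lt_top ?_ (ENNReal.pow_lt_top (ENNReal.mul_lt_top (by simp) this))
  exact ENNReal.add_lt_top.2 ⟨by simp, by simp⟩

/-- Transfers `tsum_chain_small_edge_le` to the kernel on the window. With `η = 1` it bounds the
whole sum, with small `η` the tail. -/
theorem tsum_enorm_tupleTerm_le {Q N k : ℕ} (hQ : 0 < Q) (hN : 0 < N) {B : ℝ}
    (hB : 1 + (Q : ℝ) ^ 2 / (2 * N) ≤ B) {p : ℝ × ℝ} (hp : 0 < p.2) (hp1 : p.2 ≤ 1)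
    (P : Set (Fin (k + 1) → Pair)) (η : ℝ≥0∞)
    (hP : ∀ t ∈ P, (∀ i, t i ∈ window Q p) → ∃ i : Fin (k + 2),
      ‖kernel N ((offset p (path basePair t basePair i.castSucc) -
        offset p (path basePair t basePair i.succ)) / (Q : ℝ) ^ 2)‖ₑ ≤ η) :
    ∑' t : P, ‖tupleTerm Q N (t : Fin (k + 1) → Pair) p‖ₑ
      ≤ η ^ (1 / (2 * (k : ℝ) + 4)) * tupleConst B k := by
  classical
  set g : window Q p → window Q p → ℝ≥0∞ := fun i j =>
    ‖kernel N ((offset p i - offset p j) / (Q : ℝ) ^ 2)‖ₑ with hg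
  set b : window Q p := ⟨basePair, basePair_mem_window hp hp1⟩ with hb
  have hbound := tsum_chain_small_edge_le g (3 * sepConst B (tupleExp k)) k
    (fun i j => by
      rw [hg]; dsimp only
      rw [← ofReal_norm]
      exact ENNReal.ofReal_le_one.2 (norm_kernel_le_one N _))
    (fun i => (tsum_kernel_rpow_le hQ hN hB hp (zero_le_one.trans (one_lt_tupleExp k).le) i).1)
    (fun i => (tsum_kernel_rpow_le hQ hN hB hp (zero_le_one.trans (one_lt_tupleExp k).le) i).2)
    η b b
  refine le_trans ?_ hbound
  set T := {t : Fin (k + 1) → window Q p // ∃ i : Fin (k + 2),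
        g (path b t b i.castSucc) (path b t b i.succ) ≤ η} with hT
  rw [tsum_subtype P fun t : Fin (k + 1) → Pair => ‖tupleTerm Q N t p‖ₑ]
  set c : T → (Fin (k + 1) → Pair) := fun t i => (t.1 i : Pair) with hc
  have hpath : ∀ (t : Fin (k + 1) → window Q p) (i : Fin (k + 3)),
      path basePair (fun i => (t i : Pair)) basePair i = ((path b t b i : window Q p) : Pair) := fun t i =>
    path_map (fun w : window Q p => (w : Pair)) b t b i
  have hinj : Function.Injective c := by
    intro s t hst
    refine Subtype.ext (funext fun i => Subtype.ext (congrFun hst i))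
  have hsupp : Function.support (P.indicator fun t : Fin (k + 1) → Pair => ‖tupleTerm Q N t p‖ₑ) ⊆
      Set.range c := by
    intro t ht
    rw [Function.mem_support, Set.indicator_apply_ne_zero] at ht
    have hw : ∀ i, t i ∈ window Q p := by
      by_contra h
      exact ht.2 (by change ‖tupleTerm Q N t p‖ₑ = 0; rw [tupleTerm, if_neg h, enorm_zero])
    obtain ⟨i, hi⟩ := hP t ht.1 hw
    refine ⟨⟨fun i => ⟨t i, hw i⟩, i, ?_⟩, rfl⟩
    simp only [hg]
    rw [← hpath, ← hpath]
    exact hi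
  rw [← hinj.tsum_eq hsupp]
  refine ENNReal.tsum_le_tsum fun t => ?_
  refine (Set.indicator_le_self P _ _).trans ?_
  rw [tupleTerm, if_pos fun i => (t.1 i).2]
  simp only [chain, hc, hpath, hg]
  rw [← ofReal_norm, norm_prod, ENNReal.ofReal_prod_of_nonneg fun _ _ => norm_nonneg _]
  simp only [ofReal_norm, le_refl]

theorem tsum_enorm_tupleTerm_le_tupleConst {Q N k : ℕ} (hQ : 0 < Q) (hN : 0 < N) {B : ℝ}
    (hB : 1 + (Q : ℝ) ^ 2 / (2 * N) ≤ B) {p : ℝ × ℝ} (hp : 0 < p.2) (hp1 : p.2 ≤ 1) :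
    ∑' t : Fin (k + 1) → Pair, ‖tupleTerm Q N t p‖ₑ ≤ tupleConst B k := by
  have := tsum_enorm_tupleTerm_le (k := k) hQ hN hB hp hp1 Set.univ 1 (fun t _ _ => ⟨0, by
    rw [← ofReal_norm]
    exact ENNReal.ofReal_le_one.2 (norm_kernel_le_one N _)⟩)
  rw [ENNReal.one_rpow, one_mul, tsum_univ (fun t : Fin (k + 1) → Pair => ‖tupleTerm Q N t p‖ₑ)]
    at this
  exact this

/-! ### Reduction to finitely many tuples -/

/-- The pairs with bounded entries. -/
def boundedPairs (R : ℝ) : Set Pair := {i | |(i.1.1 : ℝ)| ≤ (R + 1) ^ 2 ∧ |(i.1.2 : ℝ)| ≤ R}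

theorem finite_boundedPairs (R : ℝ) : (boundedPairs R).Finite := by
  have h1 : ∀ C : ℝ, {n : ℤ | |(n : ℝ)| ≤ C}.Finite := by
    intro C
    refine (Set.finite_Icc (-⌈C⌉) ⌈C⌉).subset fun n hn => ?_
    rw [Set.mem_ofPred_eq, abs_le] at hn
    have h2 := Int.le_ceil C
    constructor
    · have : ((-⌈C⌉ : ℤ) : ℝ) ≤ n := by push_cast; linarith
      exact_mod_cast this
    · have : (n : ℝ) ≤ ((⌈C⌉ : ℤ) : ℝ) := by linarith
      exact_mod_cast this
  refine Set.Finite.of_finite_image (f := Subtype.val) ?_ Subtype.val_injective.injOn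
  refine ((h1 ((R + 1) ^ 2)).prod (h1 R)).subset ?_
  rintro _ ⟨i, hi, rfl⟩
  exact hi

/-- The bound is uniform as `y` tends to `0`. Indeed `|B| ≤ R y`; if `B ≠ 0` this forces `1 ≤ R y`,
so that the bound `|A| y ≤ 1 + R` controls `A` by `R` alone, and if `B = 0` then coprimality gives
`|A| = 1`. -/
theorem mem_boundedPairs {p : ℝ × ℝ} (hx : 0 ≤ p.1) (hxy : p.1 ≤ p.2) (hy : 0 < p.2)
    (hy1 : p.2 ≤ 1) {i : Pair} (hi : i ∈ localPairs p) {R : ℝ} (hR : |offset p i| ≤ R) :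
    i ∈ boundedPairs R := by
  have hR0 : 0 ≤ R := (abs_nonneg _).trans hR
  obtain ⟨hd0, hd1⟩ := hi
  have hB : |(i.1.2 : ℝ)| = |offset p i| * (p.2 * denom i p) := by
    rw [offset_eq, abs_div, abs_of_pos (mul_pos hy hd0), div_mul_cancel₀ _ (mul_pos hy hd0).ne']
  have hB1 : |(i.1.2 : ℝ)| ≤ R * p.2 := by
    rw [hB]
    refine mul_le_mul hR ?_ (mul_pos hy hd0).le hR0
    nlinarith
  refine ⟨?_, hB1.trans (by nlinarith)⟩
  by_cases hB0 : i.1.2 = 0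
  · have h1 := i.2
    rw [hB0, Int.gcd_zero_right] at h1
    have h2 : |(i.1.1 : ℝ)| = 1 := by
      rw [← Int.cast_abs, Int.abs_eq_natAbs, h1]; simp
    rw [h2]; nlinarith
  · have h1 : (1 : ℝ) ≤ |(i.1.2 : ℝ)| := by exact_mod_cast Int.one_le_abs hB0
    have h2 : |(i.1.1 : ℝ)| * p.2 ≤ 1 + R := by
      have h3 : (i.1.1 : ℝ) * p.2 = denom i p + i.1.2 * p.1 := by simp [denom]
      have h4 : |(i.1.1 : ℝ)| * p.2 = |(i.1.1 : ℝ) * p.2| := by rw [abs_mul, abs_of_pos hy]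
      rw [h4, h3]
      refine (abs_add_le _ _).trans (add_le_add (by rw [abs_of_pos hd0]; exact hd1) ?_)
      rw [abs_mul, abs_of_nonneg hx]
      calc |(i.1.2 : ℝ)| * p.1 ≤ (R * p.2) * p.1 := by gcongr
        _ ≤ (R * 1) * 1 := by gcongr; linarith
        _ = R := by ring
    have h3 : |(i.1.1 : ℝ)| ≤ (1 + R) * R := by
      have h4 : |(i.1.1 : ℝ)| * p.2 ≤ (1 + R) * R * p.2 := by nlinarith
      exact le_of_mul_le_mul_right h4 hy
    nlinarith

theorem path_succ_castSucc {I : Type*} {n : ℕ} (u : I) (t : Fin n → I) (v : I) (i : Fin n) :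
    path u t v i.castSucc.succ = t i := by
  simp [path]

/-- If every edge exceeded `η`, consecutive offsets would be within `B / η` of each other modulo `Q
^ 2`. As the path starts at offset `0` and has `k + 2` edges, all offsets would be at most `(k + 2)
B / η` modulo `Q ^ 2`, and only bounded pairs would occur. -/
theorem exists_small_edge {Q N k : ℕ} (hQ : 0 < Q) (hN : 0 < N) {B η : ℝ} (hη : 0 < η)
    (hB : 1 + (Q : ℝ) ^ 2 / (2 * N) ≤ B) {p : ℝ × ℝ} (hx : 0 ≤ p.1) (hxy : p.1 ≤ p.2)
    (hp : 0 < p.2) (hp1 : p.2 ≤ 1) {t : Fin (k + 1) → Pair} (ht : ∀ i, t i ∈ window Q p)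
    (hbad : ∃ i, t i ∉ boundedPairs ((k + 2) * (B / η))) :
    ∃ i : Fin (k + 2), ‖kernel N ((offset p (path basePair t basePair i.castSucc) -
        offset p (path basePair t basePair i.succ)) / (Q : ℝ) ^ 2)‖ₑ ≤ ENNReal.ofReal η := by
  by_contra! hcon
  have hQ' : (0 : ℝ) < (Q : ℝ) ^ 2 := by positivity
  have hB0 : 0 ≤ B := le_trans (by positivity) hB
  have hw : ∀ i, path basePair t basePair i ∈ window Q p :=
    path_forall (P := fun i => i ∈ window Q p) (basePair_mem_window hp hp1) ht
      (basePair_mem_window hp hp1)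
  have hedge : ∀ i : Fin (k + 2), ∃ m : ℤ, |offset p (path basePair t basePair i.castSucc) -
      offset p (path basePair t basePair i.succ) + m * (Q : ℝ) ^ 2| ≤ B / η := by
    intro i
    obtain ⟨m, -, hm⟩ := exists_norm_kernel_le hQ hN hB (hw i.castSucc) (hw i.succ)
    refine ⟨m, ?_⟩
    have h1 := hcon i
    rw [← ofReal_norm, ENNReal.ofReal_lt_ofReal_iff_of_nonneg hη.le] at h1
    have h2 := h1.trans_le hm
    rw [lt_div_iff₀ (by positivity)] at h2
    rw [le_div_iff₀ hη]
    nlinarith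
  have hall : ∀ i : Fin (k + 3), ∃ m : ℤ,
      |offset p (path basePair t basePair i) + m * (Q : ℝ) ^ 2| ≤ (i : ℕ) * (B / η) := by
    intro i
    induction i using Fin.induction with
    | zero => exact ⟨0, by simp [path]⟩
    | succ i ih =>
      obtain ⟨m, hm⟩ := ih
      obtain ⟨m', hm'⟩ := hedge i
      refine ⟨m - m', ?_⟩
      have h1 : offset p (path basePair t basePair i.succ) + ((m - m' : ℤ) : ℝ) * (Q : ℝ) ^ 2 =
          (offset p (path basePair t basePair i.castSucc) + m * (Q : ℝ) ^ 2) -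
          (offset p (path basePair t basePair i.castSucc) -
            offset p (path basePair t basePair i.succ) + m' * (Q : ℝ) ^ 2) := by push_cast; ring
      rw [h1]
      refine (abs_sub _ _).trans ?_
      rw [Fin.val_succ]
      rw [Fin.val_castSucc] at hm
      push_cast
      linarith
  obtain ⟨i, hi⟩ := hbad
  apply hi
  obtain ⟨m, hm⟩ := hall i.castSucc.succ
  rw [path_succ_castSucc] at hm
  refine mem_boundedPairs hx hxy hp hp1 (ht i).1 ?_
  -- The window puts the offset in `(-Q²/2, Q²/2]`, where it has the least absolute value among its
  -- translates by multiples of `Q ^ 2`.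
  have h1 : |offset p (t i)| ≤ |offset p (t i) + m * (Q : ℝ) ^ 2| := by
    have h2 := (ht i).2
    rw [Set.mem_Ioc, lt_div_iff₀ hQ', div_le_iff₀ hQ'] at h2
    rcases lt_trichotomy m 0 with h | h | h
    · have h3 : (m : ℝ) ≤ -1 := by exact_mod_cast (by omega : m ≤ -1)
      have h5 : (m : ℝ) * (Q : ℝ) ^ 2 ≤ -(Q : ℝ) ^ 2 := by nlinarith
      rw [abs_le]
      have h4 := neg_abs_le (offset p (t i) + m * (Q : ℝ) ^ 2)
      constructor <;> linarith
    · simp [h]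
    · have h3 : (1 : ℝ) ≤ m := by exact_mod_cast h
      have h5 : (Q : ℝ) ^ 2 ≤ (m : ℝ) * (Q : ℝ) ^ 2 := by nlinarith
      rw [abs_le]
      have h4 := le_abs_self (offset p (t i) + m * (Q : ℝ) ^ 2)
      constructor <;> linarith
  refine (h1.trans hm).trans ?_
  have h3 : ((i.castSucc.succ : Fin (k + 3)) : ℕ) ≤ k + 2 := by
    simp only [Fin.val_succ, Fin.val_castSucc]; omega
  have h4 : (((i.castSucc.succ : Fin (k + 3)) : ℕ) : ℝ) ≤ k + 2 := by exact_mod_cast h3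
  gcongr

/-- Tuples leaving a finite set contribute little to the trace, uniformly in `Q`. -/
theorem tsum_enorm_tupleTerm_tail_le {Q N k : ℕ} (hQ : 0 < Q) (hN : 0 < N) {B η : ℝ} (hη : 0 < η)
    (hB : 1 + (Q : ℝ) ^ 2 / (2 * N) ≤ B) {p : ℝ × ℝ} (hx : 0 ≤ p.1) (hxy : p.1 ≤ p.2)
    (hp : 0 < p.2) (hp1 : p.2 ≤ 1) :
    ∑' t : {t : Fin (k + 1) → Pair | ∃ i, t i ∉ boundedPairs ((k + 2) * (B / η))},
      ‖tupleTerm Q N (t : Fin (k + 1) → Pair) p‖ₑ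
      ≤ ENNReal.ofReal η ^ (1 / (2 * (k : ℝ) + 4)) * tupleConst B k :=
  tsum_enorm_tupleTerm_le hQ hN hB hp hp1 _ _ fun _ ht hw =>
    exists_small_edge hQ hN hη hB hx hxy hp hp1 hw ht

/-! ### The limit of the normalised Dirichlet kernel -/

theorem continuous_e : Continuous e := by
  unfold e
  fun_prop

/-- The function `(e(x) - 1) / (2 π i x)`, continuously extended. -/
def psi (x : ℝ) : ℂ := e (x / 2) * Real.sinc (Real.pi * x)

theorem continuous_psi : Continuous psi := by
  unfold psi
  exact (continuous_e.comp (by fun_prop)).mul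
    (Complex.continuous_ofReal.comp (Real.continuous_sinc.comp (by fun_prop)))

theorem psi_zero : psi 0 = 1 := by simp [psi]

theorem e_sub_one_eq_psi (x : ℝ) : e x - 1 = 2 * Real.pi * Complex.I * x * psi x := by
  rw [e_sub_one, psi]
  rcases eq_or_ne x 0 with rfl | hx
  · simp
  · rw [Real.sinc_of_ne_zero (mul_ne_zero Real.pi_ne_zero hx)]
    have h1 : (x : ℂ) ≠ 0 := by exact_mod_cast hx
    have h2 : (Real.pi : ℂ) ≠ 0 := by exact_mod_cast Real.pi_ne_zero
    push_cast
    field_simp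

/-- The geometric sum formula with the factor `2 π i t` cancelled; unlike the original it carries
information at `t = 0`, so the limit of the kernel follows from continuity of `psi`. -/
theorem psi_mul_kernel {N : ℕ} (hN : 0 < N) (t : ℝ) : psi t * kernel N t = e t * psi (N * t) := by
  have hN' : (N : ℂ) ≠ 0 := by exact_mod_cast hN.ne'
  rcases eq_or_ne t 0 with rfl | ht
  · simp [psi_zero, kernel, dirichletKernel, hN']
  · have h1 := sub_one_mul_dirichletKernel N t
    rw [e_sub_one_eq_psi, e_sub_one_eq_psi] at h1
    have h2 : (2 * Real.pi * Complex.I * t : ℂ) ≠ 0 := by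
      have : (t : ℂ) ≠ 0 := by exact_mod_cast ht
      simp [Real.pi_ne_zero, this]
    rw [kernel, mul_div_assoc', div_eq_iff hN']
    refine mul_left_cancel₀ h2 ?_
    push_cast at h1
    linear_combination h1

theorem tendsto_kernel {ι : Type*} {l : Filter ι} {N : ι → ℕ} {t : ι → ℝ} {c : ℝ}
    (ht : Tendsto t l (𝓝 0)) (hN : ∀ᶠ i in l, 0 < N i)
    (hc : Tendsto (fun i => (N i : ℝ) * t i) l (𝓝 c)) :
    Tendsto (fun i => kernel (N i) (t i)) l (𝓝 (psi c)) := by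
  have h1 : Tendsto (fun i => psi (t i)) l (𝓝 1) := by
    have := (continuous_psi.tendsto 0).comp ht
    rwa [psi_zero] at this
  have h2 : Tendsto (fun i => e (t i)) l (𝓝 1) := by
    have := (continuous_e.tendsto 0).comp ht
    rwa [e_zero] at this
  have h3 := (h2.mul ((continuous_psi.tendsto c).comp hc)).div h1 one_ne_zero
  rw [one_mul, div_one] at h3
  refine h3.congr' ?_
  filter_upwards [h1.eventually_ne one_ne_zero, hN] with i hi hNi
  simp only [Pi.div_apply, Function.comp]
  rw [div_eq_iff hi, mul_comm (kernel _ _), psi_mul_kernel hNi]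

/-! ### The limiting contribution of a single tuple -/

/-- The set `D_{A,B}` of a tuple of pairs. -/
def tupleDomain {n : ℕ} (t : Fin n → Pair) : Set (ℝ × ℝ) :=
  domain (fun i => (t i).1.1) (fun i => (t i).1.2)

theorem mem_tupleDomain {n : ℕ} {t : Fin n → Pair} {p : ℝ × ℝ} : p ∈ tupleDomain t ↔
    (0 ≤ p.1 ∧ p.1 ≤ p.2 ∧ p.2 ≤ 1) ∧ ∀ i, t i ∈ localPairs p := by
  simp only [tupleDomain, domain, localPairs, denom, Set.mem_ofPred_eq]
  tauto

theorem pos_of_mem_localPairs {p : ℝ × ℝ} (hx : 0 ≤ p.1) (hxy : p.1 ≤ p.2) {i : Pair}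
    (hi : i ∈ localPairs p) : 0 < p.2 := by
  refine (hx.trans hxy).lt_of_ne fun h => ?_
  have h1 : p.1 = 0 := le_antisymm (by rwa [← h] at hxy) hx
  have h2 := hi.1
  simp [denom, h1, ← h] at h2

/-- Convexity makes the frontier a null set, so that indicator functions of these domains are
continuous almost everywhere. -/
theorem convex_tupleDomain {n : ℕ} (t : Fin n → Pair) : Convex ℝ (tupleDomain t) := by
  intro p hp q hq a b ha hb hab
  rw [mem_tupleDomain] at hp hq ⊢
  obtain ⟨⟨h1, h2, h3⟩, h4⟩ := hp
  obtain ⟨⟨h1', h2', h3'⟩, h4'⟩ := hq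
  simp only [Prod.fst_add, Prod.snd_add, Prod.smul_fst, Prod.smul_snd, smul_eq_mul]
  refine ⟨⟨by positivity, by gcongr, ?_⟩, fun i => ?_⟩
  · exact (convex_Iic (1 : ℝ)) h3 h3' ha hb hab
  · have h5 := (convex_Ioc (0 : ℝ) 1) (show denom (t i) p ∈ _ from h4 i)
      (show denom (t i) q ∈ _ from h4' i) ha hb hab
    have h6 : denom (t i) (a • p + b • q) = a • denom (t i) p + b • denom (t i) q := by
      simp only [denom, Prod.fst_add, Prod.snd_add, Prod.smul_fst, Prod.smul_snd, smul_eq_mul]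
      ring
    rw [← h6] at h5
    exact h5

theorem measurable_denom (i : Pair) : Measurable (denom i) := by
  unfold denom
  fun_prop

theorem measurable_offset (i : Pair) : Measurable fun p => offset p i := by
  simp only [offset_eq]
  exact measurable_const.div (measurable_snd.mul (measurable_denom i))

theorem measurableSet_tupleDomain {n : ℕ} (t : Fin n → Pair) : MeasurableSet (tupleDomain t) := by
  have : tupleDomain t = ({p : ℝ × ℝ | 0 ≤ p.1} ∩ {p | p.1 ≤ p.2} ∩ {p | p.2 ≤ 1}) ∩
      ⋂ i, ({p | 0 < denom (t i) p} ∩ {p | denom (t i) p ≤ 1}) := by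
    ext p
    rw [mem_tupleDomain]
    simp only [Set.mem_inter_iff, Set.mem_iInter, Set.mem_ofPred_eq, localPairs]
    tauto
  rw [this]
  refine (((measurableSet_le measurable_const measurable_fst).inter
    (measurableSet_le measurable_fst measurable_snd)).inter
    (measurableSet_le measurable_snd measurable_const)).inter (MeasurableSet.iInter fun i =>
      (measurableSet_lt measurable_const (measurable_denom _)).inter
        (measurableSet_le (measurable_denom _) measurable_const))

/-- The product of cardinal sines along a tuple. -/
def sincChain (α : ℝ) {n : ℕ} (t : Fin n → Pair) (p : ℝ × ℝ) : ℝ :=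
  chain (fun i j => Real.sinc (Real.pi * (α * (offset p i - offset p j)))) basePair t basePair

theorem sincChain_eq_integrand (α : ℝ) {k : ℕ} (t : Fin (k + 1) → Pair) (p : ℝ × ℝ) :
    sincChain α t p = integrand α (fun i => (t i).1.1) (fun i => (t i).1.2) p := by
  rw [sincChain, chain_eq, integrand]
  simp only [offset_basePair, zero_sub, sub_zero]
  congr 2
  · rw [← Real.sinc_neg]; congr 1; simp only [offset]; ring
  · congr 1; simp only [offset]; ring
  · funext i
    congr 1; simp only [offset]; ring

theorem measurable_sincChain (α : ℝ) {n : ℕ} (t : Fin n → Pair) : Measurable (sincChain α t) := by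
  unfold sincChain chain
  refine Finset.measurable_prod _ fun i _ => ?_
  exact Real.continuous_sinc.measurable.comp
    ((((measurable_offset _).sub (measurable_offset _)).const_mul α).const_mul Real.pi)

theorem norm_chain_le_one {I : Type*} {n : ℕ} (g : I → I → ℂ) (hg : ∀ i j, ‖g i j‖ ≤ 1) (u : I)
    (t : Fin n → I) (v : I) : ‖chain g u t v‖ ≤ 1 := by
  rw [chain, norm_prod]
  exact Finset.prod_le_one (fun _ _ => norm_nonneg _) fun _ _ => hg _ _

/-- Factors of the form `a i / a j` telescope along the path and leave only its ends; on a closed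
path they cancel completely. -/
theorem chain_conj {I : Type*} {n : ℕ} (a : I → ℂ) (ha : ∀ i, a i ≠ 0) (b : I → I → ℂ) (u : I)
    (t : Fin n → I) (v : I) :
    chain (fun i j => a i * (a j)⁻¹ * b i j) u t v = a u * (a v)⁻¹ * chain b u t v := by
  induction n generalizing u with
  | zero => simp only [chain_zero]
  | succ n ih =>
    obtain ⟨x, s, rfl⟩ : ∃ x, ∃ s : Fin n → I, t = (Fin.cons x s : Fin (n + 1) → I) :=
      ⟨t 0, Fin.tail t, (Fin.cons_self_tail t).symm⟩
    rw [chain_cons, chain_cons, ih]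
    field_simp [ha x]

/-- The phase of `psi (α (h_i - h_j))` is a quotient of a function of `i` by the same function of
`j`, so it disappears around the closed path and a real product remains. -/
theorem chain_psi (α : ℝ) {n : ℕ} (t : Fin n → Pair) (p : ℝ × ℝ) :
    chain (fun i j => psi (α * (offset p i - offset p j))) basePair t basePair
      = (sincChain α t p : ℂ) := by
  have h1 : (fun i j => psi (α * (offset p i - offset p j))) = fun i j =>
      e (α * offset p i / 2) * (e (α * offset p j / 2))⁻¹ *
        ((Real.sinc (Real.pi * (α * (offset p i - offset p j))) : ℝ) : ℂ) := by
    funext i j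
    rw [psi]
    congr 1
    have h2 : e (α * offset p j / 2) ≠ 0 := by
      intro h; have := norm_e (α * offset p j / 2); rw [h] at this; simp at this
    rw [eq_mul_inv_iff_mul_eq₀ h2, ← e_add]
    congr 1; ring
  rw [h1, chain_conj (fun i => e (α * offset p i / 2))]
  · simp [sincChain, chain]
  · intro i h; have := norm_e (α * offset p i / 2); rw [h] at this; simp at this

theorem continuousAt_offset {p : ℝ × ℝ} (hp : 0 < p.2) {i : Pair} (hi : 0 < denom i p) :
    ContinuousAt (fun p => offset p i) p := by
  simp only [offset_eq]
  refine ContinuousAt.div continuousAt_const (continuousAt_snd.mul ?_) (mul_pos hp hi).ne'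
  unfold denom
  fun_prop

/-- The tuple term cut off to the triangle `0 ≤ x ≤ y ≤ 1`. -/
def triangleTerm (Q N : ℕ) {n : ℕ} (t : Fin n → Pair) (p : ℝ × ℝ) : ℂ :=
  open scoped Classical in if 0 ≤ p.1 ∧ p.1 ≤ p.2 ∧ p.2 ≤ 1 then tupleTerm Q N t p else 0

theorem triangleTerm_of_notMem {Q N n : ℕ} {t : Fin n → Pair} {p : ℝ × ℝ}
    (hp : p ∉ tupleDomain t) : triangleTerm Q N t p = 0 := by
  rw [triangleTerm]
  split_ifs with h
  · rw [tupleTerm, if_neg]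
    intro hw
    exact hp (mem_tupleDomain.2 ⟨h, fun i => (hw i).1⟩)
  · rfl

theorem norm_triangleTerm_le_one {Q N n : ℕ} (t : Fin n → Pair) (p : ℝ × ℝ) :
    ‖triangleTerm Q N t p‖ ≤ 1 := by
  rw [triangleTerm]
  split_ifs
  · rw [tupleTerm]
    split_ifs
    · exact norm_chain_le_one _ (fun _ _ => norm_kernel_le_one N _) _ _ _
    · simp
  · simp

/-- In the interior of the domain nearby points satisfy the same inequalities, the window condition
holds eventually because the offsets stay bounded while `Q ^ 2` grows, and each kernel converges.
Outside the closure all nearby terms vanish. -/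
theorem tendsto_triangleTerm {N : ℕ → ℕ} {α : ℝ} (hN0 : ∀ᶠ Q in atTop, 0 < N Q)
    (hN : Tendsto (fun Q : ℕ => (N Q : ℝ) / (Q : ℝ) ^ 2) atTop (𝓝 α)) {n : ℕ} (t : Fin n → Pair)
    {p : ℝ × ℝ} (hp : p ∉ frontier (tupleDomain t)) :
    Tendsto (fun q : ℕ × (ℝ × ℝ) => triangleTerm q.1 (N q.1) t q.2) (atTop ×ˢ 𝓝 p)
      (𝓝 ((tupleDomain t).indicator (fun p => (sincChain α t p : ℂ)) p)) := by
  by_cases hpi : p ∈ interior (tupleDomain t)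
  · have hpd := interior_subset hpi
    have hpd' := mem_tupleDomain.1 hpd
    rw [Set.indicator_of_mem hpd, ← chain_psi]
    have hinv : Tendsto (fun q : ℕ × (ℝ × ℝ) => ((q.1 : ℝ) ^ 2)⁻¹) (atTop ×ˢ 𝓝 p) (𝓝 0) := by
      refine Tendsto.comp (tendsto_inv_atTop_zero) ?_
      exact ((tendsto_pow_atTop two_ne_zero).comp tendsto_natCast_atTop_atTop).comp tendsto_fst
    have hoff : ∀ i, i = basePair ∨ i ∈ Set.range t →
        Tendsto (fun q : ℕ × (ℝ × ℝ) => offset q.2 i) (atTop ×ˢ 𝓝 p) (𝓝 (offset p i)) := by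
      rintro i (rfl | ⟨j, rfl⟩)
      · simp
      · have hj := hpd'.2 j
        have hy := pos_of_mem_localPairs hpd'.1.1 hpd'.1.2.1 hj
        exact (continuousAt_offset hy hj.1).tendsto.comp tendsto_snd
    have hwin : ∀ᶠ q : ℕ × (ℝ × ℝ) in atTop ×ˢ 𝓝 p, q.2 ∈ tupleDomain t ∧
        ∀ i, t i ∈ window q.1 q.2 := by
      have h1 : ∀ᶠ q : ℕ × (ℝ × ℝ) in atTop ×ˢ 𝓝 p, q.2 ∈ tupleDomain t :=
        tendsto_snd.eventually (mem_interior_iff_mem_nhds.1 hpi)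
      have h2 : ∀ᶠ q : ℕ × (ℝ × ℝ) in atTop ×ˢ 𝓝 p, ∀ i,
          offset q.2 (t i) / (q.1 : ℝ) ^ 2 ∈ Set.Ioc (-(1 / 2) : ℝ) (1 / 2) := by
        refine eventually_all.2 fun i => ?_
        have h3 := (hoff (t i) (Or.inr ⟨i, rfl⟩)).mul hinv
        rw [mul_zero] at h3
        exact h3.eventually (Ioc_mem_nhds (by norm_num) (by norm_num))
      filter_upwards [h1, h2] with q hq1 hq2
      exact ⟨hq1, fun i => ⟨(mem_tupleDomain.1 hq1).2 i, hq2 i⟩⟩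
    have hlim : Tendsto (fun q : ℕ × (ℝ × ℝ) =>
        chain (fun i j => kernel (N q.1) ((offset q.2 i - offset q.2 j) / (q.1 : ℝ) ^ 2))
          basePair t basePair) (atTop ×ˢ 𝓝 p)
        (𝓝 (chain (fun i j => psi (α * (offset p i - offset p j))) basePair t basePair)) := by
      unfold chain
      refine tendsto_finsetProd _ fun i _ => ?_
      have hpath : ∀ i, path basePair t basePair i = basePair ∨
          path basePair t basePair i ∈ Set.range t :=
        path_forall (P := fun i => i = basePair ∨ i ∈ Set.range t) (Or.inl rfl)
          (fun i => Or.inr ⟨i, rfl⟩) (Or.inl rfl)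
      have hd := (hoff _ (hpath i.castSucc)).sub (hoff _ (hpath i.succ))
      refine tendsto_kernel ?_ (tendsto_fst.eventually hN0) ?_
      · simpa [div_eq_mul_inv] using hd.mul hinv
      · refine ((hN.comp tendsto_fst).mul hd).congr fun q => ?_
        simp only [Function.comp]
        ring
    refine hlim.congr' ?_
    filter_upwards [hwin] with q hq
    rw [triangleTerm, if_pos (mem_tupleDomain.1 hq.1).1, tupleTerm, if_pos hq.2]
  · have hpc : p ∉ closure (tupleDomain t) := fun h => hp ⟨h, hpi⟩
    have hpd : p ∉ tupleDomain t := fun h => hpc (subset_closure h)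
    rw [Set.indicator_of_notMem hpd]
    refine tendsto_const_nhds.congr' ?_
    have : ∀ᶠ q : ℕ × (ℝ × ℝ) in atTop ×ˢ 𝓝 p, q.2 ∉ tupleDomain t := by
      have h1 : ∀ᶠ q in 𝓝 p, q ∉ tupleDomain t := by
        filter_upwards [isClosed_closure.isOpen_compl.mem_nhds hpc] with q hq h
        exact hq (subset_closure h)
      exact tendsto_snd.eventually h1
    filter_upwards [this] with q hq
    rw [triangleTerm_of_notMem hq]

theorem scaledPoint_mem {Q : ℕ} {v : ℕ × ℕ} (hv : v ∈ trianglePoints Q) :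
    0 ≤ (scaledPoint Q v).1 ∧ (scaledPoint Q v).1 ≤ (scaledPoint Q v).2 ∧
      0 < (scaledPoint Q v).2 ∧ (scaledPoint Q v).2 ≤ 1 := by
  obtain ⟨h1, h2, h3, -⟩ := mem_trianglePoints.1 hv
  have h4 : (0 : ℝ) < v.2 := by exact_mod_cast h1.trans h2
  have h5 : (v.2 : ℝ) ≤ Q := by exact_mod_cast h3
  have h6 : (v.1 : ℝ) ≤ v.2 := by exact_mod_cast h2
  have h7 : (0 : ℝ) < Q := h4.trans_le h5
  simp only [scaledPoint]
  exact ⟨by positivity, by gcongr, by positivity, div_le_one_of_le₀ h5 h7.le⟩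

theorem sum_trianglePoints_tupleTerm (Q N : ℕ) {n : ℕ} (t : Fin n → Pair) :
    ∑ v ∈ trianglePoints Q, tupleTerm Q N t (scaledPoint Q v) =
      ∑ v ∈ primitivePoints Q, triangleTerm Q N t (scaledPoint Q v) := by
  rw [trianglePoints, Finset.sum_filter]
  refine Finset.sum_congr rfl fun v hv => ?_
  split_ifs with h
  · have h1 := scaledPoint_mem (Finset.mem_filter.2 ⟨hv, h⟩)
    rw [triangleTerm, if_pos ⟨h1.1, h1.2.1, h1.2.2.2⟩]
  · rw [triangleTerm, if_neg]
    rintro ⟨-, h2, -⟩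
    simp only [primitivePoints, Finset.mem_filter, Finset.mem_product, Finset.mem_Icc] at hv
    have hQ : (0 : ℝ) < Q := by
      have : 0 < Q := by omega
      exact_mod_cast this
    simp only [scaledPoint] at h2
    rw [div_le_div_iff_of_pos_right hQ] at h2
    exact h (by exact_mod_cast h2)

theorem setIntegral_indicator_tupleDomain {n : ℕ} (t : Fin n → Pair) (F : ℝ × ℝ → ℂ) :
    ∫ p in Set.Ioc 0 1 ×ˢ Set.Ioc 0 1, (tupleDomain t).indicator F p = ∫ p in tupleDomain t, F p := by
  rw [setIntegral_indicator (measurableSet_tupleDomain t)]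
  refine setIntegral_congr_set ?_
  have hne : ∀ᵐ p : ℝ × ℝ, p.1 ≠ 0 :=
    Measure.quasiMeasurePreserving_fst.ae (Measure.ae_ne volume (0 : ℝ))
  filter_upwards [hne] with p hp
  refine propext ⟨fun h => h.2, fun h => ⟨?_, h⟩⟩
  have h1 := (mem_tupleDomain.1 h).1
  have h2 : 0 < p.1 := lt_of_le_of_ne h1.1 (Ne.symm hp)
  exact ⟨⟨h2, h1.2.1.trans h1.2.2⟩, h2.trans_le h1.2.1, h1.2.2⟩

/-- Equidistribution applies because the frontier of the domain is null; passing from the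
normalisation `1 / Q ^ 2` to `1 / N` divides the density `6 / π ^ 2` by `α`. -/
theorem tendsto_average_tupleTerm {N : ℕ → ℕ} {α : ℝ} (hα : 0 < α)
    (hN : Tendsto (fun Q : ℕ => (N Q : ℝ) / (Q : ℝ) ^ 2) atTop (𝓝 α)) {n : ℕ} (t : Fin n → Pair) :
    Tendsto (fun Q => (N Q : ℂ)⁻¹ * ∑ v ∈ trianglePoints Q, tupleTerm Q (N Q) t (scaledPoint Q v))
      atTop (𝓝 (6 / ((Real.pi : ℂ) ^ 2 * α) * ∫ p in tupleDomain t, (sincChain α t p : ℂ))) := by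
  have hN0 : ∀ᶠ Q in atTop, 0 < N Q := by
    filter_upwards [hN.eventually (lt_mem_nhds hα)] with Q hQ
    rcases Nat.eq_zero_or_pos (N Q) with h | h
    · simp [h] at hQ
    · exact h
  have hfr : ∀ᵐ p : ℝ × ℝ, p ∉ frontier (tupleDomain t) :=
    measure_eq_zero_iff_ae_notMem.1 ((convex_tupleDomain t).addHaar_frontier volume)
  have h1 := tendsto_primitive_sum (fun Q p => triangleTerm Q (N Q) t p)
    ((tupleDomain t).indicator fun p => (sincChain α t p : ℂ)) 1
    (fun Q p => norm_triangleTerm_le_one t p) (by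
      filter_upwards [hfr] with p hp
      exact tendsto_triangleTerm hN0 hN t hp)
  rw [setIntegral_indicator_tupleDomain] at h1
  have hαc : (α : ℂ) ≠ 0 := by exact_mod_cast hα.ne'
  have h2 : Tendsto (fun Q : ℕ => (((N Q : ℝ) / (Q : ℝ) ^ 2 : ℝ) : ℂ)) atTop (𝓝 (α : ℂ)) :=
    (Complex.continuous_ofReal.tendsto α).comp hN
  have h3 := h1.div h2 hαc
  rw [show 6 / ((Real.pi : ℂ) ^ 2 * α) * ∫ p in tupleDomain t, (sincChain α t p : ℂ) =
    6 / (Real.pi : ℂ) ^ 2 * (∫ p in tupleDomain t, (sincChain α t p : ℂ)) / α by field_simp]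
  refine h3.congr' ?_
  filter_upwards [hN0, eventually_gt_atTop 0] with Q hQ hQ0
  rw [Pi.div_apply, sum_trianglePoints_tupleTerm]
  have h4 : (N Q : ℂ) ≠ 0 := by exact_mod_cast hQ.ne'
  have h5 : (Q : ℂ) ≠ 0 := by exact_mod_cast hQ0.ne'
  push_cast
  field_simp

/-! ### Absolute convergence of the limiting moments -/

theorem abs_sinc_le_div {α : ℝ} (hα : 0 < α) (u : ℝ) :
    |Real.sinc (Real.pi * (α * u))| ≤ (1 + 1 / α) / (1 + |u|) := by
  rw [le_div_iff₀ (by positivity), mul_add, mul_one]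
  refine add_le_add (Real.abs_sinc_le_one _) ?_
  rcases eq_or_ne u 0 with rfl | hu
  · simp only [abs_zero, mul_zero]; positivity
  · have h1 : Real.pi * (α * u) ≠ 0 := by
      have := Real.pi_ne_zero
      have := hα.ne'
      positivity
    have hu' : 0 < |u| := abs_pos.2 hu
    rw [Real.sinc_of_ne_zero h1, abs_div, abs_mul, abs_mul, abs_of_pos Real.pi_pos, abs_of_pos hα,
      div_mul_eq_mul_div, div_le_div_iff₀ (by positivity) hα]
    have h2 := Real.abs_sin_le_one (Real.pi * (α * u))
    have h3 : (1 : ℝ) ≤ Real.pi := by linarith [Real.pi_gt_three]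
    calc |Real.sin (Real.pi * (α * u))| * |u| * α ≤ 1 * |u| * α := by gcongr
      _ = 1 * (1 * (α * |u|)) := by ring
      _ ≤ 1 * (Real.pi * (α * |u|)) := by gcongr

/-- The uniform bound for the local sums of products of cardinal sines. -/
def sincConst (α : ℝ) (k : ℕ) : ℝ≥0∞ :=
  (k + 2) * sepConst (1 + 1 / α) (((k : ℝ) + 2) / (k + 1)) ^ (k + 1)

theorem sincConst_lt_top {α : ℝ} (hα : 0 < α) (k : ℕ) : sincConst α k < ∞ := by
  have h1 : 1 < ((k : ℝ) + 2) / (k + 1) := by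
    rw [one_lt_div (by positivity)]; linarith
  have := sepConst_lt_top (show 0 ≤ 1 + 1 / α by positivity) h1
  refine ENNReal.mul_lt_top ?_ (ENNReal.pow_lt_top this)
  exact ENNReal.add_lt_top.2 ⟨by simp, by simp⟩

/-- The same path estimate as for the finite kernels, now without translates because `sinc` is not
periodic. The bound does not depend on the point `p`. -/
theorem tsum_enorm_sincChain_le {α : ℝ} (hα : 0 < α) (k : ℕ) {p : ℝ × ℝ} (hp : 0 < p.2)
    (hp1 : p.2 ≤ 1) :
    ∑' t : Fin (k + 1) → Pair, (tupleDomain t).indicator (fun p => ‖sincChain α t p‖ₑ) p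
      ≤ sincConst α k := by
  set g : localPairs p → localPairs p → ℝ≥0∞ := fun i j =>
    ‖Real.sinc (Real.pi * (α * (offset p i - offset p j)))‖ₑ with hg
  set b : localPairs p := ⟨basePair, by simpa using hp, by simpa using hp1⟩ with hb
  have hB0 : 0 ≤ 1 + 1 / α := by positivity
  have hr : 0 ≤ ((k : ℝ) + 2) / (k + 1) := by positivity
  have hsep : ∀ u : ℝ, ∑' j : localPairs p, ENNReal.ofReal
      (((1 + 1 / α) / (1 + |offset p j - u|)) ^ (((k : ℝ) + 2) / (k + 1)))
      ≤ sepConst (1 + 1 / α) (((k : ℝ) + 2) / (k + 1)) := fun u =>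
    tsum_separated_le (fun j : localPairs p => offset p j)
      (fun i j hij => one_le_abs_offset_sub hp i.2 j.2 fun h => hij (Subtype.ext h)) hB0 hr u
  have hkey : ∀ i j : localPairs p, g i j ^ (((k : ℝ) + 2) / (k + 1)) ≤ ENNReal.ofReal
      (((1 + 1 / α) / (1 + |offset p i - offset p j|)) ^ (((k : ℝ) + 2) / (k + 1))) := by
    intro i j
    simp only [hg]
    rw [← ofReal_norm, ENNReal.ofReal_rpow_of_nonneg (norm_nonneg _) hr]
    exact ENNReal.ofReal_le_ofReal (Real.rpow_le_rpow (norm_nonneg _) (abs_sinc_le_div hα _) hr)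
  have hbound := tsum_chain_le g (sepConst (1 + 1 / α) (((k : ℝ) + 2) / (k + 1))) k
    (fun i => (ENNReal.tsum_le_tsum fun j => hkey i j).trans (le_of_eq_of_le
      (tsum_congr fun j => by rw [abs_sub_comm]) (hsep (offset p i))))
    (fun j => (ENNReal.tsum_le_tsum fun i => hkey i j).trans (hsep (offset p j))) b b
  refine le_trans ?_ hbound
  set c : (Fin (k + 1) → localPairs p) → (Fin (k + 1) → Pair) := fun t i => (t i : Pair) with hc
  have hinj : Function.Injective c := fun s t hst =>
    funext fun i => Subtype.ext (congrFun hst i)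
  have hsupp : Function.support (fun t : Fin (k + 1) → Pair =>
      (tupleDomain t).indicator (fun p => ‖sincChain α t p‖ₑ) p) ⊆ Set.range c := by
    intro t ht
    have h1 : p ∈ tupleDomain t := by
      by_contra h
      exact ht (Set.indicator_of_notMem h _)
    exact ⟨fun i => ⟨t i, (mem_tupleDomain.1 h1).2 i⟩, rfl⟩
  rw [← hinj.tsum_eq hsupp]
  refine ENNReal.tsum_le_tsum fun t => ?_
  refine (Set.indicator_le_self _ _ _).trans ?_
  have hpath : ∀ i : Fin (k + 3), path basePair (c t) basePair i =
      ((path b t b i : localPairs p) : Pair) := fun i =>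
    path_map (fun w : localPairs p => (w : Pair)) b t b i
  simp only [sincChain, chain, hpath, hg]
  rw [← ofReal_norm, norm_prod, ENNReal.ofReal_prod_of_nonneg fun _ _ => norm_nonneg _]
  simp only [ofReal_norm, le_refl]

/-- By Tonelli the sum moves inside the integral, where the pointwise bound applies on a region of
finite area containing all the domains. -/
theorem tsum_lintegral_enorm_sincChain_lt_top {α : ℝ} (hα : 0 < α) (k : ℕ) :
    ∑' t : Fin (k + 1) → Pair, ∫⁻ p in tupleDomain t, ‖sincChain α t p‖ₑ < ∞ := by
  set T : Set (ℝ × ℝ) := Set.Icc 0 1 ×ˢ Set.Ioc 0 1 with hT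
  have hTm : MeasurableSet T := measurableSet_Icc.prod measurableSet_Ioc
  have hsub : ∀ t : Fin (k + 1) → Pair, tupleDomain t ⊆ T := by
    intro t p hp
    have h1 := mem_tupleDomain.1 hp
    have h2 := pos_of_mem_localPairs h1.1.1 h1.1.2.1 (h1.2 0)
    exact ⟨⟨h1.1.1, h1.1.2.1.trans h1.1.2.2⟩, h2, h1.1.2.2⟩
  have h1 : ∀ t : Fin (k + 1) → Pair, ∫⁻ p in tupleDomain t, ‖sincChain α t p‖ₑ =
      ∫⁻ p in T, (tupleDomain t).indicator (fun p => ‖sincChain α t p‖ₑ) p := by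
    intro t
    rw [setLIntegral_indicator (measurableSet_tupleDomain t),
      Set.inter_eq_left.2 (hsub t)]
  simp_rw [h1]
  rw [← lintegral_tsum fun t =>
    ((measurable_sincChain α t).enorm.indicator (measurableSet_tupleDomain t)).aemeasurable]
  calc _ ≤ ∫⁻ p in T, sincConst α k := by
        refine setLIntegral_mono measurable_const fun p hp => ?_
        exact tsum_enorm_sincChain_le hα k hp.2.1 hp.2.2
    _ < ∞ := by
        rw [setLIntegral_const]
        refine ENNReal.mul_lt_top (sincConst_lt_top hα k) ?_
        rw [hT, Measure.volume_eq_prod, Measure.prod_prod]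
        simp

/-- Tuples of coprime pairs in the form used for the moments. -/
def indexEquiv (m : ℕ) : (Fin m → Pair) ≃ Index m where
  toFun t := ⟨(fun i => (t i).1.1, fun i => (t i).1.2), fun i => (t i).2⟩
  invFun AB i := ⟨(AB.1.1 i, AB.1.2 i), AB.2 i⟩
  left_inv _ := rfl
  right_inv _ := rfl

theorem integrableOn_sincChain {α : ℝ} (hα : 0 < α) {k : ℕ} (t : Fin (k + 1) → Pair) :
    IntegrableOn (sincChain α t) (tupleDomain t) := by
  refine ⟨(measurable_sincChain α t).aestronglyMeasurable, ?_⟩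
  exact (ENNReal.le_tsum t).trans_lt (tsum_lintegral_enorm_sincChain_lt_top hα k)

theorem summable_integral_abs_sincChain {α : ℝ} (hα : 0 < α) (k : ℕ) :
    Summable fun t : Fin (k + 1) → Pair => ∫ p in tupleDomain t, |sincChain α t p| := by
  have h1 := ENNReal.summable_toReal (tsum_lintegral_enorm_sincChain_lt_top hα k).ne
  refine h1.congr fun t => ?_
  rw [← integral_norm_eq_lintegral_enorm (integrableOn_sincChain hα t).1]
  rfl

theorem absConvergent {α : ℝ} (hα : 0 < α) (k : ℕ) : AbsConvergent k α := by
  have h1 : ∀ t : Fin (k + 1) → Pair,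
      integrand α (indexEquiv (k + 1) t).1.1 (indexEquiv (k + 1) t).1.2 = sincChain α t :=
    fun t => funext fun p => (sincChain_eq_integrand α t p).symm
  refine ⟨fun AB => ?_, ?_⟩
  · obtain ⟨t, rfl⟩ := (indexEquiv (k + 1)).surjective AB
    rw [h1]
    exact integrableOn_sincChain hα t
  · rw [← (indexEquiv (k + 1)).summable_iff]
    refine (summable_integral_abs_sincChain hα k).congr fun t => ?_
    simp only [Function.comp, h1]
    rfl

theorem M_add_two (α : ℝ) (k : ℕ) : M (k + 2) α = 6 / (Real.pi ^ 2 * α) *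
    ∑' t : Fin (k + 1) → Pair, ∫ p in tupleDomain t, sincChain α t p := by
  have h1 : ∀ t : Fin (k + 1) → Pair,
      integrand α (indexEquiv (k + 1) t).1.1 (indexEquiv (k + 1) t).1.2 = sincChain α t :=
    fun t => funext fun p => (sincChain_eq_integrand α t p).symm
  rw [M, ← (indexEquiv (k + 1)).tsum_eq]
  congr 1
  refine tsum_congr fun t => ?_
  rw [h1]
  rfl

/-! ### Convergence of the moments -/

/-- The tail condition is required for every finite set containing `S`, so that `S` can be enlarged
to one which also captures most of the limiting sum. -/
theorem tendsto_tsum_of_uniform_tail {ι : Type*} {F : ℕ → ι → ℂ} {a : ι → ℂ} (ha : Summable a)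
    (hlim : ∀ t, Tendsto (fun Q => F Q t) atTop (𝓝 (a t)))
    (htail : ∀ ε > 0, ∃ S : Finset ι, ∀ᶠ Q in atTop, ∀ S' : Finset ι, S ⊆ S' →
      ‖∑' t, F Q t - ∑ t ∈ S', F Q t‖ ≤ ε) :
    Tendsto (fun Q => ∑' t, F Q t) atTop (𝓝 (∑' t, a t)) := by
  classical
  rw [Metric.tendsto_atTop']
  intro ε hε
  obtain ⟨S, hS⟩ := htail (ε / 3) (by positivity)
  obtain ⟨S₁, hS₁⟩ := (Metric.tendsto_atTop.1 ha.hasSum) (ε / 3) (by positivity)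
  have h1 := hS₁ (S ∪ S₁) (Finset.subset_union_right)
  have h2 : Tendsto (fun Q => ∑ t ∈ S ∪ S₁, F Q t) atTop (𝓝 (∑ t ∈ S ∪ S₁, a t)) :=
    tendsto_finsetSum _ fun t _ => hlim t
  have h3 := (Metric.tendsto_nhds.1 h2) (ε / 3) (by positivity)
  obtain ⟨Q₀, hQ₀⟩ := eventually_atTop.1 (hS.and h3)
  refine ⟨Q₀, fun Q hQ => ?_⟩
  obtain ⟨h4, h5⟩ := hQ₀ Q hQ.le
  have h6 := h4 (S ∪ S₁) Finset.subset_union_left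
  rw [← dist_eq_norm] at h6
  have h7 := dist_triangle4 (∑' t, F Q t) (∑ t ∈ S ∪ S₁, F Q t) (∑ t ∈ S ∪ S₁, a t) (∑' t, a t)
  linarith

theorem norm_tsum_sub_sum_le {ι : Type*} {F : ι → ℂ} (hF : ∑' t, ‖F t‖ₑ < ∞) {P : Set ι}
    {S : Finset ι} (hPS : ∀ t ∉ S, t ∈ P) {ε : ℝ} (hε : 0 ≤ ε)
    (hP : ∑' t : P, ‖F t‖ₑ ≤ ENNReal.ofReal ε) : ‖∑' t, F t - ∑ t ∈ S, F t‖ ≤ ε := by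
  have hs : Summable F := by
    refine Summable.of_norm ?_
    refine (ENNReal.summable_toReal hF.ne).congr fun t => ?_
    simp
  rw [← hs.sum_add_tsum_compl (s := S), add_sub_cancel_left, ← ENNReal.ofReal_le_ofReal_iff hε,
    ofReal_norm]
  refine enorm_tsum_le_tsum_enorm.trans (le_trans ?_ hP)
  exact ENNReal.tsum_mono_subtype (fun t => ‖F t‖ₑ) fun t ht => hPS t (by simpa using ht)

theorem card_trianglePoints_le (Q : ℕ) : (trianglePoints Q).card ≤ Q ^ 2 := by
  refine (Finset.card_filter_le _ _).trans ((Finset.card_filter_le _ _).trans ?_)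
  simp [sq]

/-- The average over the triangle of the tuple terms. -/
def tupleAverage (Q N : ℕ) {n : ℕ} (t : Fin n → Pair) : ℂ :=
  (N : ℂ)⁻¹ * ∑ v ∈ trianglePoints Q, tupleTerm Q N t (scaledPoint Q v)

theorem tsum_enorm_tupleAverage_le {Q N : ℕ} (hN : 0 < N) {n : ℕ}
    (P : Set (Fin n → Pair)) (c : ℝ≥0∞)
    (hc : ∀ v ∈ trianglePoints Q, ∑' t : P, ‖tupleTerm Q N (t : Fin n → Pair) (scaledPoint Q v)‖ₑ
      ≤ c) :
    ∑' t : P, ‖tupleAverage Q N (t : Fin n → Pair)‖ₑ ≤ ENNReal.ofReal ((Q : ℝ) ^ 2 / N) * c := by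
  have hN' : (0 : ℝ) < N := by exact_mod_cast hN
  have h0 : ‖(N : ℂ)⁻¹‖ₑ = ENNReal.ofReal ((N : ℝ)⁻¹) := by
    rw [← ofReal_norm, norm_inv, Complex.norm_natCast]
  calc ∑' t : P, ‖tupleAverage Q N (t : Fin n → Pair)‖ₑ
      ≤ ∑' t : P, ENNReal.ofReal ((N : ℝ)⁻¹) * ∑ v ∈ trianglePoints Q,
          ‖tupleTerm Q N (t : Fin n → Pair) (scaledPoint Q v)‖ₑ := by
        refine ENNReal.tsum_le_tsum fun t => ?_
        rw [tupleAverage, enorm_mul, h0]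
        gcongr
        exact enorm_sum_le _ _
    _ = ENNReal.ofReal ((N : ℝ)⁻¹) * ∑ v ∈ trianglePoints Q, ∑' t : P,
          ‖tupleTerm Q N (t : Fin n → Pair) (scaledPoint Q v)‖ₑ := by
        rw [ENNReal.tsum_mul_left, Summable.tsum_finsetSum fun _ _ => ENNReal.summable]
    _ ≤ ENNReal.ofReal ((N : ℝ)⁻¹) * ((Q : ℝ≥0∞) ^ 2 * c) := by
        gcongr
        refine (Finset.sum_le_sum hc).trans ?_
        rw [Finset.sum_const, nsmul_eq_mul]
        gcongr
        exact_mod_cast card_trianglePoints_le Q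
    _ = ENNReal.ofReal ((Q : ℝ) ^ 2 / N) * c := by
        rw [← mul_assoc, div_eq_inv_mul, ENNReal.ofReal_mul (by positivity),
          ENNReal.ofReal_pow (by positivity), ENNReal.ofReal_natCast]

theorem eventually_good {N : ℕ → ℕ} {α : ℝ} (hα : 0 < α)
    (hN : Tendsto (fun Q : ℕ => (N Q : ℝ) / (Q : ℝ) ^ 2) atTop (𝓝 α)) :
    ∀ᶠ Q : ℕ in atTop, 0 < Q ∧ 0 < N Q ∧ 1 + (Q : ℝ) ^ 2 / (2 * N Q) ≤ 1 + 1 / α := by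
  filter_upwards [hN.eventually (lt_mem_nhds (show α / 2 < α by linarith)),
    eventually_gt_atTop 0] with Q hQ hQ0
  have hQ2 : (0 : ℝ) < (Q : ℝ) ^ 2 := by positivity
  rw [lt_div_iff₀ hQ2] at hQ
  have hNQ : (0 : ℝ) < N Q := lt_trans (by positivity) hQ
  refine ⟨hQ0, by exact_mod_cast hNQ, ?_⟩
  have : (Q : ℝ) ^ 2 / (2 * N Q) ≤ 1 / α := by
    rw [div_le_div_iff₀ (by positivity) hα]
    linarith
  linarith

/-- Termwise convergence is combined with the uniform smallness of the tuples that leave a finite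
set of bounded pairs. -/
theorem tendsto_tsum_tupleAverage {N : ℕ → ℕ} {α : ℝ} (hα : 0 < α)
    (hN : Tendsto (fun Q : ℕ => (N Q : ℝ) / (Q : ℝ) ^ 2) atTop (𝓝 α)) (k : ℕ) :
    Tendsto (fun Q => ∑' t : Fin (k + 1) → Pair, tupleAverage Q (N Q) t) atTop
      (𝓝 (M (k + 2) α : ℂ)) := by
  set B : ℝ := 1 + 1 / α with hBdef
  have hB0 : 0 ≤ B := by positivity
  have hgood := eventually_good hα hN
  have hlimsum : (M (k + 2) α : ℂ) = ∑' t : Fin (k + 1) → Pair,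
      6 / ((Real.pi : ℂ) ^ 2 * α) * ∫ p in tupleDomain t, (sincChain α t p : ℂ) := by
    rw [M_add_two, tsum_mul_left]
    push_cast
    congr 1
    refine tsum_congr fun t => ?_
    exact integral_ofReal.symm
  have hsum : Summable fun t : Fin (k + 1) → Pair =>
      6 / ((Real.pi : ℂ) ^ 2 * α) * ∫ p in tupleDomain t, (sincChain α t p : ℂ) := by
    refine Summable.mul_left _ (Summable.of_norm_bounded (summable_integral_abs_sincChain hα k)
      fun t => ?_)
    refine (norm_integral_le_integral_norm _).trans (le_of_eq ?_)
    simp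
  rw [hlimsum]
  refine tendsto_tsum_of_uniform_tail hsum (fun t => tendsto_average_tupleTerm hα hN t) ?_
  intro ε hε
  set K : ℝ≥0∞ := ENNReal.ofReal (2 / α) * tupleConst B k with hK
  have hKtop : K < ∞ := ENNReal.mul_lt_top ENNReal.ofReal_lt_top (tupleConst_lt_top hB0 k)
  have hexp : 0 < 1 / (2 * (k : ℝ) + 4) := by positivity
  obtain ⟨η, hη, hηε⟩ : ∃ η : ℝ, 0 < η ∧
      ENNReal.ofReal η ^ (1 / (2 * (k : ℝ) + 4)) * K ≤ ENNReal.ofReal ε := by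
    -- Taking `η = δ ^ (2 k + 4)` undoes the exponent `1 / (2 k + 4)`; the `+ 1` in `δ` keeps the
    -- denominator positive when `K` vanishes.
    set δ : ℝ := ε / (K.toReal + 1) with hδ
    have hK1 : 0 < K.toReal + 1 := by positivity
    have hδ0 : 0 < δ := by positivity
    refine ⟨δ ^ (2 * (k : ℝ) + 4), by positivity, ?_⟩
    rw [ENNReal.ofReal_rpow_of_nonneg (by positivity) hexp.le, ← Real.rpow_mul hδ0.le,
      mul_one_div_cancel (by positivity), Real.rpow_one, ← ENNReal.ofReal_toReal hKtop.ne,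
      ← ENNReal.ofReal_mul hδ0.le]
    refine ENNReal.ofReal_le_ofReal ?_
    rw [hδ, div_mul_eq_mul_div, div_le_iff₀ hK1]
    nlinarith
  set R : ℝ := (k + 2) * (B / η) with hR
  classical
  refine ⟨Fintype.piFinset fun _ => (finite_boundedPairs R).toFinset, ?_⟩
  filter_upwards [hgood] with Q hQ S' hS'
  obtain ⟨hQ0, hNQ, hBQ⟩ := hQ
  have hQN : (Q : ℝ) ^ 2 / N Q ≤ 2 / α := by
    have h1 : (Q : ℝ) ^ 2 / (2 * N Q) = (Q : ℝ) ^ 2 / N Q / 2 := by ring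
    have h2 : 2 / α = 2 * (1 / α) := by ring
    linarith
  refine norm_tsum_sub_sum_le (P := {t | ∃ i, t i ∉ boundedPairs R}) ?_ ?_ hε.le ?_
  · have h1 := tsum_enorm_tupleAverage_le (Q := Q) hNQ (Set.univ : Set (Fin (k + 1) → Pair))
      (tupleConst B k) (fun v hv => by
        have hm := scaledPoint_mem hv
        rw [tsum_univ (fun t : Fin (k + 1) → Pair => ‖tupleTerm Q (N Q) t (scaledPoint Q v)‖ₑ)]
        exact tsum_enorm_tupleTerm_le_tupleConst hQ0 hNQ hBQ hm.2.2.1 hm.2.2.2)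
    rw [tsum_univ (fun t : Fin (k + 1) → Pair => ‖tupleAverage Q (N Q) t‖ₑ)] at h1
    exact h1.trans_lt (ENNReal.mul_lt_top ENNReal.ofReal_lt_top (tupleConst_lt_top hB0 k))
  · intro t ht
    by_contra hcon
    simp only [Set.mem_ofPred_eq, not_exists, not_not] at hcon
    refine ht (hS' ?_)
    rw [Fintype.mem_piFinset]
    intro i
    simpa using hcon i
  · refine (tsum_enorm_tupleAverage_le hNQ _ (ENNReal.ofReal η ^ (1 / (2 * (k : ℝ) + 4)) *
      tupleConst B k) fun v hv => ?_).trans (le_trans ?_ hηε)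
    · have hm := scaledPoint_mem hv
      exact tsum_enorm_tupleTerm_tail_le hQ0 hNQ hη hBQ hm.1 hm.2.1 hm.2.2.1 hm.2.2.2
    · rw [mul_left_comm, hK]
      gcongr

theorem average_sieveEigenvalue_pow_eq {Q N : ℕ} (hQ : 0 < Q) (hN : 0 < N) (k : ℕ) :
    (((N : ℝ)⁻¹ * ∑ i, (sieveEigenvalue Q N i / N) ^ (k + 2) : ℝ) : ℂ) =
      ∑' t : Fin (k + 1) → Pair, tupleAverage Q N t := by
  push_cast
  have h1 := sum_sieveEigenvalue_pow_eq Q N (k + 1)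
  push_cast at h1
  rw [h1]
  simp only [tupleAverage]
  rw [tsum_mul_left, Summable.tsum_finsetSum]
  intro v hv
  have hm := scaledPoint_mem hv
  refine Summable.of_norm ?_
  have h2 := tsum_enorm_tupleTerm_le_tupleConst (k := k) hQ hN le_rfl hm.2.2.1 hm.2.2.2
  refine (ENNReal.summable_toReal (h2.trans_lt (tupleConst_lt_top (by positivity) k)).ne).congr
    fun t => ?_
  simp

theorem sincChain_of_isEmpty (α : ℝ) (t : Fin 0 → Pair) (p : ℝ × ℝ) : sincChain α t p = 1 := by
  rw [sincChain, chain_zero]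
  simp

theorem volume_triangle (t : Fin 0 → Pair) :
    (volume : Measure (ℝ × ℝ)).real (tupleDomain t) = 1 / 2 := by
  -- The fibre over `x` has length `1 - x` on `[0, 1]`. The point `0` gets a separate null term
  -- because the main indicator lives on the half-open interval.
  have hfib : ∀ x : ℝ, (volume : Measure ℝ) (Prod.mk x ⁻¹' tupleDomain t) =
      (Set.Ioc (0 : ℝ) 1).indicator (fun x => ENNReal.ofReal (1 - x)) x +
        ({0} : Set ℝ).indicator (fun _ => 1) x := by
    intro x
    have h1 : Prod.mk x ⁻¹' tupleDomain t = if 0 ≤ x then Set.Icc x 1 else ∅ := by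
      ext y
      simp only [Set.mem_preimage, mem_tupleDomain, IsEmpty.forall_iff, and_true]
      split_ifs with h <;> simp [h]
    rw [h1]
    rcases lt_trichotomy x 0 with h | h | h
    · simp [h.not_ge, h.not_gt, h.ne]
    · subst h; simp
    · rw [if_pos h.le, Real.volume_Icc]
      by_cases h1 : x ≤ 1
      · simp [h, h1, h.ne']
      · have h2 : 1 - x ≤ 0 := by linarith
        simp [h1, h.ne', ENNReal.ofReal_of_nonpos h2]
  rw [measureReal_def, Measure.volume_eq_prod, Measure.prod_apply (measurableSet_tupleDomain t)]
  simp_rw [hfib]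
  rw [lintegral_add_right _ (measurable_const.indicator (measurableSet_singleton 0)),
    lintegral_indicator measurableSet_Ioc, lintegral_indicator (measurableSet_singleton 0)]
  rw [← ofReal_integral_eq_lintegral_ofReal]
  · have h2 : ∫ x in Set.Ioc (0 : ℝ) 1, (1 - x) = 1 / 2 := by
      rw [← intervalIntegral.integral_of_le zero_le_one,
        intervalIntegral.integral_sub (by simp) (by simp)]
      norm_num
    rw [h2]
    simp
  · exact (continuous_const.sub continuous_id).integrableOn_Ioc
  · filter_upwards [ae_restrict_mem measurableSet_Ioc] with x hx
    exact sub_nonneg.2 hx.2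

/-- The moments of the scaled eigenvalues converge. -/
theorem tendsto_average_sieveEigenvalue_pow {N : ℕ → ℕ} {α : ℝ} (hα : 0 < α)
    (hN : Tendsto (fun Q : ℕ => (N Q : ℝ) / (Q : ℝ) ^ 2) atTop (𝓝 α)) (ℓ : ℕ) :
    Tendsto (fun Q => (N Q : ℝ)⁻¹ * ∑ i, (sieveEigenvalue Q (N Q) i / N Q) ^ ℓ) atTop
      (𝓝 (M ℓ α)) := by
  have hgood := eventually_good hα hN
  have hre : ∀ {f : ℕ → ℝ} {a : ℝ}, Tendsto (fun Q => (f Q : ℂ)) atTop (𝓝 (a : ℂ)) →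
      Tendsto f atTop (𝓝 a) := fun h => by
    exact (Complex.continuous_re.tendsto _).comp h
  match ℓ with
  | 0 =>
    refine tendsto_const_nhds.congr' ?_
    filter_upwards [hgood] with Q hQ
    have : (N Q : ℝ) ≠ 0 := by exact_mod_cast hQ.2.1.ne'
    simp [M, this]
  | 1 =>
    refine hre ?_
    have h1 := tendsto_average_tupleTerm hα hN (fun i : Fin 0 => i.elim0)
    simp only [sincChain_of_isEmpty] at h1
    rw [show 6 / ((Real.pi : ℂ) ^ 2 * α) * ∫ p in tupleDomain (fun i : Fin 0 => i.elim0),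
      ((1 : ℝ) : ℂ) = (M 1 α : ℂ) by
        rw [setIntegral_const, volume_triangle, M]
        push_cast
        rw [Complex.real_smul]
        push_cast
        ring] at h1
    refine h1.congr fun Q => ?_
    have h2 := sum_sieveEigenvalue_pow_eq Q (N Q) 0
    push_cast at h2 ⊢
    rw [h2]
    congr 1
    refine Finset.sum_congr rfl fun v _ => ?_
    rw [tsum_fintype, Fintype.sum_unique]
    congr 1
  | k + 2 =>
    refine hre ((tendsto_tsum_tupleAverage hα hN k).congr' ?_)
    filter_upwards [hgood] with Q hQ
    exact (average_sieveEigenvalue_pow_eq hQ.1 hQ.2.1 k).symm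

/-! ### A large sieve inequality -/

theorem exists_fareyOf_eq {Q : ℕ} {r : ℚ} (hr : r ∈ farey Q) :
    ∃ v ∈ trianglePoints Q, fareyOf v = r := by
  by_contra! h
  have h1 := sum_farey Q fun s => if s = r then 1 else 0
  rw [Finset.sum_ite_eq' (farey Q) r, if_pos hr, Finset.sum_eq_zero fun v hv => if_neg (h v hv)]
    at h1
  exact one_ne_zero h1

/-- This is a sum over the window seen from `r`, with exponent `2 > 1`, so the separation estimate
applies directly. -/
theorem sum_norm_kernel_sq_le {Q N : ℕ} (hQ : 0 < Q) (hN : 0 < N) {B : ℝ}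
    (hB : 1 + (Q : ℝ) ^ 2 / (2 * N) ≤ B) (r : farey Q) :
    ∑ s : farey Q, ‖kernel N ((r : ℚ) - (s : ℚ) : ℝ)‖ ^ 2 ≤ (3 * sepConst B 2).toReal := by
  have hB0 : 0 ≤ B := le_trans (by positivity) hB
  obtain ⟨v, hv, hvr⟩ := exists_fareyOf_eq r.2
  obtain ⟨φ, hφ⟩ := exists_window_equiv hv
  have hm := scaledPoint_mem hv
  have h1 := (tsum_kernel_rpow_le hQ hN hB hm.2.2.1 (zero_le_two (α := ℝ))
    ⟨basePair, basePair_mem_window hm.2.2.1 hm.2.2.2⟩).1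
  have htop : 3 * sepConst B 2 ≠ ⊤ :=
    (ENNReal.mul_lt_top (by simp) (sepConst_lt_top hB0 one_lt_two)).ne
  rw [← ENNReal.ofReal_le_iff_le_toReal htop, ENNReal.ofReal_sum_of_nonneg fun _ _ => by positivity]
  refine le_trans (le_of_eq ?_) h1
  rw [← tsum_fintype (L := SummationFilter.unconditional _), ← φ.tsum_eq]
  refine tsum_congr fun j => ?_
  obtain ⟨n, hn⟩ := hφ j
  have h2 : kernel N ((r : ℚ) - (φ j : ℚ) : ℝ) =
      kernel N ((offset (scaledPoint Q v) basePair - offset (scaledPoint Q v) j) / (Q : ℝ) ^ 2) := by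
    rw [hn, hvr, ← kernel_add_int N _ n, offset_basePair]
    congr 1; ring
  rw [h2, ENNReal.ofReal_pow (norm_nonneg _), ofReal_norm, ENNReal.rpow_two]

theorem sum_sum_e_eq_norm_sq (N : ℕ) (t : ℝ) :
    ∑ a ∈ Finset.range N, ∑ b ∈ Finset.range N, e (((a : ℝ) - b) * t) =
      ((‖dirichletKernel N t‖ ^ 2 : ℝ) : ℂ) := by
  have h1 : ((‖dirichletKernel N t‖ ^ 2 : ℝ) : ℂ) =
      dirichletKernel N t * star (dirichletKernel N t) := by
    rw [Complex.star_def, Complex.mul_conj, Complex.normSq_eq_norm_sq]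
  rw [h1, dirichletKernel, star_sum, Finset.sum_mul_sum]
  refine Finset.sum_congr rfl fun a _ => Finset.sum_congr rfl fun b _ => ?_
  rw [star_e, ← e_add]
  congr 1; ring

/-- The exponential sum with frequencies the Farey fractions. -/
def fareySum {Q : ℕ} (c : farey Q → ℂ) (x : ℝ) : ℂ := ∑ r, c r * e (-(x * (r : ℚ)))

/-- Averaging over differences `a - b` produces a Fejér weight: the square of the exponential sum
opens into a quadratic form with nonnegative kernel `|D_N|²`, whose row sums are controlled, in
place of `D_N` itself. -/
theorem sum_sum_norm_fareySum_sq {Q : ℕ} (N : ℕ) (c : farey Q → ℂ) :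
    ((∑ a ∈ Finset.range N, ∑ b ∈ Finset.range N, ‖fareySum c ((a : ℝ) - b)‖ ^ 2 : ℝ) : ℂ) =
      ∑ r, ∑ s, c r * star (c s) * ((‖dirichletKernel N ((s : ℚ) - (r : ℚ) : ℝ)‖ ^ 2 : ℝ) : ℂ) := by
  have h1 : ∀ x : ℝ, ((‖fareySum c x‖ ^ 2 : ℝ) : ℂ) =
      ∑ r, ∑ s, c r * star (c s) * e (x * ((s : ℚ) - (r : ℚ) : ℝ)) := by
    intro x
    have h2 : ((‖fareySum c x‖ ^ 2 : ℝ) : ℂ) = fareySum c x * star (fareySum c x) := by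
      rw [Complex.star_def, Complex.mul_conj, Complex.normSq_eq_norm_sq]
    rw [h2, fareySum, star_sum, Finset.sum_mul_sum]
    refine Finset.sum_congr rfl fun r _ => Finset.sum_congr rfl fun s _ => ?_
    rw [star_mul', star_e, mul_mul_mul_comm, ← e_add]
    congr 2; ring
  rw [Complex.ofReal_sum]
  simp_rw [Complex.ofReal_sum, h1, ← sum_sum_e_eq_norm_sq, Finset.mul_sum]
  rw [Finset.sum_congr rfl fun a _ => Finset.sum_comm, Finset.sum_comm]
  refine Finset.sum_congr rfl fun r _ => ?_
  rw [Finset.sum_congr rfl fun a _ => Finset.sum_comm, Finset.sum_comm]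

/-- The sum over `1 ≤ n ≤ N` is dominated by a Fejér-weighted sum of twice the length, and the
resulting form is bounded by Schur's test. The constant comes from `(2 N) ^ 2 / N = 4 N`. -/
theorem sum_norm_fareySum_sq_le {Q N : ℕ} (hQ : 0 < Q) (hN : 0 < N) {B : ℝ}
    (hB : 1 + (Q : ℝ) ^ 2 / (2 * N) ≤ B) (c : farey Q → ℂ) :
    ∑ n ∈ Finset.range N, ‖fareySum c ((n : ℝ) + 1)‖ ^ 2 ≤
      4 * N * (3 * sepConst B 2).toReal * ∑ r, ‖c r‖ ^ 2 := by
  have hN' : (0 : ℝ) < N := by exact_mod_cast hN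
  set C := (3 * sepConst B 2).toReal with hC
  have hC0 : 0 ≤ C := ENNReal.toReal_nonneg
  obtain ⟨K, hK⟩ : ∃ K : ℕ, K = 2 * N := ⟨_, rfl⟩
  have hK0 : 0 < K := by omega
  have hKr : (K : ℝ) = 2 * N := by rw [hK]; push_cast; ring
  have hB2 : 1 + (Q : ℝ) ^ 2 / (2 * K) ≤ B := by
    refine le_trans ?_ hB
    rw [hKr]
    gcongr
    linarith
  -- Each of `1, …, N` is a difference of at least `N` pairs from `{0, …, 2 N - 1}`.
  have hlow : (N : ℝ) * ∑ n ∈ Finset.range N, ‖fareySum c ((n : ℝ) + 1)‖ ^ 2 ≤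
      ∑ a ∈ Finset.range K, ∑ b ∈ Finset.range K, ‖fareySum c ((a : ℝ) - b)‖ ^ 2 := by
    rw [← Finset.sum_product']
    calc (N : ℝ) * ∑ n ∈ Finset.range N, ‖fareySum c ((n : ℝ) + 1)‖ ^ 2
        = ∑ q ∈ Finset.range N ×ˢ Finset.range N, ‖fareySum c ((q.1 : ℝ) + 1)‖ ^ 2 := by
          rw [Finset.sum_product]
          simp [Finset.mul_sum]
      _ = ∑ q ∈ (Finset.range N ×ˢ Finset.range N).image
            (fun q : ℕ × ℕ => (q.1 + 1 + q.2, q.2)), ‖fareySum c ((q.1 : ℝ) - q.2)‖ ^ 2 := by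
          rw [Finset.sum_image]
          · refine Finset.sum_congr rfl fun q _ => ?_
            congr 3; push_cast; ring
          · rintro ⟨a, b⟩ _ ⟨a', b'⟩ _ h
            simp only [Prod.mk.injEq] at h ⊢
            omega
      _ ≤ _ := by
          refine Finset.sum_le_sum_of_subset_of_nonneg ?_ fun _ _ _ => by positivity
          intro q hq
          simp only [Finset.mem_image, Finset.mem_product, Finset.mem_range, Prod.exists] at hq ⊢
          obtain ⟨a, b, ⟨h1, h2⟩, rfl⟩ := hq
          dsimp only
          omega
  have hup : ∑ a ∈ Finset.range K, ∑ b ∈ Finset.range K,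
      ‖fareySum c ((a : ℝ) - b)‖ ^ 2 ≤ (K : ℝ) ^ 2 * C * ∑ r, ‖c r‖ ^ 2 := by
    have h0 : 0 ≤ ∑ a ∈ Finset.range K, ∑ b ∈ Finset.range K, ‖fareySum c ((a : ℝ) - b)‖ ^ 2 :=
      Finset.sum_nonneg fun _ _ => Finset.sum_nonneg fun _ _ => sq_nonneg _
    have h1 := congrArg norm (sum_sum_norm_fareySum_sq K c)
    rw [Complex.norm_real, Real.norm_of_nonneg h0] at h1
    rw [h1]
    set D : farey Q → farey Q → ℝ := fun r s => ‖dirichletKernel K ((s : ℚ) - (r : ℚ) : ℝ)‖ ^ 2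
      with hD
    have hrow : ∀ s, ∑ r, D r s ≤ (K : ℝ) ^ 2 * C := by
      intro s
      have h2 := sum_norm_kernel_sq_le hQ hK0 hB2 s
      have h3 : ∀ r, D r s = (K : ℝ) ^ 2 * ‖kernel K ((s : ℚ) - (r : ℚ) : ℝ)‖ ^ 2 := by
        intro r
        simp only [hD, kernel]
        have hK1 : (K : ℝ) ≠ 0 := by exact_mod_cast hK0.ne'
        rw [norm_div, Complex.norm_natCast, div_pow]
        field_simp
      rw [Finset.sum_congr rfl fun r _ => h3 r, ← Finset.mul_sum]
      gcongr
    have hsymm : ∀ r s, D r s = D s r := by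
      intro r s
      simp only [hD]
      congr 1
      rw [← norm_star, dirichletKernel, dirichletKernel, star_sum]
      congr 1
      refine Finset.sum_congr rfl fun j _ => ?_
      rw [star_e]; congr 1; ring
    -- Schur's test: `2 |c r| |c s| ≤ |c r| ^ 2 + |c s| ^ 2`, followed by symmetry of the kernel and
    -- the row sum bound.
    calc _ ≤ ∑ r, ∑ s, ‖c r‖ * ‖c s‖ * D r s := by
          refine norm_sum_le_of_le _ fun r _ => norm_sum_le_of_le _ fun s _ => ?_
          rw [norm_mul, norm_mul, norm_star, Complex.norm_real, Real.norm_of_nonneg (sq_nonneg _)]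
      _ ≤ ∑ r, ∑ s, (‖c r‖ ^ 2 * D r s / 2 + ‖c s‖ ^ 2 * D r s / 2) := by
          refine Finset.sum_le_sum fun r _ => Finset.sum_le_sum fun s _ => ?_
          have hD0 : 0 ≤ D r s := sq_nonneg _
          nlinarith [mul_nonneg (sq_nonneg (‖c r‖ - ‖c s‖)) hD0]
      _ = ∑ r, ‖c r‖ ^ 2 * ∑ s, D s r := by
          simp_rw [Finset.sum_add_distrib]
          rw [Finset.sum_comm (f := fun r s => ‖c s‖ ^ 2 * D r s / 2), ← Finset.sum_add_distrib]
          refine Finset.sum_congr rfl fun r _ => ?_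
          rw [← Finset.sum_add_distrib, Finset.mul_sum]
          refine Finset.sum_congr rfl fun s _ => ?_
          rw [hsymm r s]; ring
      _ ≤ ∑ r, ‖c r‖ ^ 2 * ((K : ℝ) ^ 2 * C) := by
          gcongr with r
          exact hrow r
      _ = _ := by rw [← Finset.sum_mul]; ring
  have h3 := hlow.trans hup
  refine le_of_mul_le_mul_left (h3.trans (le_of_eq ?_)) hN'
  rw [hKr]; ring

theorem sum_norm_sq_eq_dotProduct {n : Type*} [Fintype n] (w : n → ℂ) :
    ((∑ i, ‖w i‖ ^ 2 : ℝ) : ℂ) = star w ⬝ᵥ w := by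
  rw [dotProduct]
  push_cast
  refine Finset.sum_congr rfl fun i _ => ?_
  rw [Pi.star_apply, Complex.star_def, mul_comm, Complex.mul_conj, Complex.normSq_eq_norm_sq]
  push_cast
  rfl

open scoped ComplexOrder in
theorem sieveEigenvalue_nonneg (Q N : ℕ) (i : Fin N) : 0 ≤ sieveEigenvalue Q N i :=
  (Matrix.posSemidef_conjTranspose_mul_self (sieveMatrix Q N)).eigenvalues_nonneg i

/-- The large sieve inequality with an unspecified constant. -/
theorem sieveEigenvalue_le {Q N : ℕ} (hQ : 0 < Q) (hN : 0 < N) {B : ℝ}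
    (hB : 1 + (Q : ℝ) ^ 2 / (2 * N) ≤ B) (i : Fin N) :
    sieveEigenvalue Q N i ≤ 4 * N * (3 * sepConst B 2).toReal := by
  set A := sieveMatrix Q N with hA
  set hH := Matrix.isHermitian_conjTranspose_mul_self A
  set lam : ℝ := sieveEigenvalue Q N i with hlam
  set w : Fin N → ℂ := ⇑(hH.eigenvectorBasis i) with hw
  have hw1 : (Aᴴ * A) *ᵥ w = lam • w := hH.mulVec_eigenvectorBasis i
  -- For an eigenvector `w` with eigenvalue `λ`, the vector `c = A w` satisfies `‖c‖² = λ ‖w‖²` and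
  -- `‖A⋆ c‖² = λ² ‖w‖²`; the bound for `A⋆` therefore bounds `λ` itself.
  set c : farey Q → ℂ := A *ᵥ w with hc
  have hc1 : Aᴴ *ᵥ c = lam • w := by rw [hc, Matrix.mulVec_mulVec, hw1]
  set W : ℝ := ∑ j, ‖w j‖ ^ 2 with hW
  have hWpos : 0 < W := by
    have h1 : W = ‖hH.eigenvectorBasis i‖ ^ 2 := by
      rw [EuclideanSpace.norm_sq_eq]
    rw [h1, hH.eigenvectorBasis.orthonormal.1 i]
    norm_num
  have hcsum : ∑ r, ‖c r‖ ^ 2 = lam * W := by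
    have h1 : ((∑ r, ‖c r‖ ^ 2 : ℝ) : ℂ) = ((lam * W : ℝ) : ℂ) := by
      rw [sum_norm_sq_eq_dotProduct, Complex.ofReal_mul, hW, sum_norm_sq_eq_dotProduct]
      conv_lhs => rw [hc, Matrix.star_mulVec, ← Matrix.dotProduct_mulVec, Matrix.mulVec_mulVec, hw1]
      rw [dotProduct_smul, Complex.real_smul]
    exact_mod_cast h1
  have hfar : ∀ j : Fin N, ‖fareySum c ((j : ℕ) + 1 : ℝ)‖ = lam * ‖w j‖ := by
    intro j
    have h1 : fareySum c ((j : ℕ) + 1 : ℝ) = (Aᴴ *ᵥ c) j := by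
      rw [fareySum, Matrix.mulVec, dotProduct]
      refine Finset.sum_congr rfl fun r _ => ?_
      rw [Matrix.conjTranspose_apply, hA, sieveMatrix, Matrix.of_apply, star_e, mul_comm]
    rw [h1, hc1, Pi.smul_apply, norm_smul, Real.norm_of_nonneg (sieveEigenvalue_nonneg Q N i)]
  have hmain := sum_norm_fareySum_sq_le hQ hN hB c
  rw [← Fin.sum_univ_eq_sum_range (fun n => ‖fareySum c ((n : ℝ) + 1)‖ ^ 2),
    Finset.sum_congr rfl fun j _ => by rw [hfar j, mul_pow], ← Finset.mul_sum, hcsum] at hmain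
  have h0 := sieveEigenvalue_nonneg Q N i
  rcases h0.eq_or_lt with h | h
  · rw [hlam, ← h]; positivity
  · have h2 : lam * W * lam ≤ lam * W * (4 * N * (3 * sepConst B 2).toReal) := by
      calc lam * W * lam = lam ^ 2 * W := by ring
        _ ≤ _ := hmain
        _ = _ := by ring
    exact le_of_mul_le_mul_left h2 (mul_pos h hWpos)

/-! ### The moment problem on a compact interval -/

theorem integrable_of_ae_mem_Icc {μ : Measure ℝ} [IsFiniteMeasure μ] {a b : ℝ}
    (hμ : ∀ᵐ x ∂μ, x ∈ Set.Icc a b) {f : ℝ → ℝ} (hf : Continuous f) : Integrable f μ := by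
  obtain ⟨C, hC⟩ := isCompact_Icc.exists_bound_of_continuousOn (hf.continuousOn (s := Set.Icc a b))
  refine Integrable.of_bound hf.aestronglyMeasurable C ?_
  filter_upwards [hμ] with x hx using hC x hx

theorem integral_polynomial {μ : Measure ℝ} [IsFiniteMeasure μ] {a b : ℝ}
    (hμ : ∀ᵐ x ∂μ, x ∈ Set.Icc a b) (p : Polynomial ℝ) :
    ∫ x, p.eval x ∂μ = ∑ i ∈ Finset.range (p.natDegree + 1), p.coeff i * ∫ x, x ^ i ∂μ := by
  simp_rw [Polynomial.eval_eq_sum_range]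
  rw [integral_finsetSum]
  · simp_rw [integral_const_mul]
  · intro i _
    exact (integrable_of_ae_mem_Icc hμ (continuous_pow i)).const_mul _

/-- Convergence of moments of measures on a fixed interval implies weak convergence. -/
theorem tendsto_integral_of_tendsto_moments {μs : ℕ → Measure ℝ} {μ : Measure ℝ} {a b : ℝ}
    [IsProbabilityMeasure μ] (hprob : ∀ᶠ Q in atTop, IsProbabilityMeasure (μs Q))
    (hsupp : ∀ᶠ Q in atTop, ∀ᵐ x ∂μs Q, x ∈ Set.Icc a b) (hμ : ∀ᵐ x ∂μ, x ∈ Set.Icc a b)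
    (hmom : ∀ ℓ : ℕ, Tendsto (fun Q => ∫ x, x ^ ℓ ∂μs Q) atTop (𝓝 (∫ x, x ^ ℓ ∂μ)))
    {f : ℝ → ℝ} (hf : Continuous f) :
    Tendsto (fun Q => ∫ x, f x ∂μs Q) atTop (𝓝 (∫ x, f x ∂μ)) := by
  rw [Metric.tendsto_nhds]
  intro ε hε
  obtain ⟨p, hp⟩ := exists_polynomial_near_of_continuousOn a b f hf.continuousOn (ε / 3)
    (by positivity)
  have happrox : ∀ (ν : Measure ℝ) [IsProbabilityMeasure ν], (∀ᵐ x ∂ν, x ∈ Set.Icc a b) →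
      |∫ x, f x ∂ν - ∫ x, p.eval x ∂ν| ≤ ε / 3 := by
    intro ν _ hν
    rw [← integral_sub (integrable_of_ae_mem_Icc hν hf)
      (integrable_of_ae_mem_Icc hν p.continuous), ← Real.norm_eq_abs]
    refine (norm_integral_le_of_norm_le_const (C := ε / 3) ?_).trans (by simp)
    filter_upwards [hν] with x hx
    rw [Real.norm_eq_abs, abs_sub_comm]
    exact (hp x hx).le
  have hpoly : Tendsto (fun Q => ∫ x, p.eval x ∂μs Q) atTop (𝓝 (∫ x, p.eval x ∂μ)) := by
    rw [integral_polynomial hμ]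
    have h1 : Tendsto (fun Q => ∑ i ∈ Finset.range (p.natDegree + 1),
        p.coeff i * ∫ x, x ^ i ∂μs Q) atTop
        (𝓝 (∑ i ∈ Finset.range (p.natDegree + 1), p.coeff i * ∫ x, x ^ i ∂μ)) :=
      tendsto_finsetSum _ fun i _ => (hmom i).const_mul _
    refine h1.congr' ?_
    filter_upwards [hprob, hsupp] with Q hQ hQ'
    exact (integral_polynomial hQ' p).symm
  filter_upwards [hprob, hsupp, Metric.tendsto_nhds.1 hpoly (ε / 3) (by positivity)] with Q h1 h2 h3
  have h4 := happrox (μs Q) h2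
  have h5 := happrox μ hμ
  rw [Real.dist_eq] at h3 ⊢
  rw [abs_le] at h4 h5
  rw [abs_lt] at h3 ⊢
  constructor <;> linarith [h4.1, h4.2, h5.1, h5.2, h3.1, h3.2]

/-- A probability measure whose moments grow at most geometrically has bounded support. -/
theorem ae_mem_Icc_of_moments_le {ν : Measure ℝ} [IsProbabilityMeasure ν] {C : ℝ} (hC : 0 ≤ C)
    (hint : ∀ ℓ : ℕ, Integrable (fun x : ℝ => x ^ ℓ) ν)
    (hmom : ∀ ℓ : ℕ, |∫ x, x ^ ℓ ∂ν| ≤ C ^ ℓ) : ∀ᵐ x ∂ν, x ∈ Set.Icc (-C) C := by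
  have hkey : ∀ δ : ℝ, 0 < δ → ν.real {x | C + δ ≤ |x|} = 0 := by
    intro δ hδ
    -- Markov's inequality for the moment of order `2 k`; the right-hand side tends to `0` as `k`
    -- grows.
    have hbound : ∀ k : ℕ, ν.real {x | C + δ ≤ |x|} ≤ ((C / (C + δ)) ^ 2) ^ k := by
      intro k
      have hpos : 0 < (C + δ) ^ (2 * k) := by positivity
      have h1 := mul_meas_ge_le_integral_of_nonneg (μ := ν) (f := fun x : ℝ => x ^ (2 * k))
        (ae_of_all _ fun x => by change (0 : ℝ) ≤ x ^ (2 * k); rw [pow_mul]; positivity) (hint (2 * k)) ((C + δ) ^ (2 * k))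
      have h2 : ν.real {x | C + δ ≤ |x|} ≤ ν.real {x | (C + δ) ^ (2 * k) ≤ x ^ (2 * k)} := by
        refine measureReal_mono fun x hx => ?_
        have h3 : x ^ (2 * k) = |x| ^ (2 * k) := by rw [pow_mul, pow_mul, sq_abs]
        rw [Set.mem_ofPred_eq, h3]
        exact pow_le_pow_left₀ (by positivity) hx _
      have h4 := (le_abs_self _).trans (hmom (2 * k))
      rw [← pow_mul, div_pow, le_div_iff₀ hpos, mul_comm]
      exact ((mul_le_mul_of_nonneg_left h2 hpos.le).trans h1).trans h4
    have hlt : (C / (C + δ)) ^ 2 < 1 := by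
      refine pow_lt_one₀ (by positivity) ?_ two_ne_zero
      rw [div_lt_one (by positivity)]
      linarith
    exact le_antisymm (ge_of_tendsto' (tendsto_pow_atTop_nhds_zero_of_lt_one (by positivity) hlt)
      hbound) measureReal_nonneg
  have hall : ∀ n : ℕ, ∀ᵐ x ∂ν, |x| < C + 1 / ((n : ℝ) + 1) := by
    intro n
    have h1 := hkey (1 / ((n : ℝ) + 1)) (by positivity)
    rw [measureReal_eq_zero_iff] at h1
    filter_upwards [measure_eq_zero_iff_ae_notMem.1 h1] with x hx
    simpa using hx
  filter_upwards [ae_all_iff.2 hall] with x hx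
  rw [Set.mem_Icc, ← abs_le]
  have h1 : Tendsto (fun n : ℕ => C + 1 / ((n : ℝ) + 1)) atTop (𝓝 (C + 0)) :=
    tendsto_const_nhds.add tendsto_one_div_add_atTop_nhds_zero_nat
  rw [add_zero] at h1
  exact ge_of_tendsto' h1 fun n => (hx n).le

/-- A constant sequence of measures converges weakly both to itself and, by its moments, to `μ`. -/
theorem eq_of_moments_eq {μ ν : Measure ℝ} [IsProbabilityMeasure μ] [IsProbabilityMeasure ν] {a b : ℝ}
    (hμ : ∀ᵐ x ∂μ, x ∈ Set.Icc a b) (hν : ∀ᵐ x ∂ν, x ∈ Set.Icc a b)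
    (h : ∀ ℓ : ℕ, ∫ x, x ^ ℓ ∂ν = ∫ x, x ^ ℓ ∂μ) : ν = μ := by
  refine ext_of_forall_integral_eq_of_IsFiniteMeasure fun f => ?_
  have h1 := tendsto_integral_of_tendsto_moments (μs := fun _ => ν) (μ := μ) (a := a) (b := b)
    (Eventually.of_forall fun _ => inferInstance) (Eventually.of_forall fun _ => hν) hμ
    (fun ℓ => by rw [h ℓ]; exact tendsto_const_nhds) f.continuous
  exact tendsto_nhds_unique tendsto_const_nhds h1

/-- A limit of moment sequences of probability measures on `[0, C]` is a moment sequence of a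
probability measure on `[0, C]`. -/
theorem exists_measure_of_tendsto_moments {C : ℝ} (hC : 0 ≤ C) {μs : ℕ → Measure ℝ}
    (hprob : ∀ᶠ Q in atTop, IsProbabilityMeasure (μs Q))
    (hsupp : ∀ᶠ Q in atTop, ∀ᵐ x ∂μs Q, x ∈ Set.Icc 0 C) {m : ℕ → ℝ}
    (hmom : ∀ ℓ : ℕ, Tendsto (fun Q => ∫ x, x ^ ℓ ∂μs Q) atTop (𝓝 (m ℓ))) :
    ∃ μ : ProbabilityMeasure ℝ, (∀ᵐ x ∂(μ : Measure ℝ), x ∈ Set.Icc 0 C) ∧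
      ∀ ℓ : ℕ, ∫ x, x ^ ℓ ∂(μ : Measure ℝ) = m ℓ := by
  -- Pushing the measures to the compact space `[0, C]` makes the space of probability measures
  -- compact. Projecting changes nothing almost everywhere once the measures are supported there; a
  -- point mass serves for the indices at which `μs Q` is not a probability measure.
  set proj : ℝ → Set.Icc (0 : ℝ) C := Set.projIcc 0 C hC with hproj
  have hprojm : Measurable proj := continuous_projIcc.measurable
  have hρ' : ∀ Q, ∃ ρ : ProbabilityMeasure (Set.Icc (0 : ℝ) C),
      IsProbabilityMeasure (μs Q) → (ρ : Measure (Set.Icc (0 : ℝ) C)) = (μs Q).map proj := by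
    intro Q
    by_cases hQ : IsProbabilityMeasure (μs Q)
    · exact ⟨⟨(μs Q).map proj, Measure.isProbabilityMeasure_map hprojm.aemeasurable⟩, fun _ => rfl⟩
    · exact ⟨⟨Measure.dirac (proj 0), inferInstance⟩, fun h => absurd h hQ⟩
  choose ρ hρ using hρ'
  -- A limit along a single ultrafilter suffices, since the moments already converge along the whole
  -- sequence.
  obtain ⟨ν, -, hν⟩ := isCompact_univ.ultrafilter_le_nhds
    ((hyperfilter ℕ).map ρ) (by simp)
  have hνt : Tendsto ρ (hyperfilter ℕ) (𝓝 ν) := hν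
  have hatTop : (hyperfilter ℕ : Filter ℕ) ≤ atTop := Nat.hyperfilter_le_atTop
  refine ⟨ν.map (f := Subtype.val) measurable_subtype_coe.aemeasurable, ?_, fun ℓ => ?_⟩
  · rw [ProbabilityMeasure.toMeasure_map]
    exact (ae_map_iff measurable_subtype_coe.aemeasurable (p := fun x => x ∈ Set.Icc 0 C)
      measurableSet_Icc).2 (ae_of_all _ fun x => x.2)
  · rw [ProbabilityMeasure.toMeasure_map, integral_map measurable_subtype_coe.aemeasurable
      (continuous_pow ℓ).aestronglyMeasurable]
    set f : BoundedContinuousFunction (Set.Icc (0 : ℝ) C) ℝ :=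
      BoundedContinuousFunction.mkOfCompact ⟨fun x => (x : ℝ) ^ ℓ, by fun_prop⟩ with hf
    have h1 := (ProbabilityMeasure.tendsto_iff_forall_integral_tendsto.1 hνt) f
    refine tendsto_nhds_unique h1 (((hmom ℓ).mono_left hatTop).congr' ?_)
    filter_upwards [hatTop hprob, hatTop hsupp] with Q hQ hQ'
    rw [hρ Q hQ]
    change _ = ∫ x, (x : ℝ) ^ ℓ ∂((μs Q).map proj)
    rw [integral_map hprojm.aemeasurable (by fun_prop)]
    refine integral_congr_ae ?_
    filter_upwards [hQ'] with x hx
    rw [hproj, Set.projIcc_of_mem hC hx]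

/-! ### The eigenvalue distributions -/

theorem coe_eigenvalueDist (Q N : ℕ) : (eigenvalueDist Q N : Measure ℝ) =
    (N : ℝ≥0)⁻¹ • ∑ i : Fin N, Measure.dirac (sieveEigenvalue Q N i / (N : ℝ)) := rfl

theorem isProbabilityMeasure_eigenvalueDist {Q N : ℕ} (hN : 0 < N) :
    IsProbabilityMeasure (eigenvalueDist Q N : Measure ℝ) := by
  constructor
  rw [coe_eigenvalueDist, Measure.smul_apply, Measure.finsetSum_apply]
  have h1 : (N : ℝ≥0) ≠ 0 := by exact_mod_cast hN.ne'
  simp only [measure_univ, Finset.sum_const, Finset.card_univ, Fintype.card_fin, nsmul_eq_mul,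
    mul_one]
  rw [ENNReal.smul_def, smul_eq_mul, ← ENNReal.coe_natCast, ← ENNReal.coe_mul, inv_mul_cancel₀ h1]
  rfl

theorem ae_eigenvalueDist {Q N : ℕ} {P : ℝ → Prop} (hP : ∀ i, P (sieveEigenvalue Q N i / N)) :
    ∀ᵐ x ∂(eigenvalueDist Q N : Measure ℝ), P x := by
  rw [coe_eigenvalueDist]
  refine Measure.ae_smul_measure ?_ _
  rw [ae_finsetSum_measure_iff]
  intro i _
  rw [ae_dirac_eq]
  exact hP i

theorem integral_eigenvalueDist (Q N : ℕ) (f : ℝ → ℝ) :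
    ∫ x, f x ∂(eigenvalueDist Q N : Measure ℝ) =
      (N : ℝ)⁻¹ * ∑ i, f (sieveEigenvalue Q N i / N) := by
  rw [coe_eigenvalueDist, integral_smul_nnreal_measure, integral_finsetSum_measure]
  · simp [integral_dirac, NNReal.smul_def]
  · intro i _
    exact integrable_dirac (by simp)

/-- A bound for the supports of the scaled eigenvalue distributions. -/
def supportBound (α : ℝ) : ℝ := 4 * (3 * sepConst (1 + 1 / α) 2).toReal

theorem supportBound_nonneg (α : ℝ) : 0 ≤ supportBound α := by
  unfold supportBound
  positivity

theorem eventually_eigenvalueDist {N : ℕ → ℕ} {α : ℝ} (hα : 0 < α)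
    (hN : Tendsto (fun Q : ℕ => (N Q : ℝ) / (Q : ℝ) ^ 2) atTop (𝓝 α)) :
    (∀ᶠ Q in atTop, IsProbabilityMeasure (eigenvalueDist Q (N Q) : Measure ℝ)) ∧
    ∀ᶠ Q in atTop, ∀ᵐ x ∂(eigenvalueDist Q (N Q) : Measure ℝ), x ∈ Set.Icc 0 (supportBound α) := by
  have hgood := eventually_good hα hN
  constructor
  · filter_upwards [hgood] with Q hQ
    exact isProbabilityMeasure_eigenvalueDist hQ.2.1
  · filter_upwards [hgood] with Q hQ
    refine ae_eigenvalueDist fun i => ?_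
    have hNQ : (0 : ℝ) < N Q := by exact_mod_cast hQ.2.1
    refine ⟨div_nonneg (sieveEigenvalue_nonneg Q (N Q) i) hNQ.le, ?_⟩
    rw [div_le_iff₀ hNQ, supportBound]
    exact (sieveEigenvalue_le hQ.1 hQ.2.1 hQ.2.2 i).trans (le_of_eq (by ring))

theorem tendsto_moments_eigenvalueDist {N : ℕ → ℕ} {α : ℝ} (hα : 0 < α)
    (hN : Tendsto (fun Q : ℕ => (N Q : ℝ) / (Q : ℝ) ^ 2) atTop (𝓝 α)) (ℓ : ℕ) :
    Tendsto (fun Q => ∫ x, x ^ ℓ ∂(eigenvalueDist Q (N Q) : Measure ℝ)) atTop (𝓝 (M ℓ α)) := by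
  simp_rw [integral_eigenvalueDist]
  exact tendsto_average_sieveEigenvalue_pow hα hN ℓ

/-! ### Non-degeneracy of the limit -/

theorem tsum_enorm_indicator_sincChain_le {α : ℝ} (hα : 0 < α) (k : ℕ) (p : ℝ × ℝ) :
    ∑' t : Fin (k + 1) → Pair, ‖(tupleDomain t).indicator (sincChain α t) p‖ₑ ≤ sincConst α k := by
  simp_rw [enorm_indicator_eq_indicator_enorm]
  by_cases hp : 0 < p.2 ∧ p.2 ≤ 1
  · exact tsum_enorm_sincChain_le hα k hp.1 hp.2
  · have h1 : ∀ t : Fin (k + 1) → Pair,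
        (tupleDomain t).indicator (fun p => ‖sincChain α t p‖ₑ) p = 0 := by
      intro t
      refine Set.indicator_of_notMem (fun h => hp ?_) _
      have h1 := mem_tupleDomain.1 h
      exact ⟨pos_of_mem_localPairs h1.1.1 h1.1.2.1 (h1.2 0), h1.1.2.2⟩
    simp [h1]

/-- The local sum over tuples whose integral is, up to normalization, a moment. -/
def momentDensity (α : ℝ) (k : ℕ) (p : ℝ × ℝ) : ℝ :=
  ∑' t : Fin (k + 1) → Pair, (tupleDomain t).indicator (sincChain α t) p

theorem summable_momentDensity {α : ℝ} (hα : 0 < α) (k : ℕ) (p : ℝ × ℝ) :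
    Summable fun t : Fin (k + 1) → Pair => (tupleDomain t).indicator (sincChain α t) p := by
  have h1 := (tsum_enorm_indicator_sincChain_le hα k p).trans_lt (sincConst_lt_top hα k)
  refine Summable.of_norm ((ENNReal.summable_toReal h1.ne).congr fun t => ?_)
  simp

theorem abs_momentDensity_le {α : ℝ} (hα : 0 < α) (k : ℕ) (p : ℝ × ℝ) :
    |momentDensity α k p| ≤ (sincConst α k).toReal := by
  have h0 := tsum_enorm_indicator_sincChain_le hα k p
  have h1 := h0.trans_lt (sincConst_lt_top hα k)
  have h2 := (summable_momentDensity hα k p).norm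
  refine (norm_tsum_le_tsum_norm h2).trans ?_
  have h3 : ∑' t : Fin (k + 1) → Pair, ‖(tupleDomain t).indicator (sincChain α t) p‖ =
      (∑' t : Fin (k + 1) → Pair, ‖(tupleDomain t).indicator (sincChain α t) p‖ₑ).toReal := by
    rw [ENNReal.tsum_toReal_eq fun t => by simp]
    simp
  rw [h3]
  exact ENNReal.toReal_mono (sincConst_lt_top hα k).ne h0

theorem aestronglyMeasurable_momentDensity {α : ℝ} (hα : 0 < α) (k : ℕ) (μ : Measure (ℝ × ℝ)) :
    AEStronglyMeasurable (momentDensity α k) μ := by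
  refine aestronglyMeasurable_of_tendsto_ae (u := (atTop : Filter (Finset (Fin (k + 1) → Pair))))
    (f := fun S p => ∑ t ∈ S, (tupleDomain t).indicator (sincChain α t) p) (fun S => ?_)
    (ae_of_all _ fun p => (summable_momentDensity hα k p).hasSum)
  exact (Finset.measurable_sum _ fun t _ =>
    (measurable_sincChain α t).indicator (measurableSet_tupleDomain t)).aestronglyMeasurable

/-- The triangle `0 ≤ x ≤ y ≤ 1` without the origin. -/
def puncturedTriangle : Set (ℝ × ℝ) := tupleDomain fun _ : Fin 1 => basePair

theorem mem_puncturedTriangle {p : ℝ × ℝ} :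
    p ∈ puncturedTriangle ↔ 0 ≤ p.1 ∧ p.1 ≤ p.2 ∧ 0 < p.2 ∧ p.2 ≤ 1 := by
  rw [puncturedTriangle, mem_tupleDomain]
  simp only [localPairs, Set.mem_ofPred_eq, denom_basePair]
  constructor
  · rintro ⟨⟨h1, h2, h3⟩, h4⟩
    exact ⟨h1, h2, (h4 0).1, h3⟩
  · rintro ⟨h1, h2, h3, h4⟩
    exact ⟨⟨h1, h2, h4⟩, fun _ => ⟨h3, h4⟩⟩

theorem volume_puncturedTriangle : (volume : Measure (ℝ × ℝ)).real puncturedTriangle = 1 / 2 := by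
  rw [← volume_triangle Fin.elim0]
  refine measureReal_congr ?_
  have hne : ∀ᵐ p : ℝ × ℝ, p.2 ≠ 0 :=
    Measure.quasiMeasurePreserving_snd.ae (Measure.ae_ne volume (0 : ℝ))
  filter_upwards [hne] with p hp
  refine propext (mem_puncturedTriangle.trans (Iff.trans ?_ mem_tupleDomain.symm))
  constructor
  · rintro ⟨h1, h2, h3, h4⟩
    exact ⟨⟨h1, h2, h4⟩, fun i => i.elim0⟩
  · rintro ⟨⟨h1, h2, h3⟩, -⟩
    exact ⟨h1, h2, lt_of_le_of_ne (h1.trans h2) (Ne.symm hp), h3⟩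

theorem tupleDomain_subset_puncturedTriangle {k : ℕ} (t : Fin (k + 1) → Pair) :
    tupleDomain t ⊆ puncturedTriangle := by
  intro p hp
  have h1 := mem_tupleDomain.1 hp
  exact mem_puncturedTriangle.2
    ⟨h1.1.1, h1.1.2.1, pos_of_mem_localPairs h1.1.1 h1.1.2.1 (h1.2 0), h1.1.2.2⟩

theorem setIntegral_momentDensity {α : ℝ} (hα : 0 < α) (k : ℕ) :
    6 / (Real.pi ^ 2 * α) * ∫ p in puncturedTriangle, momentDensity α k p = M (k + 2) α := by
  rw [M_add_two]
  congr 1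
  have h1 : ∀ t : Fin (k + 1) → Pair, ∫⁻ p in puncturedTriangle,
      ‖(tupleDomain t).indicator (sincChain α t) p‖ₑ = ∫⁻ p in tupleDomain t, ‖sincChain α t p‖ₑ := by
    intro t
    simp_rw [enorm_indicator_eq_indicator_enorm]
    rw [setLIntegral_indicator (measurableSet_tupleDomain t),
      Set.inter_eq_left.2 (tupleDomain_subset_puncturedTriangle t)]
  unfold momentDensity
  rw [integral_tsum]
  · refine tsum_congr fun t => ?_
    rw [setIntegral_indicator (measurableSet_tupleDomain t),
      Set.inter_eq_right.2 (tupleDomain_subset_puncturedTriangle t)]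
  · exact fun t =>
      ((measurable_sincChain α t).indicator (measurableSet_tupleDomain t)).aestronglyMeasurable
  · simp_rw [h1]
    exact (tsum_lintegral_enorm_sincChain_lt_top hα k).ne

/-- The weight of a coprime pair at a point of the triangle. -/
def sincWeight (α : ℝ) (p : ℝ × ℝ) (i : Pair) : ℝ :=
  (localPairs p).indicator (fun i => Real.sinc (Real.pi * (α * offset p i))) i

theorem indicator_sincChain_one (α : ℝ) {p : ℝ × ℝ} (hp : p ∈ puncturedTriangle)
    (t : Fin 1 → Pair) :
    (tupleDomain t).indicator (sincChain α t) p = sincWeight α p (t 0) ^ 2 := by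
  rw [mem_puncturedTriangle] at hp
  by_cases h : t 0 ∈ localPairs p
  · rw [Set.indicator_of_mem, sincWeight, Set.indicator_of_mem h, sincChain, chain_eq]
    · rw [offset_basePair, zero_sub, mul_neg, mul_neg, Real.sinc_neg]
      simp [pow_two]
    · refine mem_tupleDomain.2 ⟨⟨hp.1, hp.2.1, hp.2.2.2⟩, fun i => ?_⟩
      rwa [Subsingleton.elim i 0]
  · rw [Set.indicator_of_notMem fun h' => h ((mem_tupleDomain.1 h').2 0), sincWeight,
      Set.indicator_of_notMem h]
    simp

theorem indicator_sincChain_two (α : ℝ) {p : ℝ × ℝ} (hp : p ∈ puncturedTriangle)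
    (t : Fin 2 → Pair) :
    (tupleDomain t).indicator (sincChain α t) p = sincWeight α p (t 0) * sincWeight α p (t 1) *
      Real.sinc (Real.pi * (α * (offset p (t 0) - offset p (t 1)))) := by
  rw [mem_puncturedTriangle] at hp
  by_cases h : t 0 ∈ localPairs p ∧ t 1 ∈ localPairs p
  · rw [Set.indicator_of_mem, sincWeight, sincWeight, Set.indicator_of_mem h.1,
      Set.indicator_of_mem h.2, sincChain, chain_eq]
    · have h1 : Real.sinc (Real.pi * (α * (offset p basePair - offset p (t 0)))) =
          Real.sinc (Real.pi * (α * offset p (t 0))) := by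
        rw [offset_basePair, zero_sub, mul_neg, mul_neg, Real.sinc_neg]
      rw [h1, offset_basePair, sub_zero, Fin.prod_univ_one]
      rfl
    · refine mem_tupleDomain.2 ⟨⟨hp.1, hp.2.1, hp.2.2.2⟩, Fin.forall_fin_two.2 h⟩
  · rw [Set.indicator_of_notMem fun h' => h (Fin.forall_fin_two.1 (mem_tupleDomain.1 h').2)]
    rw [not_and_or] at h
    rcases h with h | h
    · simp [sincWeight, Set.indicator_of_notMem h]
    · simp [sincWeight, Set.indicator_of_notMem h]

theorem hasSum_sincWeight_sq {α : ℝ} (hα : 0 < α) {p : ℝ × ℝ} (hp : p ∈ puncturedTriangle) :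
    HasSum (fun i => sincWeight α p i ^ 2) (momentDensity α 0 p) := by
  have h1 := (summable_momentDensity hα 0 p).hasSum
  rw [← (Equiv.funUnique (Fin 1) Pair).symm.hasSum_iff] at h1
  have h2 : ∀ i : Pair, ((fun t : Fin 1 → Pair => (tupleDomain t).indicator (sincChain α t) p) ∘
      (Equiv.funUnique (Fin 1) Pair).symm) i = sincWeight α p i ^ 2 := fun i => by
    simp only [Function.comp]
    rw [indicator_sincChain_one α hp]
    simp
  rw [← funext h2]
  exact h1

theorem hasSum_sincWeight_mul {α : ℝ} (hα : 0 < α) {p : ℝ × ℝ} (hp : p ∈ puncturedTriangle) :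
    HasSum (fun q : Pair × Pair => sincWeight α p q.1 * sincWeight α p q.2 *
      Real.sinc (Real.pi * (α * (offset p q.1 - offset p q.2)))) (momentDensity α 1 p) := by
  have h1 := (summable_momentDensity hα 1 p).hasSum
  rw [← (finTwoArrowEquiv Pair).symm.hasSum_iff] at h1
  have h2 : ∀ q : Pair × Pair, ((fun t : Fin 2 → Pair => (tupleDomain t).indicator (sincChain α t) p) ∘
      (finTwoArrowEquiv Pair).symm) q = sincWeight α p q.1 * sincWeight α p q.2 *
      Real.sinc (Real.pi * (α * (offset p q.1 - offset p q.2))) := fun q => by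
    simp only [Function.comp]
    rw [indicator_sincChain_two α hp]
    simp
  rw [← funext h2]
  exact h1

theorem sinc_eq_integral (u : ℝ) : Real.sinc u = ∫ s in (0 : ℝ)..1, Real.cos (u * s) := by
  rcases eq_or_ne u 0 with rfl | hu
  · simp
  · rw [intervalIntegral.integral_comp_mul_left (fun x => Real.cos x) hu, integral_cos,
      Real.sinc_of_ne_zero hu]
    simp [div_eq_inv_mul]

/-- Since `sinc u` is the mean of `cos (u s)` over `s ∈ [0, 1]`, the right side is the mean of `C ^
2 + D ^ 2` and the left side is the squared mean of `C`. This is Cauchy-Schwarz for the positive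
semidefinite kernel `sinc (x - y)`, with one argument at `0`. -/
theorem sq_sum_sinc_le {ι : Type*} (S : Finset ι) (w x : ι → ℝ) :
    (∑ i ∈ S, w i * Real.sinc (x i)) ^ 2 ≤
      ∑ q ∈ S ×ˢ S, w q.1 * w q.2 * Real.sinc (x q.1 - x q.2) := by
  set C : ℝ → ℝ := fun s => ∑ i ∈ S, w i * Real.cos (x i * s) with hC
  set D : ℝ → ℝ := fun s => ∑ i ∈ S, w i * Real.sin (x i * s) with hD
  have hCc : Continuous C := by fun_prop
  have hDc : Continuous D := by fun_prop
  have h1 : ∑ i ∈ S, w i * Real.sinc (x i) = ∫ s in (0 : ℝ)..1, C s := by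
    rw [hC, intervalIntegral.integral_finsetSum]
    · simp_rw [intervalIntegral.integral_const_mul, sinc_eq_integral]
    · exact fun i _ => Continuous.intervalIntegrable (by fun_prop) _ _
  have h2 : ∑ q ∈ S ×ˢ S, w q.1 * w q.2 * Real.sinc (x q.1 - x q.2) =
      ∫ s in (0 : ℝ)..1, (C s ^ 2 + D s ^ 2) := by
    have h3 : ∀ s, C s ^ 2 + D s ^ 2 =
        ∑ q ∈ S ×ˢ S, w q.1 * w q.2 * Real.cos ((x q.1 - x q.2) * s) := by
      intro s
      rw [pow_two, pow_two, hC, hD]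
      simp only
      rw [Finset.sum_mul_sum, Finset.sum_mul_sum, ← Finset.sum_product', ← Finset.sum_product',
        ← Finset.sum_add_distrib]
      refine Finset.sum_congr rfl fun q _ => ?_
      rw [sub_mul, Real.cos_sub]
      ring
    simp_rw [h3]
    rw [intervalIntegral.integral_finsetSum]
    · simp_rw [intervalIntegral.integral_const_mul, sinc_eq_integral]
    · exact fun i _ => Continuous.intervalIntegrable (by fun_prop) _ _
  rw [h1, h2]
  set c := ∫ s in (0 : ℝ)..1, C s with hc
  -- The integrand is `(C s - c) ^ 2 + D s ^ 2`, expanded so that its integral can be read off.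
  have h4 : ∫ s in (0 : ℝ)..1, (C s ^ 2 + D s ^ 2) - (2 * c * C s - c ^ 2) =
      (∫ s in (0 : ℝ)..1, (C s ^ 2 + D s ^ 2)) - (2 * c * c - c ^ 2) := by
    rw [intervalIntegral.integral_sub, intervalIntegral.integral_sub,
      intervalIntegral.integral_const_mul, ← hc]
    · simp
    all_goals exact Continuous.intervalIntegrable (by fun_prop) _ _
  have h5 : 0 ≤ ∫ s in (0 : ℝ)..1, (C s ^ 2 + D s ^ 2) - (2 * c * C s - c ^ 2) := by
    refine intervalIntegral.integral_nonneg zero_le_one fun s _ => ?_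
    nlinarith [sq_nonneg (C s - c), sq_nonneg (D s)]
  rw [h4] at h5
  linarith

/-- For the kernel `G i j = sinc (π α (h_i - h_j))` on the local pairs, the two densities are the
entries of `G ^ 2` and `G ^ 3` at `basePair`, where `G` itself has entry `1`. The inequality is
Cauchy-Schwarz, first on finite sets of pairs and then in the limit. -/
theorem sq_momentDensity_le {α : ℝ} (hα : 0 < α) {p : ℝ × ℝ} (hp : p ∈ puncturedTriangle) :
    momentDensity α 0 p ^ 2 ≤ momentDensity α 1 p := by
  have h1 : Tendsto (fun S : Finset Pair => (∑ i ∈ S, sincWeight α p i ^ 2) ^ 2) atTop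
      (𝓝 (momentDensity α 0 p ^ 2)) := Tendsto.pow (hasSum_sincWeight_sq hα hp) 2
  have h2 := Tendsto.comp (hasSum_sincWeight_mul hα hp)
    (tendsto_finsetProd_atTop.comp (tendsto_atTop_diagonal (α := Finset Pair)))
  refine le_of_tendsto_of_tendsto' h1 h2 fun S => ?_
  have h3 := sq_sum_sinc_le S (sincWeight α p) fun i => Real.pi * (α * offset p i)
  have h4 : ∀ i, sincWeight α p i ^ 2 =
      sincWeight α p i * Real.sinc (Real.pi * (α * offset p i)) := by
    intro i
    by_cases hi : i ∈ localPairs p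
    · simp only [sincWeight, Set.indicator_of_mem hi, pow_two]
    · simp [sincWeight, Set.indicator_of_notMem hi]
  simp_rw [h4]
  refine h3.trans (le_of_eq (Finset.sum_congr rfl fun q _ => ?_))
  rw [mul_sub, mul_sub]

theorem sum_sincWeight_sq_le {α : ℝ} (hα : 0 < α) {p : ℝ × ℝ} (hp : p ∈ puncturedTriangle)
    (S : Finset Pair) : ∑ i ∈ S, sincWeight α p i ^ 2 ≤ momentDensity α 0 p :=
  sum_le_hasSum S (fun _ _ => sq_nonneg _) (hasSum_sincWeight_sq hα hp)

theorem sincWeight_basePair (α : ℝ) {p : ℝ × ℝ} (hp : p ∈ puncturedTriangle) :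
    sincWeight α p basePair = 1 := by
  rw [mem_puncturedTriangle] at hp
  rw [sincWeight, Set.indicator_of_mem]
  · simp
  · simpa [localPairs] using hp.2.2

theorem one_le_momentDensity {α : ℝ} (hα : 0 < α) {p : ℝ × ℝ} (hp : p ∈ puncturedTriangle) :
    1 ≤ momentDensity α 0 p := by
  simpa [sincWeight_basePair α hp] using sum_sincWeight_sq_le hα hp {basePair}

/-- The only local pair with `B = 0` is `basePair`; for every other pair the numerator is at least
`1` in absolute value and the denominator is at most `y`. -/
theorem inv_le_abs_offset {p : ℝ × ℝ} (hp : 0 < p.2) {i : Pair} (hi : i ∈ localPairs p)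
    (hib : i ≠ basePair) : p.2⁻¹ ≤ |offset p i| := by
  obtain ⟨h1, h2⟩ := hi
  have hB : i.1.2 ≠ 0 := by
    intro hB
    have h3 := i.2
    rw [hB, Int.gcd_zero_right] at h3
    have h4 : (0 : ℝ) < i.1.1 := by
      rw [denom, hB] at h1
      simp only [Int.cast_zero, zero_mul, sub_zero] at h1
      exact pos_of_mul_pos_left h1 hp.le
    have h5 : 0 < i.1.1 := by exact_mod_cast h4
    refine hib (Subtype.ext (Prod.ext ?_ hB))
    change i.1.1 = 1
    omega
  have h3 : (1 : ℝ) ≤ |(i.1.2 : ℝ)| := by exact_mod_cast Int.one_le_abs hB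
  rw [offset_eq, abs_div, abs_of_pos (mul_pos hp h1), inv_eq_one_div]
  exact div_le_div₀ (abs_nonneg _) h3 (mul_pos hp h1) (mul_le_of_le_one_right hp.le h2)

/-- Near the origin all pairs but `basePair` have offset at least `1 / y`. Of the square of each
weight, the power `1/2` supplies the small factor and the power `3/2` keeps the sum convergent. -/
theorem momentDensity_le {α : ℝ} (hα : 0 < α) {p : ℝ × ℝ} (hp : p ∈ puncturedTriangle) :
    momentDensity α 0 p ≤ 1 + ((1 + 1 / α) * p.2) ^ (1 / 2 : ℝ) *
      (sepConst (1 + 1 / α) (3 / 2)).toReal := by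
  classical
  set B := 1 + 1 / α with hB
  have hB0 : 0 < B := by positivity
  have hy : 0 < p.2 := (mem_puncturedTriangle.1 hp).2.2.1
  have hsum := (hasSum_sincWeight_sq hα hp)
  rw [← hsum.tsum_eq, hsum.summable.tsum_eq_add_tsum_ite basePair, sincWeight_basePair α hp,
    one_pow]
  refine add_le_add_right ?_ 1
  set f : Pair → ℝ := fun i => if i = basePair then 0 else sincWeight α p i ^ 2 with hf
  have hf0 : ∀ i, 0 ≤ f i := fun i => by simp only [hf]; split_ifs <;> positivity
  have hfs : Summable f := Summable.of_nonneg_of_le hf0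
    (fun i => by simp only [hf]; split_ifs <;> [positivity; exact le_rfl]) hsum.summable
  have hfl : ∀ i : Pair, ENNReal.ofReal (f i) ≤
      (localPairs p).indicator (fun i => ENNReal.ofReal ((B * p.2) ^ (1 / 2 : ℝ)) *
        ENNReal.ofReal ((B / (1 + |offset p i - 0|)) ^ (3 / 2 : ℝ))) i := by
    intro i
    by_cases hi : i ∈ localPairs p
    · rw [Set.indicator_of_mem hi, ← ENNReal.ofReal_mul (by positivity)]
      refine ENNReal.ofReal_le_ofReal ?_
      simp only [hf]
      split_ifs with hib
      · positivity
      · have h1 : |sincWeight α p i| ≤ B / (1 + |offset p i|) := by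
          rw [sincWeight, Set.indicator_of_mem hi]
          exact abs_sinc_le_div hα _
        have h2 : B / (1 + |offset p i|) ≤ B * p.2 := by
          rw [div_eq_mul_inv]
          refine mul_le_mul_of_nonneg_left ?_ hB0.le
          refine inv_le_of_inv_le₀ hy ?_
          exact (inv_le_abs_offset hy hi hib).trans (by linarith)
        have h3 : 0 < B / (1 + |offset p i|) := by positivity
        rw [sub_zero, ← sq_abs]
        calc |sincWeight α p i| ^ 2 ≤ (B / (1 + |offset p i|)) ^ 2 := by gcongr
          _ = (B / (1 + |offset p i|)) ^ (1 / 2 : ℝ) * (B / (1 + |offset p i|)) ^ (3 / 2 : ℝ) := by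
              rw [← Real.rpow_add h3, ← Real.rpow_natCast]
              norm_num
          _ ≤ _ := by gcongr
    · rw [Set.indicator_of_notMem hi]
      simp [hf, sincWeight, Set.indicator_of_notMem hi]
  have hK := sepConst_lt_top hB0.le (show (1 : ℝ) < 3 / 2 by norm_num)
  have hle : ENNReal.ofReal (∑' i, f i) ≤
      ENNReal.ofReal ((B * p.2) ^ (1 / 2 : ℝ)) * sepConst B (3 / 2) := by
    rw [ENNReal.ofReal_tsum_of_nonneg hf0 hfs]
    refine (ENNReal.tsum_le_tsum hfl).trans ?_
    rw [← tsum_subtype, ENNReal.tsum_mul_left]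
    gcongr
    exact tsum_separated_le (fun i : localPairs p => offset p i)
      (fun i j hij => one_le_abs_offset_sub hy i.2 j.2 fun h => hij (Subtype.ext h)) hB0.le
      (by norm_num) 0
  rwa [← ENNReal.ofReal_toReal hK.ne, ← ENNReal.ofReal_mul (by positivity),
    ENNReal.ofReal_le_ofReal_iff (by positivity)] at hle

/-- If the second and third moments were powers of the first one, the local density would be
constant. -/
theorem ae_momentDensity_eq {α : ℝ} (hα : 0 < α) (h2 : M 2 α = M 1 α ^ 2)
    (h3 : M 3 α = M 1 α ^ 3) :
    ∀ᵐ p : ℝ × ℝ, p ∈ puncturedTriangle → momentDensity α 0 p = M 1 α := by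
  set m := M 1 α with hm
  have hm' : m = 3 / (Real.pi ^ 2 * α) := rfl
  have hm0 : 0 < m := by rw [hm']; positivity
  -- The triangle has area `1/2`, so twice Lebesgue measure is a probability measure on it. With
  -- this normalisation `M 2` and `M 3` are `m` times the means of the two densities, and the
  -- hypotheses say that these means are `m` and `m ^ 2`.
  have hc : 6 / (Real.pi ^ 2 * α) = 2 * m := by rw [hm']; ring
  have hTm : MeasurableSet puncturedTriangle := measurableSet_tupleDomain _
  have hfin : volume puncturedTriangle < ∞ := by
    refine lt_top_iff_ne_top.2 fun h => ?_
    have := volume_puncturedTriangle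
    rw [measureReal_def, h] at this
    norm_num at this
  have : IsFiniteMeasure (volume.restrict puncturedTriangle) := ⟨by simpa using hfin⟩
  have hint : ∀ k, IntegrableOn (momentDensity α k) puncturedTriangle := fun k =>
    Integrable.of_bound (aestronglyMeasurable_momentDensity hα k _) (sincConst α k).toReal
      (ae_of_all _ fun p => abs_momentDensity_le hα k p)
  have hI2 := setIntegral_momentDensity hα 0
  have hI3 := setIntegral_momentDensity hα 1
  rw [hc] at hI2 hI3
  have hJ2 : ∫ p in puncturedTriangle, momentDensity α 0 p = m / 2 := by
    refine mul_left_cancel₀ (mul_pos two_pos hm0).ne' ?_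
    rw [hI2, zero_add, h2]
    ring
  have hJ3 : ∫ p in puncturedTriangle, momentDensity α 1 p = m ^ 2 / 2 := by
    refine mul_left_cancel₀ (mul_pos two_pos hm0).ne' ?_
    rw [hI3, show 1 + 2 = 3 from rfl, h3]
    ring
  -- By `sq_momentDensity_le` this function dominates the squared deviation of the first density
  -- from `m`, while its integral is zero.
  set G : ℝ × ℝ → ℝ := fun p => momentDensity α 1 p - 2 * m * momentDensity α 0 p + m ^ 2 with hG
  have hGint : IntegrableOn G puncturedTriangle :=
    ((hint 1).sub ((hint 0).const_mul _)).add (integrable_const _)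
  have hG0 : ∫ p in puncturedTriangle, G p = 0 := by
    have h4 : IntegrableOn (fun p => momentDensity α 1 p - 2 * m * momentDensity α 0 p)
        puncturedTriangle := (hint 1).sub ((hint 0).const_mul _)
    simp only [hG]
    rw [integral_add h4 (integrable_const _),
      integral_sub (hint 1) ((hint 0).const_mul _), integral_const_mul, hJ2, hJ3, setIntegral_const,
      volume_puncturedTriangle, smul_eq_mul]
    ring
  have hGge : ∀ p ∈ puncturedTriangle, (momentDensity α 0 p - m) ^ 2 ≤ G p := by
    intro p hp
    have := sq_momentDensity_le hα hp
    simp only [hG]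
    nlinarith
  have hae := (setIntegral_eq_zero_iff_of_nonneg_ae ((ae_restrict_iff' hTm).2
    (ae_of_all _ fun p hp => (sq_nonneg _).trans (hGge p hp))) hGint).1 hG0
  filter_upwards [(ae_restrict_iff' hTm).1 hae] with p hp hpT
  have h4 := hGge p hpT
  rw [hp hpT] at h4
  have h5 : momentDensity α 0 p - m = 0 := by
    simpa using le_antisymm h4 (sq_nonneg _)
  linarith

/-- The constant value of the density would be `1`, by its behaviour near the origin. This fixes
`α`, and for that `α` the pair `(1, 1)` makes a positive additional contribution near the corner
`(0, 1)`. -/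
theorem moments_ne_pow {α : ℝ} (hα : 0 < α) (h2 : M 2 α = M 1 α ^ 2) (h3 : M 3 α = M 1 α ^ 3) :
    False := by
  -- A set of full measure meets every nonempty open set, so suitable points can be chosen without
  -- any continuity of the density.
  have hdense := Measure.dense_of_ae (ae_momentDensity_eq hα h2 h3)
  set m := M 1 α with hm
  have hm1 : m = 1 := by
    refine le_antisymm ?_ ?_
    · set K := (sepConst (1 + 1 / α) (3 / 2)).toReal with hK
      have hlim : Tendsto (fun δ : ℝ => 1 + ((1 + 1 / α) * δ) ^ (1 / 2 : ℝ) * K) (𝓝[>] 0)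
          (𝓝 1) := by
        have hcont : Continuous fun δ : ℝ => 1 + ((1 + 1 / α) * δ) ^ (1 / 2 : ℝ) * K :=
          continuous_const.add (((continuous_const.mul continuous_id).rpow_const
            fun _ => Or.inr (by norm_num)).mul continuous_const)
        have h4 := (hcont.tendsto 0).mono_left (nhdsWithin_le_nhds (s := Set.Ioi 0))
        rwa [mul_zero, Real.zero_rpow (by norm_num), zero_mul, add_zero] at h4
      refine ge_of_tendsto hlim ?_
      filter_upwards [Ioo_mem_nhdsGT (show (0 : ℝ) < 1 by norm_num)] with δ hδ
      have hopen : IsOpen {p : ℝ × ℝ | 0 < p.1 ∧ p.1 < p.2 ∧ p.2 < δ} :=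
        (isOpen_lt continuous_const continuous_fst).inter
          ((isOpen_lt continuous_fst continuous_snd).inter
            (isOpen_lt continuous_snd continuous_const))
      obtain ⟨p, hp, hpU⟩ := hdense.exists_mem_open hopen
        ⟨(δ / 3, δ / 2), by
          have := hδ.1
          exact ⟨by positivity, by change δ / 3 < δ / 2; linarith,
            by change δ / 2 < δ; linarith⟩⟩
      obtain ⟨hp1, hp2, hp3⟩ := hpU
      have hpT : p ∈ puncturedTriangle := mem_puncturedTriangle.2
        ⟨hp1.le, hp2.le, hp1.trans hp2, (hp3.trans hδ.2).le⟩
      rw [← hp hpT]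
      refine (momentDensity_le hα hpT).trans ?_
      have := hp1.trans hp2
      gcongr
    · have hopen : IsOpen {p : ℝ × ℝ | 0 < p.1 ∧ p.1 < p.2 ∧ p.2 < 1} :=
        (isOpen_lt continuous_const continuous_fst).inter
          ((isOpen_lt continuous_fst continuous_snd).inter
            (isOpen_lt continuous_snd continuous_const))
      obtain ⟨p, hp, hpU⟩ := hdense.exists_mem_open hopen ⟨(1 / 3, 1 / 2), by norm_num⟩
      obtain ⟨hp1, hp2, hp3⟩ := hpU
      have hpT : p ∈ puncturedTriangle := mem_puncturedTriangle.2
        ⟨hp1.le, hp2.le, hp1.trans hp2, hp3.le⟩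
      rw [← hp hpT]
      exact one_le_momentDensity hα hpT
  have hα' : Real.pi ^ 2 * α = 3 := by
    have h4 : m = 3 / (Real.pi ^ 2 * α) := rfl
    rw [hm1, eq_div_iff (by positivity), one_mul] at h4
    exact h4
  have hopen : IsOpen {p : ℝ × ℝ | 0 < p.1 ∧ p.1 < 1 / 10 ∧ 9 / 10 < p.2 ∧ p.2 < 1} :=
    (isOpen_lt continuous_const continuous_fst).inter
      ((isOpen_lt continuous_fst continuous_const).inter
        ((isOpen_lt continuous_const continuous_snd).inter
          (isOpen_lt continuous_snd continuous_const)))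
  obtain ⟨p, hp, hpU⟩ := hdense.exists_mem_open hopen ⟨(1 / 20, 19 / 20), by norm_num⟩
  obtain ⟨hp1, hp2, hp3, hp4⟩ := hpU
  have hpT : p ∈ puncturedTriangle := mem_puncturedTriangle.2
    ⟨hp1.le, by linarith, by linarith, hp4.le⟩
  set i : Pair := ⟨(1, 1), by simp⟩ with hi
  have hden : denom i p = p.2 - p.1 := by simp [denom, hi]
  have hil : i ∈ localPairs p := by
    constructor <;> rw [hden] <;> linarith
  have hib : i ≠ basePair := by
    intro h
    have := congrArg (fun i : Pair => i.1.2) h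
    simp [hi, basePair] at this
  have hoff : offset p i = 1 / (p.2 * (p.2 - p.1)) := by
    rw [offset_eq, hden]
    simp [hi]
  have hprod : 7 / 10 < p.2 * (p.2 - p.1) := by nlinarith
  have hoff0 : 0 < offset p i := by rw [hoff]; positivity
  have hoff2 : offset p i < 2 := by
    rw [hoff, div_lt_iff₀ (by linarith)]
    linarith
  have harg0 : 0 < Real.pi * (α * offset p i) := by positivity
  have hargpi : Real.pi * (α * offset p i) < Real.pi := by
    -- From `π² α = 3` and `π > 3` follows `α < 1/2`, and the offset is below `2` in the chosen
    -- corner. The argument therefore stays in `(0, π)`, where `sinc` is positive.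
    have h4 : α * offset p i < 1 := by
      have h5 : (9 : ℝ) < Real.pi ^ 2 := by nlinarith [Real.pi_gt_three]
      have h6 : α < 1 / 2 := by nlinarith
      nlinarith
    nlinarith [Real.pi_pos]
  have hw : 0 < sincWeight α p i := by
    rw [sincWeight, Set.indicator_of_mem hil, Real.sinc_of_ne_zero harg0.ne']
    exact div_pos (Real.sin_pos_of_pos_of_lt_pi harg0 hargpi) harg0
  have hsum := sum_sincWeight_sq_le hα hpT {basePair, i}
  rw [Finset.sum_pair hib.symm, sincWeight_basePair α hpT, hp hpT, hm1] at hsum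
  nlinarith [sq_pos_of_pos hw]

end LargeSieve

end

/-! ### The limiting measure -/

theorem corollary1 (α : ℝ) (hα : 0 < α) :
    ∃ μ : ProbabilityMeasure ℝ,
      -- `μ` is concentrated on `[0, ∞)`
      (μ : Measure ℝ) (Set.Iio 0) = 0 ∧
      -- weak convergence along every `N = N(Q)` with `N ∼ α Q²` as `Q → ∞`
      (∀ N : ℕ → ℕ,
        (fun Q : ℕ => (N Q : ℝ)) ~[atTop] (fun Q : ℕ => α * (Q : ℝ) ^ 2) →
        Tendsto (fun Q : ℕ => LargeSieve.eigenvalueDist Q (N Q)) atTop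
          (𝓝 μ.toFiniteMeasure)) ∧
      -- the moments of `μ` are the absolutely convergent expressions `M_ℓ(α)`
      (∀ k : ℕ, LargeSieve.AbsConvergent k α) ∧
      LargeSieve.HasMoments α μ ∧
      -- `μ` is determined by these moments
      (∀ ν : ProbabilityMeasure ℝ, LargeSieve.HasMoments α ν → ν = μ) ∧
      -- `μ` is non-degenerate
      0 < ProbabilityTheory.variance (fun t : ℝ => t) (μ : Measure ℝ) := by
  have hC := LargeSieve.supportBound_nonneg α
  set C := LargeSieve.supportBound α with hCdef
  -- One particular sequence with the right growth is used to construct `μ`. Every other such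
  -- sequence has the same limiting moments and hence the same limit.
  set N₀ : ℕ → ℕ := fun Q => ⌊α * (Q : ℝ) ^ 2⌋₊ with hN₀
  have hlim₀ : Tendsto (fun Q : ℕ => (N₀ Q : ℝ) / (Q : ℝ) ^ 2) atTop (𝓝 α) :=
    (tendsto_nat_floor_mul_div_atTop hα.le).comp
      ((tendsto_pow_atTop two_ne_zero).comp tendsto_natCast_atTop_atTop)
  obtain ⟨hprob₀, hsupp₀⟩ := LargeSieve.eventually_eigenvalueDist hα hlim₀
  obtain ⟨μ, hμ, hmom⟩ := LargeSieve.exists_measure_of_tendsto_moments hC hprob₀ hsupp₀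
    (LargeSieve.tendsto_moments_eigenvalueDist hα hlim₀)
  have hint : ∀ ℓ : ℕ, Integrable (fun t : ℝ => t ^ ℓ) (μ : Measure ℝ) := fun ℓ =>
    LargeSieve.integrable_of_ae_mem_Icc hμ (continuous_pow ℓ)
  refine ⟨μ, ?_, fun N hN => ?_, LargeSieve.absConvergent hα, fun ℓ => ⟨hint ℓ, hmom ℓ⟩,
    fun ν hν => ?_, ?_⟩
  · refine measure_eq_zero_iff_ae_notMem.2 ?_
    filter_upwards [hμ] with t ht
    exact not_lt.2 ht.1
  · have hlim : Tendsto (fun Q : ℕ => (N Q : ℝ) / (Q : ℝ) ^ 2) atTop (𝓝 α) := by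
      have hne : ∀ᶠ Q : ℕ in atTop, α * (Q : ℝ) ^ 2 ≠ 0 := by
        filter_upwards [eventually_gt_atTop 0] with Q hQ
        have : (0 : ℝ) < Q := by exact_mod_cast hQ
        positivity
      have h1 := ((isEquivalent_iff_tendsto_one hne).1 hN).const_mul α
      rw [mul_one] at h1
      refine h1.congr fun Q => ?_
      rw [Pi.div_apply, mul_div_assoc', mul_div_mul_left _ _ hα.ne']
    obtain ⟨hprob, hsupp⟩ := LargeSieve.eventually_eigenvalueDist hα hlim
    refine FiniteMeasure.tendsto_iff_forall_integral_tendsto.2 fun f => ?_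
    refine LargeSieve.tendsto_integral_of_tendsto_moments hprob hsupp hμ (fun ℓ => ?_) f.continuous
    rw [hmom ℓ]
    exact LargeSieve.tendsto_moments_eigenvalueDist hα hlim ℓ
  · have hμ' : ∀ᵐ x ∂(μ : Measure ℝ), x ∈ Set.Icc (-C) C := by
      filter_upwards [hμ] with x hx
      exact ⟨by linarith [hx.1], hx.2⟩
    -- A measure with the same moments inherits their geometric growth, which forces bounded
    -- support; only then does polynomial approximation apply to it.
    have hbound : ∀ ℓ : ℕ, |∫ x, x ^ ℓ ∂(ν : Measure ℝ)| ≤ C ^ ℓ := by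
      intro ℓ
      rw [(hν ℓ).2, ← hmom ℓ]
      have h1 : ∀ᵐ x ∂(μ : Measure ℝ), ‖x ^ ℓ‖ ≤ C ^ ℓ := by
        filter_upwards [hμ] with x hx
        rw [norm_pow, Real.norm_of_nonneg hx.1]
        exact pow_le_pow_left₀ hx.1 hx.2 ℓ
      simpa using norm_integral_le_of_norm_le_const h1
    have hν' := LargeSieve.ae_mem_Icc_of_moments_le hC (fun ℓ => (hν ℓ).1) hbound
    exact Subtype.ext (LargeSieve.eq_of_moments_eq (μ := (μ : Measure ℝ)) (ν := (ν : Measure ℝ)) hμ' hν' fun ℓ => (hν ℓ).2.trans (hmom ℓ).symm)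
  · refine (ProbabilityTheory.variance_nonneg _ _).lt_of_ne fun hvar => ?_
    have hL2 : MemLp (fun t : ℝ => t) 2 (μ : Measure ℝ) :=
      (memLp_two_iff_integrable_sq aestronglyMeasurable_id).2 (hint 2)
    -- With zero variance `μ` is concentrated at its mean, so every moment is a power of the first
    -- one.
    have hconst : ∀ᵐ t ∂(μ : Measure ℝ), t = LargeSieve.M 1 α := by
      have h1 := (ProbabilityTheory.evariance_eq_zero_iff aemeasurable_id).1
        ((hL2.ofReal_variance_eq.symm.trans (by rw [← hvar, ENNReal.ofReal_zero])))
      filter_upwards [h1] with t ht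
      rw [← hmom 1]
      simpa using ht
    have hpow : ∀ ℓ : ℕ, LargeSieve.M ℓ α = LargeSieve.M 1 α ^ ℓ := by
      intro ℓ
      rw [← hmom ℓ, integral_congr_ae (g := fun _ => LargeSieve.M 1 α ^ ℓ)]
      · simp
      · filter_upwards [hconst] with t ht
        rw [ht]
    exact LargeSieve.moments_ne_pow hα (hpow 2) (hpow 3)
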